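/- \textbf{Theorem (meromorphic continuation of $R_V$).} Let $V:\mathbb R^3\to\mathbb C$ be measurable, essentially bounded and compactly supported, and let $\Delta^2+V$ be the unbounded operator on $L^2(\mathbb R^3)$ with domain $H^4(\mathbb R^3)$. Let $\Sigma=\{\lambda\in\mathbb C:\operatorname{Re}\lambda>0,\ \operatorname{Im}\lambda>0\}$. For $\lambda\in\Sigma$ with $\lambda^4$ in the resolvent set of $\Delta^2+V$ put $R_V(\lambda)=(\Delta^2+V-\lambda^4)^{-1}:L^2(\mathbb R^3)\to L^2(\mathbb R^3)$. A family $A(\lambda)$ of bounded operators between two normed spaces is called a meromorphic family at $a\in\mathbb C$ if for all $\lambda\ne a$ near $a$ one has $A(\lambda)=A_0(\lambda)+\sum_{j=1}^N(\lambda-a)^{-j}B_j$, with $A_0$ analytic at $a$ in operator norm and $B_j$ bounded operators of finite rank. (i) The set $P$ of all $\lambda\in\Sigma$ such that $\lambda^4$ belongs to the spectrum of $\Delta^2+V$ is finite; $R_V$ is analytic on $\Sigma\setminus P$ and is a meromorphic family of bounded operators on $L^2(\mathbb R^3)$ at every point of $\Sigma$. In particular it has only finitely many poles in $\Sigma$.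 (ii) $R_V$ extends to a meromorphic family on $\mathbb C$ of operators $L^2_{\rm comp}(\mathbb R^3)\to H^4_{\rm loc}(\mathbb R^3)$: there are a set $S\subset\mathbb C$, finite in every compact set, with $S\cap\Sigma=P$, and linear maps $\mathcal R(\lambda):L^2_{\rm comp}(\mathbb R^3)\to H^4_{\rm loc}(\mathbb R^3)$, $\lambda\in\mathbb C\setminus S$, such that $\mathcal R(\lambda)f=R_V(\lambda)f$ for all $\lambda\in\Sigma\setminus S$ and $f\in L^2_{\rm comp}(\mathbb R^3)$, and such that for every $\rho\in C_c^\infty(\mathbb R^3)$ the operators $\rho\,\mathcal R(\lambda)\rho:L^2(\mathbb R^3)\to H^4(\mathbb R^3)$ are bounded for $\lambda\in\mathbb C\setminus S$, are analytic in $\lambda\in\mathbb C\setminus S$ in the operator norm from $L^2(\mathbb R^3)$ to $H^4(\mathbb R^3)$, and form a meromorphic family at every point of $\mathbb C$. -/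

import Mathlib

open Set Filter Topology MeasureTheory
open scoped ENNReal SchwartzMap Laplacian ContDiff Distributions

namespace BiSchrodinger

/-- Three-dimensional Euclidean space. -/
abbrev E3 : Type := EuclideanSpace ℝ (Fin 3)

/-- The complex Hilbert space `L²(ℝ³)`. -/
abbrev L2 : Type := Lp ℂ 2 (volume : Measure E3)

/-- The space `L^∞(ℝ³)` of complex essentially bounded functions. -/
abbrev LInf : Type := Lp ℂ ∞ (volume : Measure E3)

/-- Almost everywhere classes of complex measurable functions on `ℝ³`. -/
abbrev Meas : Type := E3 →ₘ[(volume : Measure E3)] ℂ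

/-- The test functions `C_c^∞(ℝ³)`, with complex values. -/
abbrev Test : Type := 𝓓((⊤ : TopologicalSpace.Opens E3), ℂ)

/-- The tempered distribution defined by a square integrable function. -/
noncomputable abbrev toDist : L2 →L[ℂ] 𝓢'(E3, ℂ) :=
  Lp.toTemperedDistributionCLM ℂ (volume : Measure E3) 2

theorem toDist_injective : Function.Injective toDist :=
  LinearMap.ker_eq_bot.mp
    (Lp.ker_toTemperedDistributionCLM_eq_bot (E := E3) (F := ℂ) (μ := volume) (p := 2))

/-! ### The Sobolev space `H⁴(ℝ³)` -/

/-- `H⁴(ℝ³)` as a linear subspace of `L²(ℝ³)`. -/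
noncomputable def sobolevFour : Submodule ℂ L2 where
  carrier := {u | TemperedDistribution.MemSobolev 4 2 (toDist u)}
  add_mem' {u v} hu hv := by
    simp only [Set.mem_ofPred_eq, map_add] at *
    exact hu.add hv
  zero_mem' := by
    simp only [Set.mem_ofPred_eq, map_zero]
    exact TemperedDistribution.memSobolev_fun_zero E3 ℂ 4 2
  smul_mem' c u hu := by
    simp only [Set.mem_ofPred_eq, map_smul] at *
    exact hu.smul c

/-- The map `u ↦ 𝓕⁻¹ ((1 + |ξ|²)² 𝓕 u)` from `H⁴(ℝ³)` to `L²(ℝ³)`. -/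
noncomputable def bessel : sobolevFour →ₗ[ℂ] L2 where
  toFun u := u.2.choose
  map_add' u v := toDist_injective <| by
    have h1 := u.2.choose_spec
    have h2 := v.2.choose_spec
    have h3 := (u + v).2.choose_spec
    rw [← Lp.toTemperedDistributionCLM_apply] at h1 h2 h3
    rw [map_add, ← h1, ← h2, ← h3, Submodule.coe_add, map_add, map_add]
  map_smul' c u := toDist_injective <| by
    have h1 := u.2.choose_spec
    have h3 := (c • u).2.choose_spec
    rw [← Lp.toTemperedDistributionCLM_apply] at h1 h3
    rw [RingHom.id_apply, map_smul, ← h1, ← h3, Submodule.coe_smul, map_smul, map_smul]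

theorem toDist_bessel (u : sobolevFour) :
    toDist (bessel u) = TemperedDistribution.besselPotential E3 ℂ 4 (toDist u) :=
  u.2.choose_spec.symm

theorem bessel_injective : Function.Injective bessel := by
  intro u v h
  have h' : TemperedDistribution.besselPotential E3 ℂ 4 (toDist u)
      = TemperedDistribution.besselPotential E3 ℂ 4 (toDist v) := by
    rw [← toDist_bessel, ← toDist_bessel, h]
  have h'' := congrArg (TemperedDistribution.besselPotential E3 ℂ (-4)) h'
  simp only [TemperedDistribution.besselPotential_besselPotential_apply, add_neg_cancel,
    TemperedDistribution.besselPotential_zero, ContinuousLinearMap.id_apply] at h''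
  exact Subtype.ext (toDist_injective h'')

/-- The Banach space `H⁴(ℝ³)`. Its norm is `‖u‖ = ‖(1 + |ξ|²)² 𝓕 u‖_{L²}`, which is not the norm
that the subspace inherits from `L²(ℝ³)`. -/
def H4 : Type := sobolevFour

noncomputable instance : AddCommGroup H4 := inferInstanceAs (AddCommGroup sobolevFour)

noncomputable instance : Module ℂ H4 := inferInstanceAs (Module ℂ sobolevFour)

/-- The inclusion of `H⁴(ℝ³)` in `L²(ℝ³)`. -/
noncomputable def H4.toL2 : H4 →ₗ[ℂ] L2 := sobolevFour.subtype

/-- The map `bessel` on the type `H4`. -/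
noncomputable def H4.bessel : H4 →ₗ[ℂ] L2 := BiSchrodinger.bessel

noncomputable instance : NormedAddCommGroup H4 :=
  NormedAddCommGroup.induced H4 L2 H4.bessel bessel_injective

noncomputable instance : NormedSpace ℂ H4 :=
  NormedSpace.induced ℂ H4 L2 H4.bessel

/-! ### The operator `Δ² + V` -/

/-- For `u` in `H⁴(ℝ³)`, the distribution `Δ (Δ u)` is a square integrable function. -/
theorem exists_bilaplacian (u : sobolevFour) : ∃ g : L2, toDist g = Δ (Δ (toDist u)) := by
  have h := (TemperedDistribution.MemSobolev.laplacian
    (TemperedDistribution.MemSobolev.laplacian u.2))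
  have h0 : (4 : ℝ) - 2 - 2 = 0 := by norm_num
  rw [h0, TemperedDistribution.memSobolev_zero_iff] at h
  obtain ⟨g, hg⟩ := h
  exact ⟨g, hg.symm⟩

/-- The bilaplacian `Δ²` from `H⁴(ℝ³)` to `L²(ℝ³)`, in the sense of distributions. -/
noncomputable def bilaplacian : sobolevFour →ₗ[ℂ] L2 where
  toFun u := (exists_bilaplacian u).choose
  map_add' u v := toDist_injective <| by
    rw [map_add, (exists_bilaplacian u).choose_spec, (exists_bilaplacian v).choose_spec,
      (exists_bilaplacian (u + v)).choose_spec, Submodule.coe_add]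
    simp only [← TemperedDistribution.laplacianCLM_apply, map_add]
  map_smul' c u := toDist_injective <| by
    rw [RingHom.id_apply, map_smul, (exists_bilaplacian u).choose_spec,
      (exists_bilaplacian (c • u)).choose_spec, Submodule.coe_smul]
    simp only [← TemperedDistribution.laplacianCLM_apply, map_smul]

theorem toDist_bilaplacian (u : sobolevFour) : toDist (bilaplacian u) = Δ (Δ (toDist u)) :=
  (exists_bilaplacian u).choose_spec

/-- Multiplication by an essentially bounded function on `L²(ℝ³)`. -/
noncomputable def mulOp (V : LInf) : L2 →L[ℂ] L2 :=
  (ContinuousLinearMap.mul ℂ ℂ).holderL volume ∞ 2 2 V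

theorem coeFn_mulOp (V : LInf) (f : L2) : mulOp V f =ᵐ[volume] fun x => V x * f x :=
  ContinuousLinearMap.coeFn_holder _ V f

/-- The unbounded operator `Δ² + V` on `L²(ℝ³)`, with domain `H⁴(ℝ³)`. -/
noncomputable def biSchrodinger (V : LInf) : L2 →ₗ.[ℂ] L2 where
  domain := sobolevFour
  toFun := bilaplacian + (mulOp V : L2 →ₗ[ℂ] L2) ∘ₗ sobolevFour.subtype

/-! ### Resolvents of unbounded operators -/

section Resolvent

variable {X : Type*} [NormedAddCommGroup X] [NormedSpace ℂ X]

/-- The bounded operator `R` is a two-sided inverse of `A - z`. -/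
def IsResolventAt (A : X →ₗ.[ℂ] X) (z : ℂ) (R : X →L[ℂ] X) : Prop :=
  (∀ x : X, ∃ u : A.domain, (u : X) = R x ∧ A u - z • (u : X) = x) ∧
    ∀ u : A.domain, R (A u - z • (u : X)) = u

/-- The resolvent set of an unbounded operator. -/
def resSet (A : X →ₗ.[ℂ] X) : Set ℂ := {z | ∃ R, IsResolventAt A z R}

/-- There is at most one resolvent at each point. -/
theorem IsResolventAt.unique {A : X →ₗ.[ℂ] X} {z : ℂ} {R R' : X →L[ℂ] X}
    (h : IsResolventAt A z R) (h' : IsResolventAt A z R') : R = R' := by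
  ext x
  obtain ⟨u, hu, hx⟩ := h.1 x
  rw [← hu, ← h'.2 u, hx]

open Classical in
/-- The resolvent `(A - z)⁻¹` for `z` in the resolvent set (and zero elsewhere). -/
noncomputable def res (A : X →ₗ.[ℂ] X) (z : ℂ) : X →L[ℂ] X :=
  if h : z ∈ resSet A then h.choose else 0

end Resolvent

/-- The resolvent `R_V(k) = (Δ² + V - k⁴)⁻¹` on `L²(ℝ³)`. -/
noncomputable def RV (V : LInf) (k : ℂ) : L2 →L[ℂ] L2 := res (biSchrodinger V) (k ^ 4)

/-- The open first quadrant. -/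
def firstQuadrant : Set ℂ := {k | 0 < k.re ∧ 0 < k.im}

/-- The exceptional points of `R_V` in the open first quadrant: those `k` for which `k⁴` lies in
the spectrum of `Δ² + V`. -/
def quadrantPoles (V : LInf) : Set ℂ := {k ∈ firstQuadrant | k ^ 4 ∉ resSet (biSchrodinger V)}

/-! ### Meromorphic families of operators -/

/-- A family of bounded operators is a meromorphic family at `a` if near `a` it is a finite
Laurent sum: an operator-norm analytic family plus a polynomial without constant term in
`(k - a)⁻¹` whose coefficients are bounded operators of finite rank. The value at `a` itself
is irrelevant. -/
def IsMeromorphicFamilyAt {X Y : Type*} [NormedAddCommGroup X] [NormedSpace ℂ X]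
    [NormedAddCommGroup Y] [NormedSpace ℂ Y] (A : ℂ → X →L[ℂ] Y) (a : ℂ) : Prop :=
  ∃ (N : ℕ) (B : ℕ → X →L[ℂ] Y) (A₀ : ℂ → X →L[ℂ] Y),
    AnalyticAt ℂ A₀ a ∧
    (∀ j, FiniteDimensional ℂ (LinearMap.range (B j : X →ₗ[ℂ] Y))) ∧
    ∀ᶠ k in 𝓝[≠] a, A k = A₀ k + ∑ j ∈ Finset.range N, ((k - a) ^ (j + 1))⁻¹ • B j

/-! ### Compactly supported and local spaces -/

/-- The measurable function `f` vanishes almost everywhere outside a compact set. -/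
def CompSupp (f : E3 → ℂ) : Prop :=
  ∃ K : Set E3, IsCompact K ∧ ∀ᵐ x ∂(volume : Measure E3), x ∉ K → f x = 0

/-- `L²_comp(ℝ³)`. -/
noncomputable def L2comp : Submodule ℂ L2 where
  carrier := {f | CompSupp f}
  add_mem' {f g} := by
    rintro ⟨K, hK, hf⟩ ⟨K', hK', hg⟩
    refine ⟨K ∪ K', hK.union hK', ?_⟩
    filter_upwards [hf, hg, Lp.coeFn_add f g] with x h1 h2 h3 hx
    rw [Set.mem_union, not_or] at hx
    rw [h3, Pi.add_apply, h1 hx.1, h2 hx.2, add_zero]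
  zero_mem' := by
    refine ⟨∅, isCompact_empty, ?_⟩
    filter_upwards [Lp.coeFn_zero ℂ 2 (volume : Measure E3)] with x hx _
    rw [hx, Pi.zero_apply]
  smul_mem' c f := by
    rintro ⟨K, hK, hf⟩
    refine ⟨K, hK, ?_⟩
    filter_upwards [hf, Lp.coeFn_smul c f] with x h1 h2 hx
    rw [h2, Pi.smul_apply, h1 hx, smul_zero]

/-- A test function as an element of `L^∞(ℝ³)`. -/
noncomputable def testLInf (ρ : Test) : LInf :=
  (ρ.continuous.memLp_of_hasCompactSupport (p := ∞) (μ := volume) ρ.hasCompactSupport).toLp ρ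

/-- Multiplication by a test function, from `L²(ℝ³)` to `L²_comp(ℝ³)`. -/
noncomputable def cutoff (ρ : Test) : L2 →ₗ[ℂ] L2comp :=
  LinearMap.codRestrict L2comp (mulOp (testLInf ρ) : L2 →ₗ[ℂ] L2) <| by
    intro f
    refine ⟨tsupport ρ, ρ.hasCompactSupport, ?_⟩
    filter_upwards [coeFn_mulOp (testLInf ρ) f, MemLp.coeFn_toLp
      (ρ.continuous.memLp_of_hasCompactSupport (p := ∞) (μ := volume) ρ.hasCompactSupport)]
      with x h1 h2 hx
    have h3 : testLInf ρ x = ρ x := h2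
    rw [ContinuousLinearMap.coe_coe, h1, h3, image_eq_zero_of_notMem_tsupport hx, zero_mul]

/-- `H⁴_loc(ℝ³)`: the measurable functions `u` such that `ρ u` lies in `H⁴(ℝ³)` for every test
function `ρ`. -/
noncomputable def H4loc : Submodule ℂ Meas where
  carrier := {u | ∀ ρ : Test, ∃ v : H4, ∀ᵐ x ∂(volume : Measure E3), v.toL2 x = ρ x * u x}
  add_mem' {u u'} hu hu' ρ := by
    obtain ⟨v, hv⟩ := hu ρ
    obtain ⟨v', hv'⟩ := hu' ρ
    refine ⟨v + v', ?_⟩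
    rw [map_add]
    filter_upwards [hv, hv', Lp.coeFn_add v.toL2 v'.toL2, AEEqFun.coeFn_add u u']
      with x h1 h2 h3 h4
    rw [h3, h4, Pi.add_apply, Pi.add_apply, h1, h2, mul_add]
  zero_mem' ρ := by
    refine ⟨0, ?_⟩
    rw [map_zero]
    filter_upwards [Lp.coeFn_zero ℂ 2 (volume : Measure E3),
      AEEqFun.coeFn_zero (α := E3) (β := ℂ) (μ := volume)] with x h1 h2
    rw [h1, h2, Pi.zero_apply, mul_zero]
  smul_mem' c u hu ρ := by
    obtain ⟨v, hv⟩ := hu ρ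
    refine ⟨c • v, ?_⟩
    rw [map_smul]
    filter_upwards [hv, Lp.coeFn_smul c v.toL2, AEEqFun.coeFn_smul c u] with x h1 h2 h3
    rw [h2, h3, Pi.smul_apply, Pi.smul_apply, h1, smul_eq_mul, smul_eq_mul, mul_left_comm]

end BiSchrodinger

/-! For `k` in the open first quadrant, `(Δ² - k⁴)⁻¹` is the difference of the resolvents of `-Δ` at
`k²` and at `-k²`, divided by `2k²`. Hence it is convolution with `(exp (i k |x|) - exp (-k |x|)) /
(8π k² |x|)` (`fourier_freeKernel`, `freeResL2_ae_eq`). This kernel is continuous at the origin and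
bounded by `1/|k|` on the quadrant. At each `x` it is holomorphic in `k ≠ 0`. At `k = 0` it has a
simple pole whose residue does not depend on `x`, so between cutoffs the residue is an operator of
rank one.

Only the values of the kernel on a ball matter between cutoffs, so it may be multiplied by a smooth
radial cutoff. Integrating the sine transform of the profile by parts
(`IsProfile.weightedTransform_apply`) shows that `(1 + |ξ|²)²` times its Fourier transform is
bounded, and is a continuous linear function of the profile and its second and third derivatives in
`C[0, L]`. These depend holomorphically on `k` in the sup norm. The cut-off free resolvent is
therefore a meromorphic family from `L²` to `H⁴` on all of `ℂ`, with a pole at most at `0`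
(`isMeromorphicFamilyAt_waveOp`).

Let `V` live in the ball of radius `b` with characteristic function `χ`, and let `K(k)` be the
continuation of `V (Δ² - k⁴)⁻¹ χ`. It is a Hilbert–Schmidt operator, hence a norm limit of finite
rank operators, and in the quadrant its norm is `O(1/|k|)` (`norm_birman_le`). So `1 + K(k)` is
invertible for some `k`, and meromorphic Fredholm theory (`meromorphic_fredholm`) makes `(1 +
K(k))⁻¹` a meromorphic family on `ℂ`. The identity `R_V = R₀ - R₀ (1 + K)⁻¹ V R₀` then continues the
resolvent, since functions of the form `(1 + K)⁻¹ V g` are supported in the ball.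

In the quadrant, `k⁴` is in the resolvent set exactly when `1 + K(k)` is invertible
(`mem_resSet_iff`). The exceptional points there are bounded, because `K` is small for large `|k|`.
They cannot accumulate even at the boundary of the quadrant, because `K` is meromorphic across it.
So they are finite in number. -/

namespace BiSchrodinger

/-! ### Operators of finite rank and meromorphic families -/

section Meromorphic

variable {X Y Z : Type*} [NormedAddCommGroup X] [NormedSpace ℂ X] [NormedAddCommGroup Y]
  [NormedSpace ℂ Y] [NormedAddCommGroup Z] [NormedSpace ℂ Z]

variable (X Y) in
/-- The bounded operators of finite rank. -/
def finiteRank : Submodule ℂ (X →L[ℂ] Y) where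
  carrier := {B | FiniteDimensional ℂ (LinearMap.range (B : X →ₗ[ℂ] Y))}
  add_mem' {A B} hA hB := by
    simp only [Set.mem_ofPred_eq] at *
    have : LinearMap.range ((A + B : X →L[ℂ] Y) : X →ₗ[ℂ] Y) ≤
        LinearMap.range (A : X →ₗ[ℂ] Y) ⊔ LinearMap.range (B : X →ₗ[ℂ] Y) := by
      rintro _ ⟨x, rfl⟩
      exact Submodule.add_mem_sup ⟨x, rfl⟩ ⟨x, rfl⟩
    exact Submodule.finiteDimensional_of_le this
  zero_mem' := by
    simp only [Set.mem_ofPred_eq]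
    have : LinearMap.range ((0 : X →L[ℂ] Y) : X →ₗ[ℂ] Y) = ⊥ := LinearMap.range_zero
    rw [this]
    infer_instance
  smul_mem' c A hA := by
    simp only [Set.mem_ofPred_eq] at *
    have : LinearMap.range ((c • A : X →L[ℂ] Y) : X →ₗ[ℂ] Y) ≤ LinearMap.range (A : X →ₗ[ℂ] Y) := by
      rintro _ ⟨x, rfl⟩
      exact ⟨c • x, by simp⟩
    exact Submodule.finiteDimensional_of_le this

theorem mem_finiteRank {B : X →L[ℂ] Y} :
    B ∈ finiteRank X Y ↔ FiniteDimensional ℂ (LinearMap.range (B : X →ₗ[ℂ] Y)) := Iff.rfl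

theorem finiteRank_comp_left (C : Y →L[ℂ] Z) {B : X →L[ℂ] Y} (hB : B ∈ finiteRank X Y) :
    C ∘L B ∈ finiteRank X Z := by
  rw [mem_finiteRank] at *
  have : LinearMap.range ((C ∘L B : X →L[ℂ] Z) : X →ₗ[ℂ] Z) =
      (LinearMap.range (B : X →ₗ[ℂ] Y)).map (C : Y →ₗ[ℂ] Z) := by
    rw [ContinuousLinearMap.toLinearMap_comp, LinearMap.range_comp]
  rw [this]
  infer_instance

theorem finiteRank_comp_right {B : Y →L[ℂ] Z} (hB : B ∈ finiteRank Y Z) (C : X →L[ℂ] Y) :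
    B ∘L C ∈ finiteRank X Z := by
  rw [mem_finiteRank] at *
  have : LinearMap.range ((B ∘L C : X →L[ℂ] Z) : X →ₗ[ℂ] Z) ≤ LinearMap.range (B : Y →ₗ[ℂ] Z) := by
    rintro _ ⟨x, rfl⟩
    exact ⟨C x, rfl⟩
  exact Submodule.finiteDimensional_of_le this

theorem mem_finiteRank_of_finiteDimensional_domain [FiniteDimensional ℂ X] (B : X →L[ℂ] Y) :
    B ∈ finiteRank X Y := by
  rw [mem_finiteRank]
  infer_instance

/-- The norm limits of operators of finite rank. -/
noncomputable def approximable (X Y : Type*) [NormedAddCommGroup X] [NormedSpace ℂ X] [NormedAddCommGroup Y]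
    [NormedSpace ℂ Y] : Submodule ℂ (X →L[ℂ] Y) := (finiteRank X Y).topologicalClosure

theorem finiteRank_le_approximable : finiteRank X Y ≤ approximable X Y :=
  Submodule.le_topologicalClosure _

theorem isClosed_approximable : IsClosed (approximable X Y : Set (X →L[ℂ] Y)) :=
  Submodule.isClosed_topologicalClosure _

theorem _root_.AnalyticAt.clmComp {f : ℂ → Y →L[ℂ] Z} {g : ℂ → X →L[ℂ] Y} {a : ℂ}
    (hf : AnalyticAt ℂ f a) (hg : AnalyticAt ℂ g a) : AnalyticAt ℂ (fun k => f k ∘L g k) a :=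
  ((ContinuousLinearMap.compL ℂ X Y Z).analyticAt_bilinear (f a, g a)).comp₂ hf hg

theorem _root_.AnalyticAt.clmApply (L : X →L[ℂ] Y) {f : ℂ → X} {a : ℂ}
    (hf : AnalyticAt ℂ f a) : AnalyticAt ℂ (fun k => L (f k)) a :=
  (L.analyticAt (f a)).comp hf

theorem _root_.MeromorphicAt.clmApply (L : X →L[ℂ] Y) {f : ℂ → X} {a : ℂ}
    (hf : MeromorphicAt f a) : MeromorphicAt (fun k => L (f k)) a := by
  obtain ⟨n, hn⟩ := hf
  refine ⟨n, ?_⟩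
  simpa using AnalyticAt.clmApply L hn

/-- Shifting the power series by one index gives a series for the divided difference. Below this
peels off Taylor coefficients one at a time. -/
theorem _root_.AnalyticAt.dslope_self {f : ℂ → X} {a : ℂ} (hf : AnalyticAt ℂ f a) :
    AnalyticAt ℂ (dslope f a) a := by
  obtain ⟨p, hp⟩ := hf
  exact hp.has_fpower_series_dslope_fslope.analyticAt

namespace IsMeromorphicFamilyAt

variable {a : ℂ}

theorem of_analyticAt {A : ℂ → X →L[ℂ] Y} (h : AnalyticAt ℂ A a) : IsMeromorphicFamilyAt A a := by
  refine ⟨0, 0, A, h, fun j => (finiteRank X Y).zero_mem, ?_⟩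
  filter_upwards with k
  simp

theorem congr {A A' : ℂ → X →L[ℂ] Y} (h : IsMeromorphicFamilyAt A a) (h' : A =ᶠ[𝓝[≠] a] A') :
    IsMeromorphicFamilyAt A' a := by
  obtain ⟨N, B, A₀, h1, h2, h3⟩ := h
  refine ⟨N, B, A₀, h1, h2, ?_⟩
  filter_upwards [h3, h'] with k h4 h5
  rw [← h5, h4]

theorem meromorphicAt {A : ℂ → X →L[ℂ] Y} (h : IsMeromorphicFamilyAt A a) : MeromorphicAt A a := by
  obtain ⟨N, B, A₀, h1, h2, h3⟩ := h
  have h4 : MeromorphicAt (fun k => A₀ k + ∑ j ∈ Finset.range N, ((k - a) ^ (j + 1))⁻¹ • B j) a := by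
    refine h1.meromorphicAt.fun_add (MeromorphicAt.fun_sum fun j _ => ?_)
    refine MeromorphicAt.fun_smul ?_ (MeromorphicAt.const _ _)
    exact (((MeromorphicAt.id a).fun_sub (MeromorphicAt.const a a)).fun_pow (j + 1)).fun_inv
  exact h4.congr (h3.mono fun k hk => hk.symm)

theorem add {A A' : ℂ → X →L[ℂ] Y} (h : IsMeromorphicFamilyAt A a)
    (h' : IsMeromorphicFamilyAt A' a) : IsMeromorphicFamilyAt (fun k => A k + A' k) a := by
  obtain ⟨N, B, A₀, h1, h2, h3⟩ := h
  obtain ⟨N', B', A₀', h1', h2', h3'⟩ := h'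
  refine ⟨max N N', fun j => (if j < N then B j else 0) + (if j < N' then B' j else 0),
    fun k => A₀ k + A₀' k, h1.fun_add h1', fun j => ?_, ?_⟩
  · refine (finiteRank X Y).add_mem ?_ ?_
    · split_ifs
      exacts [h2 j, (finiteRank X Y).zero_mem]
    · split_ifs
      exacts [h2' j, (finiteRank X Y).zero_mem]
  · filter_upwards [h3, h3'] with k hk hk'
    have key : ∀ (M M' : ℕ) (C : ℕ → X →L[ℂ] Y), M ≤ M' →
        ∑ j ∈ Finset.range M', ((k - a) ^ (j + 1))⁻¹ • (if j < M then C j else 0) =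
        ∑ j ∈ Finset.range M, ((k - a) ^ (j + 1))⁻¹ • C j := by
      intro M M' C hM
      rw [← Finset.sum_subset (Finset.range_mono hM)]
      · refine Finset.sum_congr rfl fun j hj => ?_
        rw [if_pos (Finset.mem_range.mp hj)]
      · intro j _ hj
        rw [if_neg (by simpa using hj), smul_zero]
    simp only [smul_add, Finset.sum_add_distrib]
    rw [key _ _ _ (le_max_left _ _), key _ _ _ (le_max_right _ _), hk, hk']
    abel

theorem sum {ι : Type*} (s : Finset ι) {A : ι → ℂ → X →L[ℂ] Y}
    (h : ∀ i ∈ s, IsMeromorphicFamilyAt (A i) a) :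
    IsMeromorphicFamilyAt (fun k => ∑ i ∈ s, A i k) a := by
  classical
  induction s using Finset.induction_on with
  | empty => simpa using of_analyticAt analyticAt_const
  | insert i s hi ih =>
    simp only [Finset.sum_insert hi]
    exact (h i (Finset.mem_insert_self i s)).add
      (ih fun j hj => h j (Finset.mem_insert_of_mem hj))

theorem inv_pow_smul_finiteRank {B : X →L[ℂ] Y} (hB : B ∈ finiteRank X Y) (n : ℕ) :
    IsMeromorphicFamilyAt (fun k => ((k - a) ^ (n + 1))⁻¹ • B) a := by
  refine ⟨n + 1, fun j => if j = n then B else 0, fun _ => 0, analyticAt_const, fun j => ?_, ?_⟩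
  · change (if j = n then B else 0) ∈ finiteRank X Y
    split_ifs
    exacts [hB, (finiteRank X Y).zero_mem]
  · filter_upwards with k
    simp

/-- The splitting `C k = C a + (k - a) • dslope C a k` produces one polar term, of finite rank
because of the factor `B`, and a remainder whose pole order is lower by one. -/
theorem inv_pow_smul_analytic_comp {B : X →L[ℂ] Y} (hB : B ∈ finiteRank X Y) (n : ℕ)
    {C : ℂ → Y →L[ℂ] Z} (hC : AnalyticAt ℂ C a) :
    IsMeromorphicFamilyAt (fun k => ((k - a) ^ n)⁻¹ • (C k ∘L B)) a := by
  induction n generalizing C with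
  | zero => simpa using of_analyticAt (hC.clmComp analyticAt_const)
  | succ n ih =>
    refine ((inv_pow_smul_finiteRank (finiteRank_comp_left (C a) hB) n).add
      (ih hC.dslope_self)).congr ?_
    filter_upwards [self_mem_nhdsWithin] with k hk
    have hk' : k - a ≠ 0 := sub_ne_zero.mpr hk
    have h1 : C k = C a + (k - a) • dslope C a k := by rw [sub_smul_dslope]; abel
    conv_rhs => rw [h1]
    rw [ContinuousLinearMap.add_comp, ContinuousLinearMap.smul_comp, smul_add, smul_smul]
    congr 2
    rw [pow_succ]
    field_simp

theorem inv_pow_smul_comp_analytic {B : Y →L[ℂ] Z} (hB : B ∈ finiteRank Y Z) (n : ℕ)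
    {C : ℂ → X →L[ℂ] Y} (hC : AnalyticAt ℂ C a) :
    IsMeromorphicFamilyAt (fun k => ((k - a) ^ n)⁻¹ • (B ∘L C k)) a := by
  induction n generalizing C with
  | zero => simpa using of_analyticAt (analyticAt_const.clmComp hC)
  | succ n ih =>
    refine ((inv_pow_smul_finiteRank (finiteRank_comp_right hB (C a)) n).add
      (ih hC.dslope_self)).congr ?_
    filter_upwards [self_mem_nhdsWithin] with k hk
    have hk' : k - a ≠ 0 := sub_ne_zero.mpr hk
    have h1 : C k = C a + (k - a) • dslope C a k := by rw [sub_smul_dslope]; abel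
    conv_rhs => rw [h1]
    rw [ContinuousLinearMap.comp_add, ContinuousLinearMap.comp_smul, smul_add, smul_smul]
    congr 2
    rw [pow_succ]
    field_simp

/-- Among the four products of regular and principal parts, only regular times regular has no factor
of finite rank, and that product is analytic. -/
theorem comp {A : ℂ → Y →L[ℂ] Z} {A' : ℂ → X →L[ℂ] Y} (h : IsMeromorphicFamilyAt A a)
    (h' : IsMeromorphicFamilyAt A' a) : IsMeromorphicFamilyAt (fun k => A k ∘L A' k) a := by
  obtain ⟨N, B, A₀, h1, h2, h3⟩ := h
  obtain ⟨N', B', A₀', h1', h2', h3'⟩ := h'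
  have H1 := of_analyticAt (h1.clmComp h1')
  have H2 := sum (a := a) (Finset.range N') (fun j _ =>
    inv_pow_smul_analytic_comp (a := a) (h2' j) (j + 1) h1)
  have H3 := sum (a := a) (Finset.range N) (fun j _ =>
    inv_pow_smul_comp_analytic (a := a) (h2 j) (j + 1) h1')
  have H4 := sum (a := a) (Finset.range N) (fun i _ => sum (a := a) (Finset.range N') (fun j _ =>
    inv_pow_smul_finiteRank (a := a) (finiteRank_comp_right (h2 i) (B' j)) (i + 1 + j)))
  refine (((H1.add H2).add H3).add H4).congr ?_
  filter_upwards [h3, h3'] with k hk hk'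
  rw [hk, hk']
  have : ∀ i j : ℕ, ((k - a) ^ (i + 1 + j + 1))⁻¹ = ((k - a) ^ (i + 1))⁻¹ * ((k - a) ^ (j + 1))⁻¹ := by
    intro i j
    rw [← mul_inv, ← pow_add]
    ring_nf
  simp only [this, ContinuousLinearMap.add_comp, ContinuousLinearMap.comp_add,
    ContinuousLinearMap.comp_finsetSum, ContinuousLinearMap.finsetSum_comp,
    ContinuousLinearMap.smul_comp, ContinuousLinearMap.comp_smul, mul_smul,
    Finset.smul_sum, Finset.sum_add_distrib, smul_add]
  rw [Finset.sum_comm (s := Finset.range N) (t := Finset.range N')]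
  have h4 : ∀ i j : ℕ, ((k - a) ^ (j + 1))⁻¹ • ((k - a) ^ (i + 1))⁻¹ • (B j ∘L B' i) =
    ((k - a) ^ (i + 1))⁻¹ • ((k - a) ^ (j + 1))⁻¹ • (B j ∘L B' i) := fun i j => smul_comm _ _ _
  simp only [h4]
  abel

theorem smul_finiteRank {s : ℂ → ℂ} (hs : MeromorphicAt s a) {B : X →L[ℂ] Y}
    (hB : B ∈ finiteRank X Y) : IsMeromorphicFamilyAt (fun k => s k • B) a := by
  obtain ⟨n, hn⟩ := hs
  have h1 : AnalyticAt ℂ (fun k => ((k - a) ^ n • s k) • ContinuousLinearMap.id ℂ Y) a :=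
    hn.fun_smul analyticAt_const
  refine (inv_pow_smul_analytic_comp hB n h1).congr ?_
  filter_upwards [self_mem_nhdsWithin] with k hk
  have hk' : k - a ≠ 0 := sub_ne_zero.mpr hk
  rw [ContinuousLinearMap.smul_comp, ContinuousLinearMap.id_comp, smul_smul, smul_eq_mul,
    inv_mul_cancel_left₀ (pow_ne_zero _ hk')]

theorem comp_left {A : ℂ → X →L[ℂ] Y} (C : Y →L[ℂ] Z) (h : IsMeromorphicFamilyAt A a) :
    IsMeromorphicFamilyAt (fun k => C ∘L A k) a :=
  (of_analyticAt (A := fun _ => C) analyticAt_const).comp h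

theorem comp_right {A : ℂ → Y →L[ℂ] Z} (h : IsMeromorphicFamilyAt A a) (C : X →L[ℂ] Y) :
    IsMeromorphicFamilyAt (fun k => A k ∘L C) a :=
  h.comp (of_analyticAt (A := fun _ => C) analyticAt_const)

theorem neg {A : ℂ → X →L[ℂ] Y} (h : IsMeromorphicFamilyAt A a) :
    IsMeromorphicFamilyAt (fun k => -A k) a := by
  simpa using h.comp_left (-ContinuousLinearMap.id ℂ Y)

theorem sub {A A' : ℂ → X →L[ℂ] Y} (h : IsMeromorphicFamilyAt A a)
    (h' : IsMeromorphicFamilyAt A' a) : IsMeromorphicFamilyAt (fun k => A k - A' k) a := by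
  simpa [sub_eq_add_neg] using h.add h'.neg

end IsMeromorphicFamilyAt

end Meromorphic

end BiSchrodinger

namespace BiSchrodinger

/-! ### Meromorphic Fredholm theory -/

section Fredholm

variable {X : Type*} [NormedAddCommGroup X] [NormedSpace ℂ X]

theorem _root_.MeromorphicAt.matrix_det {n : Type*} [Fintype n] [DecidableEq n]
    {M : ℂ → Matrix n n ℂ} {a : ℂ} (h : ∀ i j, MeromorphicAt (fun k => M k i j) a) :
    MeromorphicAt (fun k => (M k).det) a := by
  simp only [Matrix.det_apply]
  refine MeromorphicAt.fun_sum fun σ _ => ?_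
  have h1 : MeromorphicAt (fun k => ∏ i, M k (σ i) i) a := MeromorphicAt.fun_prod fun i _ => h _ _
  have h2 : (fun k => Equiv.Perm.sign σ • ∏ i, M k (σ i) i) =
      fun k => ((Equiv.Perm.sign σ : ℤ) : ℂ) * ∏ i, M k (σ i) i := by
    funext k
    rw [Units.smul_def, zsmul_eq_mul]
  rw [h2]
  exact (MeromorphicAt.const _ _).fun_mul h1

theorem _root_.MeromorphicAt.matrix_adjugate {n : Type*} [Fintype n] [DecidableEq n]
    {M : ℂ → Matrix n n ℂ} {a : ℂ} (h : ∀ i j, MeromorphicAt (fun k => M k i j) a) (i j : n) :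
    MeromorphicAt (fun k => (M k).adjugate i j) a := by
  simp only [Matrix.adjugate_apply]
  refine MeromorphicAt.matrix_det fun i' j' => ?_
  simp only [Matrix.updateRow_apply]
  split_ifs
  · exact MeromorphicAt.const _ _
  · exact h i' j'

/-- In finite dimension a meromorphic family of operators is either invertible near the point, with
a meromorphic inverse, or nowhere invertible near the point. -/
theorem meromorphic_inverse_finiteDimensional {W : Type*} [NormedAddCommGroup W] [NormedSpace ℂ W]
    [FiniteDimensional ℂ W] {M : ℂ → W →L[ℂ] W} {a : ℂ} (hM : MeromorphicAt M a) :
    (∃ R : ℂ → W →L[ℂ] W, (∀ᶠ k in 𝓝[≠] a, R k * M k = 1 ∧ M k * R k = 1) ∧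
      IsMeromorphicFamilyAt R a) ∨ ∀ᶠ k in 𝓝[≠] a, ¬ IsUnit (M k) := by
  classical
  let b := Module.finBasis ℂ W
  let n := Module.finrank ℂ W
  let L : (W →L[ℂ] W) →ₗ[ℂ] Matrix (Fin n) (Fin n) ℂ :=
    (LinearMap.toMatrix b b).toLinearMap ∘ₗ ContinuousLinearMap.coeLM ℂ
  have hL : ∀ A B, L (A * B) = L A * L B := fun A B => LinearMap.toMatrix_mul b (A : W →ₗ[ℂ] W) B
  have hL1 : L 1 = 1 := LinearMap.toMatrix_one b
  have hLi : Function.Injective L := fun A B h =>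
    ContinuousLinearMap.coe_injective ((LinearMap.toMatrix b b).injective h)
  have hent : ∀ i j, MeromorphicAt (fun k => L (M k) i j) a := fun i j =>
    MeromorphicAt.clmApply (LinearMap.toContinuousLinearMap
      (Matrix.entryLinearMap ℂ ℂ i j ∘ₗ L)) hM
  have hdet := MeromorphicAt.matrix_det hent
  -- A scalar meromorphic function either vanishes identically or has no zero on a punctured
  -- neighbourhood. For the determinant this is the whole dichotomy.
  rcases hdet.eventually_eq_zero_or_eventually_ne_zero with h0 | h0
  · right
    filter_upwards [h0] with k hk hu
    obtain ⟨u, hu⟩ := hu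
    have h1 : (L (M k)).det * (L (↑u⁻¹)).det = 1 := by
      rw [← Matrix.det_mul, ← hL, ← hu, Units.mul_inv, hL1, Matrix.det_one]
    rw [hk, zero_mul] at h1
    exact zero_ne_one h1
  · left
    let E : Fin n → Fin n → W →L[ℂ] W := fun i j =>
      LinearMap.toContinuousLinearMap (Matrix.toLin b b (Matrix.single i j 1))
    have hE : ∀ i j, L (E i j) = Matrix.single i j 1 := fun i j => by
      simp [L, E]
    -- Cramer's rule expanded in matrix units: meromorphic scalars times fixed operators of finite
    -- rank.
    refine ⟨fun k => ∑ i, ∑ j, ((L (M k)).det⁻¹ * (L (M k)).adjugate i j) • E i j, ?_, ?_⟩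
    · filter_upwards [h0] with k hk
      have h2 : L (∑ i, ∑ j, ((L (M k)).det⁻¹ * (L (M k)).adjugate i j) • E i j) =
          (L (M k)).det⁻¹ • (L (M k)).adjugate := by
        simp only [map_sum, map_smul, hE, Matrix.smul_single, smul_eq_mul, mul_one]
        conv_rhs => rw [Matrix.matrix_eq_sum_single ((L (M k)).det⁻¹ • (L (M k)).adjugate)]
        simp only [Matrix.smul_apply, smul_eq_mul]
      constructor
      · apply hLi
        rw [hL, h2, hL1, Matrix.smul_mul, Matrix.adjugate_mul, smul_smul, inv_mul_cancel₀ hk,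
          one_smul]
      · apply hLi
        rw [hL, h2, hL1, Matrix.mul_smul, Matrix.mul_adjugate, smul_smul, inv_mul_cancel₀ hk,
          one_smul]
    · refine IsMeromorphicFamilyAt.sum _ fun i _ => IsMeromorphicFamilyAt.sum _ fun j _ => ?_
      exact IsMeromorphicFamilyAt.smul_finiteRank
        (hdet.fun_inv.fun_mul (MeromorphicAt.matrix_adjugate hent i j))
        (mem_finiteRank_of_finiteDimensional_domain _)

theorem exists_projection (W : Submodule ℂ X) [FiniteDimensional ℂ W] :
    ∃ f : X →L[ℂ] W, ∀ w : W, f w = w := by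
  obtain ⟨g, hg⟩ := ContinuousLinearMap.exist_extension_of_finiteDimensional_range
    (ContinuousLinearMap.id ℂ W)
  exact ⟨g, fun w => (DFunLike.congr_fun hg w).symm⟩

theorem analyticAt_ringInverse {R : Type*} [NormedRing R] [NormedAlgebra ℂ R] [CompleteSpace R]
    {A : ℂ → R} {a : ℂ} (h : AnalyticAt ℂ A a) (hu : IsUnit (A a)) :
    AnalyticAt ℂ (fun k => Ring.inverse (A k)) a := by
  obtain ⟨u, hu⟩ := hu
  have h1 : AnalyticAt ℂ Ring.inverse (A a) := hu ▸ analyticAt_inverse u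
  exact h1.comp h

theorem eventually_isUnit {R : Type*} [NormedRing R] [CompleteSpace R]
    {A : ℂ → R} {a : ℂ} (h : ContinuousAt A a) (hu : IsUnit (A a)) : ∀ᶠ k in 𝓝 a, IsUnit (A k) :=
  h.eventually (Units.isOpen.mem_nhds hu)

variable [CompleteSpace X]

/-- Up to an analytic invertible factor, `1 + K` is the identity plus a family `Z` with values in a
fixed finite-dimensional space `W`. Whether it is invertible is decided by its block on `W`, where
determinants apply. -/
theorem meromorphic_fredholm_local {K : ℂ → X →L[ℂ] X} {a : ℂ} (hK : IsMeromorphicFamilyAt K a)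
    (hKc : ∀ᶠ k in 𝓝[≠] a, K k ∈ approximable X X) :
    ((∀ᶠ k in 𝓝[≠] a, IsUnit (1 + K k)) ∧
      IsMeromorphicFamilyAt (fun k => Ring.inverse (1 + K k)) a) ∨
    ∀ᶠ k in 𝓝[≠] a, ¬ IsUnit (1 + K k) := by
  obtain ⟨N, B, A₀, hA₀, hB, hKB⟩ := hK
  -- Away from `a` the regular part is `K k` minus finite rank terms, and the norm limits of finite
  -- rank operators form a closed space.
  have hApp : A₀ a ∈ approximable X X := by
    have h1 : Tendsto A₀ (𝓝[≠] a) (𝓝 (A₀ a)) :=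
      hA₀.continuousAt.tendsto.mono_left nhdsWithin_le_nhds
    refine isClosed_approximable.mem_of_tendsto h1 ?_
    filter_upwards [hKc, hKB] with k h2 h3
    have h4 : A₀ k = K k - ∑ j ∈ Finset.range N, ((k - a) ^ (j + 1))⁻¹ • B j := by
      rw [h3, add_sub_cancel_right]
    rw [h4]
    refine Submodule.sub_mem _ h2 (Submodule.sum_mem _ fun j _ => Submodule.smul_mem _ _ ?_)
    exact finiteRank_le_approximable (hB j)
  obtain ⟨F, hF, hFn⟩ := Metric.mem_closure_iff.mp hApp 1 one_pos
  rw [dist_comm, dist_eq_norm] at hFn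
  -- Since `F` is at distance less than `1` from `A₀ a`, the Neumann series inverts `E` at `a`,
  -- hence near `a`.
  let E : ℂ → X →L[ℂ] X := fun k => 1 + A₀ k - F
  have hE : AnalyticAt ℂ E a := (analyticAt_const.fun_add hA₀).fun_sub analyticAt_const
  have hEu : IsUnit (E a) := by
    have : E a = 1 - (F - A₀ a) := by simp only [E]; abel
    rw [this]
    exact isUnit_one_sub_of_norm_lt_one hFn
  have hEinv := analyticAt_ringInverse hE hEu
  have hEev : ∀ᶠ k in 𝓝[≠] a, IsUnit (E k) :=
    (eventually_isUnit hE.continuousAt hEu).filter_mono nhdsWithin_le_nhds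
  let G : ℂ → X →L[ℂ] X := fun k => F + ∑ j ∈ Finset.range N, ((k - a) ^ (j + 1))⁻¹ • B j
  have hG : IsMeromorphicFamilyAt G a :=
    (IsMeromorphicFamilyAt.of_analyticAt analyticAt_const).add
      (IsMeromorphicFamilyAt.sum _ fun j _ => IsMeromorphicFamilyAt.inv_pow_smul_finiteRank (hB j) j)
  let W : Submodule ℂ X := LinearMap.range (F : X →ₗ[ℂ] X) ⊔
    (Finset.range N).sup fun j => LinearMap.range (B j : X →ₗ[ℂ] X)
  have : FiniteDimensional ℂ (LinearMap.range (F : X →ₗ[ℂ] X)) := hF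
  have : ∀ j, FiniteDimensional ℂ (LinearMap.range (B j : X →ₗ[ℂ] X)) := hB
  have : FiniteDimensional ℂ W := inferInstance
  have hGW : ∀ k x, G k x ∈ W := by
    intro k x
    have h1 : G k x = F x + ∑ j ∈ Finset.range N, ((k - a) ^ (j + 1))⁻¹ • B j x := by
      simp [G]
    rw [h1]
    refine Submodule.add_mem_sup ⟨x, rfl⟩ (Submodule.sum_mem _ fun j hj => ?_)
    exact Submodule.smul_mem _ _ (Finset.le_sup (f := fun j => LinearMap.range (B j : X →ₗ[ℂ] X)) hj ⟨x, rfl⟩)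
  obtain ⟨f, hf⟩ := exists_projection W
  let ι : W →L[ℂ] X := W.subtypeL
  let P : X →L[ℂ] X := ι ∘L f
  have hfι : f ∘L ι = 1 := ContinuousLinearMap.ext hf
  have hPP : P * P = P := by
    ext x
    exact congrArg ι (hf (f x))
  have hPG : ∀ k, P * G k = G k := by
    intro k
    ext x
    exact congrArg Subtype.val (hf ⟨G k x, hGW k x⟩)
  let Z : ℂ → X →L[ℂ] X := fun k => G k ∘L Ring.inverse (E k)
  have hZ : IsMeromorphicFamilyAt Z a := hG.comp (IsMeromorphicFamilyAt.of_analyticAt hEinv)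
  have hPZ : ∀ k, P * Z k = Z k := fun k => by
    change P * (G k * _) = G k * _
    rw [← mul_assoc, hPG]
  -- Because `P Z = Z` and `(1 - P) P = 0`, the cross term in the product of the first two factors
  -- vanishes. The first factor is unipotent, so only `1 + Z P` can fail to be invertible.
  have hmain : ∀ᶠ k in 𝓝[≠] a, 1 + K k = (1 + Z k * (1 - P)) * (1 + Z k * P) * E k := by
    filter_upwards [hKB, hEev] with k h1 h2
    have h3 : 1 + K k = (1 + Z k) * E k := by
      change _ = (1 + G k * _) * E k
      rw [add_mul, mul_assoc, Ring.inverse_mul_cancel _ h2, h1]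
      simp only [E, G]
      noncomm_ring
    have h4 : Z k * (1 - P) * (Z k * P) = 0 := by
      rw [← hPZ k]
      have : P * Z k * (1 - P) * (P * Z k * P) = P * Z k * ((P - P * P) * Z k * P) := by noncomm_ring
      rw [this, hPP, sub_self, zero_mul, zero_mul, mul_zero]
    have h5 : (1 + Z k * (1 - P)) * (1 + Z k * P) = 1 + Z k + Z k * (1 - P) * (Z k * P) := by
      noncomm_ring
    rw [h3, h5, h4, add_zero]
  have hU1 : ∀ k, (1 + Z k * (1 - P)) * (1 - Z k * (1 - P)) = 1 ∧
      (1 - Z k * (1 - P)) * (1 + Z k * (1 - P)) = 1 := by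
    intro k
    have h4 : Z k * (1 - P) * (Z k * (1 - P)) = 0 := by
      rw [← hPZ k]
      have : P * Z k * (1 - P) * (P * Z k * (1 - P)) =
        P * Z k * ((P - P * P) * Z k * (1 - P)) := by noncomm_ring
      rw [this, hPP, sub_self, zero_mul, zero_mul, mul_zero]
    constructor
    · have : (1 + Z k * (1 - P)) * (1 - Z k * (1 - P)) = 1 - Z k * (1 - P) * (Z k * (1 - P)) := by
        noncomm_ring
      rw [this, h4, sub_zero]
    · have : (1 - Z k * (1 - P)) * (1 + Z k * (1 - P)) = 1 - Z k * (1 - P) * (Z k * (1 - P)) := by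
        noncomm_ring
      rw [this, h4, sub_zero]
  let M : ℂ → W →L[ℂ] W := fun k => 1 + f ∘L Z k ∘L ι
  have hM : MeromorphicAt M a :=
    (MeromorphicAt.const _ _).fun_add ((hZ.comp_right ι).comp_left f).meromorphicAt
  have hιM : ∀ k, ι ∘L M k = (1 + Z k * P) ∘L ι := by
    intro k
    ext w
    have h1 : P (Z k w) = Z k w := DFunLike.congr_fun (hPZ k) (w : X)
    have h2 : P (w : X) = w := congrArg Subtype.val (hf w)
    change (w : X) + P (Z k w) = (w : X) + Z k (P w)
    rw [h1, h2]
  have hfM : ∀ k, f ∘L (1 + Z k * P) = M k ∘L f := by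
    intro k
    ext x
    have h1 : f (x + Z k (P x)) = f x + f (Z k (ι (f x))) := map_add _ _ _
    exact congrArg Subtype.val h1
  rcases meromorphic_inverse_finiteDimensional hM with ⟨R, hR, hRm⟩ | hno
  · left
    let Q : ℂ → X →L[ℂ] X := fun k => (1 - P) + ι ∘L R k ∘L f
    have hQm : IsMeromorphicFamilyAt Q a :=
      (IsMeromorphicFamilyAt.of_analyticAt analyticAt_const).add ((hRm.comp_right f).comp_left ι)
    have hQ : ∀ᶠ k in 𝓝[≠] a, Q k * (1 + Z k * P) = 1 ∧ (1 + Z k * P) * Q k = 1 := by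
      filter_upwards [hR] with k hk
      have e1 : (1 - P) * (1 + Z k * P) = 1 - P := by
        have : (1 - P) * (1 + Z k * P) = 1 - P + (Z k - P * Z k) * P := by noncomm_ring
        rw [this, hPZ, sub_self, zero_mul, add_zero]
      have e2 : (1 + Z k * P) * (1 - P) = 1 - P := by
        have : (1 + Z k * P) * (1 - P) = 1 - P + Z k * (P - P * P) := by noncomm_ring
        rw [this, hPP, sub_self, mul_zero, add_zero]
      constructor
      · change ((1 - P) + ι ∘L R k ∘L f) * (1 + Z k * P) = 1
        rw [add_mul, e1]
        change 1 - P + ι ∘L R k ∘L (f ∘L (1 + Z k * P)) = 1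
        rw [hfM]
        change 1 - P + ι ∘L (R k * M k) ∘L f = 1
        rw [hk.1]
        change 1 - P + P = 1
        abel
      · change (1 + Z k * P) * ((1 - P) + ι ∘L R k ∘L f) = 1
        rw [mul_add, e2]
        change 1 - P + ((1 + Z k * P) ∘L ι) ∘L R k ∘L f = 1
        rw [← hιM]
        change 1 - P + ι ∘L (M k * R k) ∘L f = 1
        rw [hk.2]
        change 1 - P + P = 1
        abel
    have hinv : ∀ᶠ k in 𝓝[≠] a, IsUnit (1 + K k) ∧
        Ring.inverse (E k) * Q k * (1 - Z k * (1 - P)) = Ring.inverse (1 + K k) := by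
      filter_upwards [hmain, hQ, hEev] with k h1 h2 h3
      let u1 : (X →L[ℂ] X)ˣ := ⟨_, _, (hU1 k).1, (hU1 k).2⟩
      let u2 : (X →L[ℂ] X)ˣ := ⟨_, _, h2.2, h2.1⟩
      obtain ⟨u3, h3⟩ := h3
      have h4 : 1 + K k = ((u1 * u2 * u3 : (X →L[ℂ] X)ˣ) : X →L[ℂ] X) := by
        rw [h1, ← h3]
        rfl
      rw [h4, Ring.inverse_unit, ← h3, Ring.inverse_unit]
      refine ⟨Units.isUnit _, ?_⟩
      rw [mul_inv_rev, mul_inv_rev, mul_assoc]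
      rfl
    refine ⟨hinv.mono fun k hk => hk.1, ?_⟩
    have hfin := ((IsMeromorphicFamilyAt.of_analyticAt hEinv).comp hQm).comp
      ((IsMeromorphicFamilyAt.of_analyticAt (a := a) (A := fun _ => (1 : X →L[ℂ] X))
        analyticAt_const).sub (hZ.comp_right (1 - P)))
    exact hfin.congr (hinv.mono fun k hk => hk.2)
  · right
    filter_upwards [hmain, hno, hEev] with k h1 h2 h3 h4
    apply h2
    have h5 : IsUnit (1 + Z k * P) := by
      let u1 : (X →L[ℂ] X)ˣ := ⟨_, _, (hU1 k).1, (hU1 k).2⟩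
      obtain ⟨u3, h3⟩ := h3
      have h6 : 1 + Z k * P = ↑u1⁻¹ * (1 + K k) * ↑u3⁻¹ := by
        rw [h1, ← h3]
        change _ = (1 - Z k * (1 - P)) * ((1 + Z k * (1 - P)) * (1 + Z k * P) * u3) * ↑u3⁻¹
        rw [← mul_assoc, ← mul_assoc, (hU1 k).2, one_mul, mul_assoc, Units.mul_inv, mul_one]
      rw [h6]
      exact ((Units.isUnit _).mul h4).mul (Units.isUnit _)
    obtain ⟨u, hu⟩ := h5
    have e1 : (M k) * (f ∘L (↑u⁻¹ : X →L[ℂ] X) ∘L ι) = 1 := by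
      change (M k ∘L f) ∘L (↑u⁻¹ : X →L[ℂ] X) ∘L ι = 1
      rw [← hfM, ← hu]
      change f ∘L ((u : X →L[ℂ] X) * (↑u⁻¹ : X →L[ℂ] X)) ∘L ι = 1
      rw [Units.mul_inv]
      exact hfι
    have e2 : (f ∘L (↑u⁻¹ : X →L[ℂ] X) ∘L ι) * (M k) = 1 := by
      change f ∘L (↑u⁻¹ : X →L[ℂ] X) ∘L (ι ∘L M k) = 1
      rw [hιM, ← hu]
      change f ∘L ((↑u⁻¹ : X →L[ℂ] X) * (u : X →L[ℂ] X)) ∘L ι = 1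
      rw [Units.inv_mul]
      exact hfι
    exact ⟨⟨_, _, e1, e2⟩, rfl⟩

/-- Meromorphic Fredholm theory on the complex plane. -/
theorem meromorphic_fredholm {K : ℂ → X →L[ℂ] X} (hK : ∀ a, IsMeromorphicFamilyAt K a)
    (hKc : ∀ a, ∀ᶠ k in 𝓝[≠] a, K k ∈ approximable X X)
    (h0 : ∃ a, ∀ᶠ k in 𝓝[≠] a, IsUnit (1 + K k)) (a : ℂ) :
    (∀ᶠ k in 𝓝[≠] a, IsUnit (1 + K k)) ∧
      IsMeromorphicFamilyAt (fun k => Ring.inverse (1 + K k)) a := by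
  -- A point of the punctured neighbourhood has a full neighbourhood inside it. Together with the
  -- local dichotomy this makes the set `U` below clopen, and `ℂ` is connected.
  have hopen : ∀ p : ℂ → Prop, IsOpen {a | ∀ᶠ k in 𝓝[≠] a, p k} := by
    intro p
    rw [isOpen_iff_mem_nhds]
    intro b hb
    obtain ⟨u, hu, hbu, hup⟩ := mem_nhdsWithin.mp hb
    filter_upwards [hu.mem_nhds hbu] with c hc
    rcases eq_or_ne c b with rfl | hcb
    · exact hb
    · filter_upwards [nhdsWithin_le_nhds ((hu.inter isOpen_compl_singleton).mem_nhds ⟨hc, hcb⟩)]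
        with k hk using hup hk
  let U : Set ℂ := {a | ∀ᶠ k in 𝓝[≠] a, IsUnit (1 + K k)}
  have hU : Uᶜ = {a | ∀ᶠ k in 𝓝[≠] a, ¬ IsUnit (1 + K k)} := by
    ext b
    constructor
    · intro hb
      exact (meromorphic_fredholm_local (hK b) (hKc b)).resolve_left fun h => hb h.1
    · intro hb hb'
      have h1 : ∀ᶠ k in 𝓝[≠] b, False := by
        filter_upwards [hb, hb'] with k h2 h3 using h2 h3
      exact (NeBot.ne inferInstance : 𝓝[≠] b ≠ ⊥) (Filter.eventually_false_iff_eq_bot.mp h1)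
  have hcl : IsClopen U := ⟨⟨hU ▸ hopen _⟩, hopen _⟩
  have huniv : U = univ := by
    rcases isClopen_iff.mp hcl with h | h
    · obtain ⟨b, hb⟩ := h0
      exact absurd (show b ∈ U from hb) (h ▸ notMem_empty b)
    · exact h
  have ha : a ∈ U := huniv ▸ mem_univ a
  rcases meromorphic_fredholm_local (hK a) (hKc a) with h | h
  · exact h
  · exact absurd ha (show a ∈ Uᶜ from hU ▸ h)

end Fredholm

end BiSchrodinger

namespace BiSchrodinger

/-! ### Multiplication operators and Fourier multipliers -/

section Multipliers

open FourierTransform TemperedDistribution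
open scoped BoundedContinuousFunction

/-- A bounded continuous function as an element of `L^∞(ℝ³)`. -/
noncomputable def bcfToLInf : (E3 →ᵇ ℂ) →L[ℂ] LInf :=
  LinearMap.mkContinuous
    { toFun := fun g => g.memLp_top.toLp g
      map_add' := fun _ _ => rfl
      map_smul' := fun _ _ => rfl } 1 <| by
    intro g
    rw [one_mul]
    refine ENNReal.toReal_le_of_le_ofReal (norm_nonneg _) ?_
    change eLpNorm (g.memLp_top.toLp g) ∞ volume ≤ _
    rw [eLpNorm_congr_ae (MemLp.coeFn_toLp _), eLpNorm_exponent_top]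
    exact eLpNormEssSup_le_of_ae_bound (Eventually.of_forall g.norm_coe_le_norm)

theorem coeFn_bcfToLInf (g : E3 →ᵇ ℂ) : bcfToLInf g =ᵐ[volume] g := MemLp.coeFn_toLp g.memLp_top

theorem coeFn_mulOp_bcfToLInf (g : E3 →ᵇ ℂ) (f : L2) :
    mulOp (bcfToLInf g) f =ᵐ[volume] fun x => g x * f x := by
  filter_upwards [coeFn_mulOp (bcfToLInf g) f, coeFn_bcfToLInf g] with x h1 h2
  rw [h1, h2]

/-- The Fourier transform on `L²(ℝ³)`. -/
noncomputable abbrev FT : L2 ≃ₗᵢ[ℂ] L2 := Lp.fourierTransformₗᵢ E3 ℂ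

/-- The Fourier multiplier `𝓕⁻¹ g 𝓕` on `L²(ℝ³)` with bounded continuous symbol `g`. -/
noncomputable def fm : (E3 →ᵇ ℂ) →L[ℂ] L2 →L[ℂ] L2 :=
  (ContinuousLinearMap.compL ℂ L2 L2 L2 (FT.symm.toContinuousLinearEquiv : L2 →L[ℂ] L2)) ∘L
    (ContinuousLinearMap.compL ℂ L2 L2 L2).flip (FT.toContinuousLinearEquiv : L2 →L[ℂ] L2) ∘L
      ((ContinuousLinearMap.mul ℂ ℂ).holderL volume ∞ 2 2 ∘L bcfToLInf)

theorem fm_apply (g : E3 →ᵇ ℂ) (f : L2) : fm g f = FT.symm (mulOp (bcfToLInf g) (FT f)) := rfl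

theorem fm_mul (g g' : E3 →ᵇ ℂ) (f : L2) : fm (g * g') f = fm g (fm g' f) := by
  rw [fm_apply, fm_apply, fm_apply, LinearIsometryEquiv.apply_symm_apply]
  congr 1
  apply Lp.ext
  filter_upwards [coeFn_mulOp_bcfToLInf (g * g') (FT f),
    coeFn_mulOp_bcfToLInf g (mulOp (bcfToLInf g') (FT f)),
    coeFn_mulOp_bcfToLInf g' (FT f)] with x h1 h2 h3
  rw [h1, h2, h3, BoundedContinuousFunction.mul_apply, mul_assoc]

theorem fm_one (f : L2) : fm 1 f = f := by
  rw [fm_apply]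
  have : mulOp (bcfToLInf 1) (FT f) = FT f := by
    apply Lp.ext
    filter_upwards [coeFn_mulOp_bcfToLInf 1 (FT f)] with x h1
    rw [h1, BoundedContinuousFunction.coe_one, Pi.one_apply, one_mul]
  rw [this, LinearIsometryEquiv.symm_apply_apply]

theorem toDist_mulOp (V : LInf) (g : E3 → ℂ) (hg : g.HasTemperateGrowth) (hV : V =ᵐ[volume] g)
    (f : L2) : toDist (mulOp V f) = smulLeftCLM ℂ g (toDist f) := by
  have hg2 : MemLp g ∞ (volume : Measure E3) := (memLp_congr_ae hV).mp (Lp.memLp V)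
  have h := Lp.toTemperedDistribution_smul_eq (r := 2) hg hg2 f
  rw [Lp.toTemperedDistributionCLM_apply, Lp.toTemperedDistributionCLM_apply, ← h]
  congr 1
  apply Lp.ext
  filter_upwards [coeFn_mulOp V f, Lp.coeFn_lpSMul (r := 2) (hg2.toLp g) f, hg2.coeFn_toLp, hV]
    with x h1 h2 h3 h4
  rw [h1, h2, Pi.smul_apply', h3, h4, smul_eq_mul]

/-- This links the bounded multipliers on `L²` to those on tempered distributions, in terms of which
`H⁴` and `Δ` are given. -/
theorem toDist_fm (g : E3 →ᵇ ℂ) (hg : (g : E3 → ℂ).HasTemperateGrowth) (f : L2) :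
    toDist (fm g f) = fourierMultiplierCLM ℂ g (toDist f) := by
  rw [fm_apply, TemperedDistribution.fourierMultiplierCLM_apply]
  simp only [Lp.toTemperedDistributionCLM_apply]
  rw [Lp.fourier_toTemperedDistribution_eq, ← Lp.toTemperedDistributionCLM_apply (𝓕 f),
    ← toDist_mulOp _ _ hg (coeFn_bcfToLInf g), Lp.toTemperedDistributionCLM_apply,
    Lp.fourierInv_toTemperedDistribution_eq]
  rfl

/-- The symbol `(1 + |ξ|²)⁻²`. -/
noncomputable def winv : E3 →ᵇ ℂ :=
  BoundedContinuousFunction.ofNormedAddCommGroup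
    (fun x => (((1 + ‖x‖ ^ 2) ^ (-4 / 2 : ℝ) : ℝ) : ℂ))
    (Complex.continuous_ofReal.comp
      (Function.hasTemperateGrowth_one_add_norm_sq_rpow E3 _).1.continuous) 1 <| by
    intro x
    rw [Complex.norm_real, Real.norm_of_nonneg (by positivity)]
    exact Real.rpow_le_one_of_one_le_of_nonpos (by simp) (by norm_num)

theorem winv_eq (x : E3) : winv x = ((1 + (‖x‖ : ℂ) ^ 2) ^ 2)⁻¹ := by
  change ((((1 + ‖x‖ ^ 2) ^ (-4 / 2 : ℝ) : ℝ) : ℂ)) = _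
  have : (-4 / 2 : ℝ) = -((2 : ℕ) : ℝ) := by norm_num
  rw [this, Real.rpow_neg (by positivity), Real.rpow_natCast]
  push_cast
  rfl

theorem hasTemperateGrowth_winv : (winv : E3 → ℂ).HasTemperateGrowth := by
  change (fun x : E3 => (((1 + ‖x‖ ^ 2) ^ (-4 / 2 : ℝ) : ℝ) : ℂ)).HasTemperateGrowth
  fun_prop

theorem toDist_fm_winv (f : L2) :
    toDist (fm winv f) = besselPotential E3 ℂ (-4) (toDist f) :=
  toDist_fm winv hasTemperateGrowth_winv f

theorem fm_winv_mem (f : L2) : fm winv f ∈ sobolevFour := by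
  refine ⟨f, ?_⟩
  rw [toDist_fm_winv, besselPotential_besselPotential_apply, neg_add_cancel, besselPotential_zero]
  rfl

theorem bessel_fm_winv (f : L2) : bessel ⟨fm winv f, fm_winv_mem f⟩ = f := by
  apply toDist_injective
  rw [toDist_bessel, toDist_fm_winv, besselPotential_besselPotential_apply, neg_add_cancel,
    besselPotential_zero]
  rfl

theorem fm_winv_bessel (u : sobolevFour) : fm winv (bessel u) = u :=
  congrArg Subtype.val (bessel_injective (bessel_fm_winv (bessel u)))

/-- The map `bessel` as an isometric isomorphism. -/
noncomputable def besselEquiv : H4 ≃ₗᵢ[ℂ] L2 where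
  toLinearEquiv := LinearEquiv.ofBijective H4.bessel
    ⟨bessel_injective, fun f => ⟨⟨fm winv f, fm_winv_mem f⟩, bessel_fm_winv f⟩⟩
  norm_map' _ := rfl

instance : CompleteSpace H4 :=
  (completeSpace_congr (e := besselEquiv.toEquiv) besselEquiv.isometry.isUniformEmbedding).mpr
    inferInstance

/-- The inverse of `besselEquiv` as a bounded operator. -/
noncomputable def besselInv : L2 →L[ℂ] H4 := besselEquiv.symm.toContinuousLinearEquiv

/-- The inclusion of `H⁴(ℝ³)` in `L²(ℝ³)` as a bounded operator. -/
noncomputable def toL2L : H4 →L[ℂ] L2 := fm winv ∘L (besselEquiv.toContinuousLinearEquiv : H4 →L[ℂ] L2)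

theorem toL2L_apply (u : H4) : toL2L u = u.toL2 := fm_winv_bessel u

theorem toL2_besselInv (f : L2) : (besselInv f).toL2 = fm winv f := by
  rw [← toL2L_apply]
  change fm winv (besselEquiv (besselEquiv.symm f)) = _
  rw [LinearIsometryEquiv.apply_symm_apply]

theorem toL2_injective : Function.Injective H4.toL2 := Subtype.val_injective

theorem bessel_besselInv (f : L2) : (besselInv f).bessel = f := besselEquiv.apply_symm_apply f

end Multipliers

/-! ### The free resolvent -/

section FreeResolvent

open FourierTransform TemperedDistribution
open scoped BoundedContinuousFunction

theorem one_add_sq_mul_winv (x : E3) : (1 + (‖x‖ : ℂ) ^ 2) ^ 2 * winv x = 1 := by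
  rw [winv_eq]
  refine mul_inv_cancel₀ (pow_ne_zero _ ?_)
  norm_cast
  positivity

/-- The symbol `(2π|ξ|)⁴ (1 + |ξ|²)⁻²`. -/
noncomputable def bilaplaceSymbol : E3 →ᵇ ℂ :=
  BoundedContinuousFunction.ofNormedAddCommGroup
    (fun x => (((2 * Real.pi) ^ 4 * ‖x‖ ^ 4 : ℝ) : ℂ) * winv x) (by fun_prop) ((2 * Real.pi) ^ 4) <| by
    intro x
    rw [winv_eq, norm_mul, Complex.norm_real, Real.norm_of_nonneg (by positivity), norm_inv,
      norm_pow]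
    have : ‖1 + (‖x‖ : ℂ) ^ 2‖ = 1 + ‖x‖ ^ 2 := by
      norm_cast
      rw [Real.norm_of_nonneg (by positivity)]
    rw [this, ← div_eq_mul_inv, div_le_iff₀ (by positivity)]
    refine mul_le_mul_of_nonneg_left ?_ (by positivity)
    nlinarith [sq_nonneg ‖x‖]

theorem bilaplaceSymbol_apply (x : E3) :
    bilaplaceSymbol x = (((2 * Real.pi) ^ 4 * ‖x‖ ^ 4 : ℝ) : ℂ) * winv x := rfl

theorem hasTemperateGrowth_norm_pow_four :
    (fun x : E3 => ((‖x‖ ^ 4 : ℝ) : ℂ)).HasTemperateGrowth := by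
  have : (fun x : E3 => ((‖x‖ ^ 4 : ℝ) : ℂ)) = fun x : E3 => ((((‖x‖ ^ 2) ^ 2 : ℝ)) : ℂ) := by
    funext x
    rw [← pow_mul]
  rw [this]
  fun_prop

theorem hasTemperateGrowth_bilaplaceSymbol : (bilaplaceSymbol : E3 → ℂ).HasTemperateGrowth := by
  have h : (bilaplaceSymbol : E3 → ℂ) = fun x =>
      ((((2 * Real.pi) ^ 4 : ℝ) : ℂ) * ((‖x‖ ^ 4 : ℝ) : ℂ)) * winv x := by
    funext x
    rw [bilaplaceSymbol_apply, Complex.ofReal_mul]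
  rw [h]
  exact ((Function.HasTemperateGrowth.const _).mul hasTemperateGrowth_norm_pow_four).mul
    hasTemperateGrowth_winv

/-- Each Laplacian has the symbol `-(2π|ξ|)²`. Composing with `u = fm winv (bessel u)` turns the
unbounded symbol `(2π|ξ|)⁴` into a bounded one. -/
theorem bilaplacian_eq_fm (u : sobolevFour) :
    bilaplacian u = fm bilaplaceSymbol (bessel u) := by
  have ha : (fun x : E3 => Complex.ofReal (‖x‖ ^ 2)).HasTemperateGrowth := by fun_prop
  apply toDist_injective
  rw [toDist_bilaplacian, toDist_fm _ hasTemperateGrowth_bilaplaceSymbol]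
  conv_lhs => rw [← fm_winv_bessel u, toDist_fm _ hasTemperateGrowth_winv]
  rw [laplacian_eq_fourierMultiplierCLM, laplacian_eq_fourierMultiplierCLM,
    ContinuousLinearMap.map_smul_of_tower,
    fourierMultiplierCLM_fourierMultiplierCLM_apply ha ha,
    fourierMultiplierCLM_fourierMultiplierCLM_apply hasTemperateGrowth_winv (ha.mul ha), smul_smul,
    ← Complex.coe_smul, ← smul_apply, ← fourierMultiplierCLM_smul]
  · congr 2
    funext x
    simp only [Pi.smul_apply, Pi.mul_apply, smul_eq_mul, bilaplaceSymbol_apply]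
    push_cast
    ring
  · exact hasTemperateGrowth_winv.mul (ha.mul ha)

/-- The symbol `((2π|ξ|)⁴ - z) (1 + |ξ|²)⁻²`. -/
noncomputable def resolventDenom (z : ℂ) : E3 →ᵇ ℂ := bilaplaceSymbol - z • winv

theorem resolventDenom_apply (z : ℂ) (x : E3) :
    resolventDenom z x = (((2 * Real.pi * ‖x‖) ^ 4 : ℝ) - z) * winv x := by
  change bilaplaceSymbol x - z * winv x = _
  rw [bilaplaceSymbol_apply, mul_pow (2 * Real.pi)]
  ring

/-- Inverting in the Banach algebra of bounded continuous symbols gives analyticity in `z` for free.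
As the symbol carries the weight `(1 + |ξ|²)⁻²`, the inverse controls the resolvent with values in
`H⁴`. -/
theorem isUnit_resolventDenom {z : ℂ} (hz : ∀ t : ℝ, 0 ≤ t → (t : ℂ) ≠ z) :
    IsUnit (resolventDenom z) := by
  have hcl : IsClosed ((fun t : ℝ => (t : ℂ)) '' Set.Ici 0) :=
    Complex.isometry_ofReal.isClosedEmbedding.isClosedMap _ isClosed_Ici
  have hz' : z ∉ (fun t : ℝ => (t : ℂ)) '' Set.Ici 0 := by
    rintro ⟨t, ht, h⟩
    exact hz t ht h
  obtain ⟨d, hd, hball⟩ := Metric.isOpen_iff.mp hcl.isOpen_compl z hz'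
  have hdist : ∀ t : ℝ, 0 ≤ t → d ≤ ‖(t : ℂ) - z‖ := by
    intro t ht
    by_contra! h
    exact hball (show (t : ℂ) ∈ Metric.ball z d by rwa [Metric.mem_ball, dist_eq_norm])
      ⟨t, ht, rfl⟩
  have hw : ∀ x : E3, (1 + (‖x‖ : ℂ) ^ 2) ^ 2 ≠ 0 := by
    intro x h
    have := one_add_sq_mul_winv x
    rw [h, zero_mul] at this
    exact zero_ne_one this
  have hne : ∀ x : E3, (((2 * Real.pi * ‖x‖) ^ 4 : ℝ) : ℂ) - z ≠ 0 := fun x =>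
    sub_ne_zero.mpr (hz _ (by positivity))
  let q : E3 →ᵇ ℂ := BoundedContinuousFunction.ofNormedAddCommGroup
    (fun x => (1 + (‖x‖ : ℂ) ^ 2) ^ 2 / ((((2 * Real.pi * ‖x‖) ^ 4 : ℝ) : ℂ) - z))
    (by
      refine Continuous.div (by fun_prop) ?_ hne
      exact (Complex.continuous_ofReal.comp (by fun_prop)).sub continuous_const)
    -- This constant combines `(1 + |x|²)² ≤ 2 (1 + |x|⁴) ≤ 2 (1 + t)`, `t ≤ |t - z| + |z|` and `d ≤
    -- |t - z|`.
    (2 * (1 + (‖z‖ + 1) / d)) (by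
      intro x
      have hn : ‖1 + (‖x‖ : ℂ) ^ 2‖ = 1 + ‖x‖ ^ 2 := by
        norm_cast
        rw [Real.norm_of_nonneg (by positivity)]
      rw [norm_div, norm_pow, hn, div_le_iff₀ (norm_pos_iff.mpr (hne x))]
      set t : ℝ := (2 * Real.pi * ‖x‖) ^ 4 with ht
      have h1 := hdist t (by positivity)
      have h2 : t - ‖z‖ ≤ ‖(t : ℂ) - z‖ := by
        have := norm_sub_norm_le (t : ℂ) z
        rwa [Complex.norm_real, Real.norm_of_nonneg (by positivity)] at this
      have h3 : ‖z‖ + 1 ≤ (‖z‖ + 1) / d * ‖(t : ℂ) - z‖ := by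
        rw [div_mul_eq_mul_div, le_div_iff₀ hd]
        exact mul_le_mul_of_nonneg_left h1 (by positivity)
      have h4 : ‖x‖ ^ 4 ≤ t := by
        rw [ht]
        have : 1 ≤ 2 * Real.pi := by linarith [Real.two_le_pi]
        gcongr
        nlinarith [norm_nonneg x]
      nlinarith [sq_nonneg (‖x‖ ^ 2 - 1)])
  refine IsUnit.of_mul_eq_one q ?_
  ext x
  rw [BoundedContinuousFunction.mul_apply, resolventDenom_apply, BoundedContinuousFunction.coe_one, Pi.one_apply]
  change _ * ((1 + (‖x‖ : ℂ) ^ 2) ^ 2 / ((((2 * Real.pi * ‖x‖) ^ 4 : ℝ) : ℂ) - z)) = 1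
  rw [winv_eq]
  have h1 := hw x
  have h2 := hne x
  rw [mul_assoc, inv_mul_eq_div, div_div, mul_comm _ ((1 + (‖x‖ : ℂ) ^ 2) ^ 2), ← div_div,
    div_self h1, mul_one_div, div_self h2]

/-- The resolvent of the bilaplacian, from `L²(ℝ³)` to `H⁴(ℝ³)`. -/
noncomputable def freeRes (z : ℂ) : L2 →L[ℂ] H4 := besselInv ∘L fm (Ring.inverse (resolventDenom z))

/-- The resolvent of the bilaplacian on `L²(ℝ³)`. -/
noncomputable def freeResL2 (z : ℂ) : L2 →L[ℂ] L2 := toL2L ∘L freeRes z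

theorem freeResL2_apply (z : ℂ) (f : L2) : freeResL2 z f = (freeRes z f).toL2 := toL2L_apply _

theorem freeResL2_eq_fm (z : ℂ) :
    freeResL2 z = fm (winv * Ring.inverse (resolventDenom z)) := by
  ext1 f
  rw [freeResL2_apply, fm_mul]
  exact toL2_besselInv _

theorem resolventSymbol_apply {z : ℂ} (hz : ∀ t : ℝ, 0 ≤ t → (t : ℂ) ≠ z) (x : E3) :
    (winv * Ring.inverse (resolventDenom z)) x = ((((2 * Real.pi * ‖x‖) ^ 4 : ℝ) : ℂ) - z)⁻¹ := by
  have h1 := DFunLike.congr_fun (Ring.mul_inverse_cancel _ (isUnit_resolventDenom hz)) x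
  rw [BoundedContinuousFunction.mul_apply, BoundedContinuousFunction.coe_one, Pi.one_apply,
    resolventDenom_apply] at h1
  rw [BoundedContinuousFunction.mul_apply]
  refine eq_inv_of_mul_eq_one_right ?_
  rw [← h1]
  ring

theorem analyticAt_freeRes {z : ℂ} (hz : ∀ t : ℝ, 0 ≤ t → (t : ℂ) ≠ z) :
    AnalyticAt ℂ freeRes z := by
  have h1 : AnalyticAt ℂ resolventDenom z :=
    analyticAt_const.fun_sub (analyticAt_id.fun_smul analyticAt_const)
  have h2 := analyticAt_ringInverse h1 (isUnit_resolventDenom hz)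
  exact analyticAt_const.clmComp (h2.clmApply fm)

theorem analyticAt_freeResL2 {z : ℂ} (hz : ∀ t : ℝ, 0 ≤ t → (t : ℂ) ≠ z) :
    AnalyticAt ℂ freeResL2 z :=
  analyticAt_const.clmComp (analyticAt_freeRes hz)

theorem bilaplacian_sub_smul (z : ℂ) (u : sobolevFour) :
    bilaplacian u - z • (u : L2) = fm (resolventDenom z) (bessel u) := by
  rw [bilaplacian_eq_fm, resolventDenom, map_sub, map_smul, sub_apply,
    smul_apply, fm_winv_bessel]

theorem bilaplacian_sub_freeRes {z : ℂ} (hz : ∀ t : ℝ, 0 ≤ t → (t : ℂ) ≠ z) (f : L2) :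
    bilaplacian (freeRes z f : sobolevFour) - z • freeResL2 z f = f := by
  rw [freeResL2_apply]
  refine (bilaplacian_sub_smul z (freeRes z f : sobolevFour)).trans ?_
  have : bessel (freeRes z f : sobolevFour) = fm (Ring.inverse (resolventDenom z)) f :=
    bessel_besselInv _
  rw [this, ← fm_mul, Ring.mul_inverse_cancel _ (isUnit_resolventDenom hz), fm_one]

theorem freeResL2_bilaplacian_sub {z : ℂ} (hz : ∀ t : ℝ, 0 ≤ t → (t : ℂ) ≠ z) (u : sobolevFour) :
    freeResL2 z (bilaplacian u - z • (u : L2)) = u := by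
  rw [bilaplacian_sub_smul, freeResL2_eq_fm, fm_mul, ← fm_mul _ _ (bessel u),
    Ring.inverse_mul_cancel _ (isUnit_resolventDenom hz), fm_one, fm_winv_bessel]

end FreeResolvent

end BiSchrodinger

namespace BiSchrodinger

/-! ### Multiplication by test functions on `H⁴(ℝ³)` -/

section TestMul

open FourierTransform TemperedDistribution LineDeriv

theorem lineDeriv_smulLeftCLM_schwartz {g g' : E3 → ℂ} (hg : g.HasTemperateGrowth)
    (hg' : g'.HasTemperateGrowth) (m : E3) (hd : ∀ x, HasLineDerivAt ℝ g (g' x) x m)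
    (φ : 𝓢(E3, ℂ)) :
    ∂_{m} (SchwartzMap.smulLeftCLM ℂ g φ) =
      SchwartzMap.smulLeftCLM ℂ g' φ + SchwartzMap.smulLeftCLM ℂ g (∂_{m} φ) := by
  ext x
  have h1 : HasLineDerivAt ℝ φ ((∂_{m} φ) x) x m := by
    rw [SchwartzMap.lineDerivOp_apply_eq_fderiv]
    exact (φ.differentiableAt.hasFDerivAt).hasLineDerivAt m
  have h2 := HasDerivAt.mul (hd x) h1
  rw [SchwartzMap.lineDerivOp_apply, add_apply,
    SchwartzMap.smulLeftCLM_apply_apply hg', SchwartzMap.smulLeftCLM_apply_apply hg]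
  have h3 : HasLineDerivAt ℝ (SchwartzMap.smulLeftCLM ℂ g φ)
      (g' x • φ x + g x • (∂_{m} φ) x) x m := by
    have : (SchwartzMap.smulLeftCLM ℂ g φ : E3 → ℂ) = fun y => g y * φ y := by
      funext y
      rw [SchwartzMap.smulLeftCLM_apply_apply hg, smul_eq_mul]
    rw [this]
    simp only [zero_smul, add_zero] at h2
    exact h2
  exact h3.lineDeriv

theorem lineDeriv_smulLeftCLM {g g' : E3 → ℂ} (hg : g.HasTemperateGrowth)
    (hg' : g'.HasTemperateGrowth) (m : E3) (hd : ∀ x, HasLineDerivAt ℝ g (g' x) x m)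
    (T : 𝓢'(E3, ℂ)) :
    ∂_{m} (smulLeftCLM ℂ g T) = smulLeftCLM ℂ g' T + smulLeftCLM ℂ g (∂_{m} T) := by
  ext φ
  have h := lineDeriv_smulLeftCLM_schwartz hg hg' m hd φ
  change T (SchwartzMap.smulLeftCLM ℂ g (-∂_{m} φ)) =
    T (SchwartzMap.smulLeftCLM ℂ g' φ) + T (-∂_{m} (SchwartzMap.smulLeftCLM ℂ g φ))
  rw [h, ← map_add]
  congr 1
  rw [map_neg]
  abel

/-- The operator with symbol `1 + |ξ|²` is `1 - (2π)⁻² Δ`, and `Δ T` is a sum of derivatives of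
elements of `H^s`. So it maps `T` into `H^(s-1)`, and inverting it gains two orders. -/
theorem memSobolev_add_one {s : ℝ} {T : 𝓢'(E3, ℂ)} (h0 : MemSobolev s 2 T)
    (h1 : ∀ m : E3, MemSobolev s 2 (∂_{m} T)) : MemSobolev (s + 1) 2 T := by
  have h2 : MemSobolev (s - 1) 2 (Δ T) := by
    rw [laplacian_eq_sum (stdOrthonormalBasis ℝ E3)]
    refine Finset.sum_induction _ (MemSobolev (s - 1) 2) (fun _ _ => MemSobolev.add)
      (memSobolev_fun_zero _ _ _ _) fun i _ => (h1 _).lineDerivOp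
  have hg : (fun x : E3 => Complex.ofReal (‖x‖ ^ 2)).HasTemperateGrowth := by fun_prop
  have h3 : besselPotential E3 ℂ 2 T = T - (((2 * Real.pi) ^ 2)⁻¹ : ℂ) • Δ T := by
    rw [laplacian_eq_fourierMultiplierCLM, ← Complex.coe_smul, smul_smul, besselPotential]
    have e1 : (fun x : E3 => (((1 + ‖x‖ ^ 2) ^ ((2 : ℝ) / 2) : ℝ) : ℂ)) =
        fun x => ∑ i : Fin 2, (![fun _ => 1, fun x : E3 => Complex.ofReal (‖x‖ ^ 2)] i : E3 → ℂ) x := by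
      funext x
      simp
    rw [e1, fourierMultiplierCLM_sum ℂ, Fin.sum_univ_two]
    · have e2 : ((2 * Real.pi : ℂ) ^ 2)⁻¹ * ((-(2 * Real.pi) ^ 2 : ℝ) : ℂ) = -1 := by
        push_cast
        rw [mul_neg, inv_mul_cancel₀]
        norm_cast
        positivity
      rw [e2, neg_one_smul, sub_neg_eq_add, add_apply]
      congr 1
      simp
    · intro i _
      fin_cases i
      · exact Function.HasTemperateGrowth.const _
      · exact hg
  have h4 : MemSobolev (s - 1) 2 (besselPotential E3 ℂ 2 T) := by
    rw [h3]
    exact (h0.mono (by linarith)).sub (h2.smul _)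
  rw [memSobolev_besselPotential_iff] at h4
  convert h4 using 1
  ring

/-- Induction on the order by the Leibniz rule. The function `g` has to vary in the induction, since
one of the two terms contains its derivative. -/
theorem memSobolev_smulLeftCLM {g : E3 → ℂ} (hg : ContDiff ℝ ∞ g) (hc : HasCompactSupport g)
    (n : ℕ) {T : 𝓢'(E3, ℂ)} (hT : MemSobolev n 2 T) : MemSobolev n 2 (smulLeftCLM ℂ g T) := by
  induction n generalizing g T with
  | zero =>
    rw [Nat.cast_zero, memSobolev_zero_iff] at hT ⊢
    obtain ⟨f, rfl⟩ := hT
    have h1 : MemLp g ∞ (volume : Measure E3) := hg.continuous.memLp_of_hasCompactSupport hc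
    exact ⟨mulOp (h1.toLp g) f,
      (toDist_mulOp _ g (hc.hasTemperateGrowth hg) h1.coeFn_toLp f).symm⟩
  | succ n ih =>
    push_cast at hT ⊢
    have hT0 : MemSobolev n 2 T := hT.mono (by linarith)
    refine memSobolev_add_one (ih hg hc hT0) fun m => ?_
    have hg' : ContDiff ℝ ∞ (fun x => fderiv ℝ g x m) :=
      (hg.fderiv_right (m := ∞) (by simp)).clm_apply contDiff_const
    have hc' : HasCompactSupport (fun x => fderiv ℝ g x m) := hc.fderiv_apply ℝ m
    rw [lineDeriv_smulLeftCLM (hc.hasTemperateGrowth hg) (hc'.hasTemperateGrowth hg') m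
      (fun x => ((hg.differentiable (by simp)).differentiableAt.hasFDerivAt).hasLineDerivAt m)]
    refine (ih hg' hc' hT0).add (ih hg hc ?_)
    have := hT.lineDerivOp (m := m)
    simpa using this

theorem coeFn_testLInf (ρ : Test) : testLInf ρ =ᵐ[volume] ρ := MemLp.coeFn_toLp _

theorem mulOp_testLInf_mem (ρ : Test) (u : sobolevFour) : mulOp (testLInf ρ) u ∈ sobolevFour := by
  have h := memSobolev_smulLeftCLM ρ.contDiff ρ.hasCompactSupport 4 (T := toDist u)
    (by exact_mod_cast u.2)
  change MemSobolev 4 2 (toDist _)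
  rw [toDist_mulOp _ ρ (ρ.hasCompactSupport.hasTemperateGrowth ρ.contDiff) (coeFn_testLInf ρ)]
  exact_mod_cast h

/-- Multiplication by a test function on `H⁴(ℝ³)`, as a linear map. -/
noncomputable def testMulLinear (ρ : Test) : H4 →ₗ[ℂ] H4 where
  toFun u := (⟨mulOp (testLInf ρ) u.toL2, mulOp_testLInf_mem ρ u⟩ : sobolevFour)
  map_add' u v := Subtype.ext (by
    change mulOp (testLInf ρ) (u + v).toL2 = mulOp (testLInf ρ) u.toL2 + mulOp (testLInf ρ) v.toL2
    rw [map_add, map_add])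
  map_smul' c u := Subtype.ext (by
    change mulOp (testLInf ρ) (c • u).toL2 = c • mulOp (testLInf ρ) u.toL2
    rw [map_smul, map_smul])

/-- Multiplication by a test function on `H⁴(ℝ³)`. -/
noncomputable def testMul (ρ : Test) : H4 →L[ℂ] H4 :=
  -- The closed graph theorem replaces norm estimates: the graph is closed because multiplication by
  -- `ρ` is continuous on `L²`, into which `H⁴` embeds continuously.
  ContinuousLinearMap.ofSeqClosedGraph (g := testMulLinear ρ) <| by
    intro u x y hu hy
    apply toL2_injective
    change y.toL2 = mulOp (testLInf ρ) x.toL2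
    rw [← toL2L_apply, ← toL2L_apply]
    have h1 := (toL2L.continuous.tendsto y).comp hy
    have h2 := ((mulOp (testLInf ρ) ∘L toL2L).continuous.tendsto x).comp hu
    refine tendsto_nhds_unique h1 (h2.congr fun n => ?_)
    change mulOp (testLInf ρ) (toL2L (u n)) = toL2L (testMulLinear ρ (u n))
    rw [toL2L_apply, toL2L_apply]
    rfl

theorem toL2_testMul (ρ : Test) (u : H4) : (testMul ρ u).toL2 = mulOp (testLInf ρ) u.toL2 := rfl

theorem coeFn_testMul (ρ : Test) (u : H4) :
    (testMul ρ u).toL2 =ᵐ[volume] fun x => ρ x * u.toL2 x := by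
  rw [toL2_testMul]
  filter_upwards [coeFn_mulOp (testLInf ρ) u.toL2, coeFn_testLInf ρ] with x h1 h2
  rw [h1, h2]

end TestMul

end BiSchrodinger

namespace BiSchrodinger

/-! ### Convolution operators -/

section Convolution

open FourierTransform TemperedDistribution
open scoped BoundedContinuousFunction Convolution

theorem locallyIntegrable_L2 (f : L2) : LocallyIntegrable f :=
  (Lp.memLp f).locallyIntegrable one_le_two

/-- A continuous function on `ℝ³` that decays at least like `|x|⁻⁴`. -/
structure DecayingKernel (k : E3 → ℂ) : Prop where
  continuous : Continuous k
  decay : ∃ C, ∀ x, ‖k x‖ ≤ C * (1 + ‖x‖) ^ (-4 : ℝ)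

namespace DecayingKernel

variable {k : E3 → ℂ}

theorem integrable (hk : DecayingKernel k) : Integrable k := by
  obtain ⟨C, hC⟩ := hk.decay
  have h : Integrable fun x : E3 => (1 + ‖x‖) ^ (-4 : ℝ) :=
    integrable_one_add_norm (by simp; norm_num)
  exact (h.const_mul C).mono' hk.continuous.aestronglyMeasurable (Eventually.of_forall hC)

theorem bounded (hk : DecayingKernel k) : ∃ C, 0 ≤ C ∧ ∀ x, ‖k x‖ ≤ C := by
  obtain ⟨C, hC⟩ := hk.decay
  have h0 : 0 ≤ C := by
    have := (norm_nonneg _).trans (hC 0)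
    simpa using this
  refine ⟨C, h0, fun x => (hC x).trans ?_⟩
  exact mul_le_of_le_one_right h0
    (Real.rpow_le_one_of_one_le_of_nonpos (by simp) (by norm_num))

theorem memLp_two (hk : DecayingKernel k) : MemLp k 2 (volume : Measure E3) := by
  obtain ⟨C, h0, hC⟩ := hk.bounded
  rw [memLp_two_iff_integrable_sq_norm hk.continuous.aestronglyMeasurable]
  refine (hk.integrable.norm.const_mul C).mono'
    (hk.continuous.norm.pow 2).aestronglyMeasurable (Eventually.of_forall fun x => ?_)
  rw [Real.norm_of_nonneg (by positivity), sq]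
  exact mul_le_mul_of_nonneg_right (hC x) (norm_nonneg _)

/-- The translates `y ↦ k (x - y)` as elements of `L²(ℝ³)`. -/
noncomputable def trans (hk : DecayingKernel k) (x : E3) : L2 :=
  Lp.compMeasurePreserving (x - ·) (Measure.measurePreserving_sub_left volume x)
    (hk.memLp_two.toLp k)

theorem coeFn_trans (hk : DecayingKernel k) (x : E3) :
    hk.trans x =ᵐ[volume] fun y => k (x - y) :=
  (Lp.coeFn_compMeasurePreserving _ _).trans
    ((Measure.measurePreserving_sub_left volume x).quasiMeasurePreserving.ae_eq_comp
      hk.memLp_two.coeFn_toLp)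

theorem continuous_trans (hk : DecayingKernel k) : Continuous hk.trans := by
  let g : E3 → C(E3, E3) := fun x => ⟨fun y => x - y, by fun_prop⟩
  have hg : Continuous g := ContinuousMap.continuous_of_continuous_uncurry _ (by
    change Continuous fun p : E3 × E3 => p.1 - p.2
    fun_prop)
  exact Continuous.compMeasurePreservingLp (f := fun _ : E3 => hk.memLp_two.toLp k)
    continuous_const hg (fun x => Measure.measurePreserving_sub_left volume x) (by simp)

theorem norm_trans (hk : DecayingKernel k) (x : E3) : ‖hk.trans x‖ = ‖hk.memLp_two.toLp k‖ :=
  Lp.norm_compMeasurePreserving _ _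

/-- The functional `f ↦ ∫ k (x - y) f(y) dy` on `L²(ℝ³)`. -/
noncomputable def convAt (hk : DecayingKernel k) (x : E3) : L2 →L[ℂ] ℂ :=
  (ContinuousLinearMap.mul ℂ ℂ).lpPairing volume 2 2 (hk.trans x)

theorem convAt_apply (hk : DecayingKernel k) (x : E3) (f : L2) :
    hk.convAt x f = ∫ y, k (x - y) * f y := by
  rw [convAt, ContinuousLinearMap.lpPairing_eq_integral]
  refine integral_congr_ae ?_
  filter_upwards [hk.coeFn_trans x] with y hy
  rw [hy]
  rfl

/-- Norm continuity comes from the continuity of translations in `L²`. It makes `x ↦ V x • convAt x`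
measurable as a family of functionals, as the Hilbert–Schmidt argument requires. -/
theorem continuous_convAt (hk : DecayingKernel k) : Continuous hk.convAt :=
  ((ContinuousLinearMap.mul ℂ ℂ).lpPairing volume 2 2).continuous.comp hk.continuous_trans

theorem exists_norm_convAt_le (hk : DecayingKernel k) : ∃ C, ∀ x, ‖hk.convAt x‖ ≤ C :=
  ⟨_, fun x => ((ContinuousLinearMap.le_opNorm _ _).trans_eq (by rw [hk.norm_trans x]))⟩

theorem convAt_toLp (hk : DecayingKernel k) (φ : 𝓢(E3, ℂ)) (x : E3) :
    hk.convAt x (φ.toLp 2) = ((φ : E3 → ℂ) ⋆[ContinuousLinearMap.lsmul ℂ ℂ] k) x := by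
  rw [convAt_apply, convolution_def]
  refine integral_congr_ae ?_
  filter_upwards [φ.coeFn_toLp 2 volume] with y hy
  rw [hy, mul_comm]
  rfl

theorem _root_.BiSchrodinger.toDist_fm_toLp_apply (g : E3 →ᵇ ℂ) (φ Ψ : 𝓢(E3, ℂ)) :
    toDist (fm g (φ.toLp 2)) Ψ = ∫ ξ, (𝓕⁻ Ψ) ξ • (g ξ * (𝓕 φ) ξ) := by
  have : toDist (fm g (φ.toLp 2)) =
      𝓕⁻ ((mulOp (bcfToLInf g) (𝓕 (φ.toLp 2)) : L2) : 𝓢'(E3, ℂ)) := by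
    rw [Lp.fourierInv_toTemperedDistribution_eq]
    rfl
  rw [this, TemperedDistribution.fourierInv_apply,
    Lp.toTemperedDistribution_apply, SchwartzMap.toLp_fourier_eq]
  refine integral_congr_ae ?_
  filter_upwards [coeFn_mulOp_bcfToLInf g ((𝓕 φ).toLp 2), (𝓕 φ).coeFn_toLp 2 volume] with ξ e1 e2
  rw [e1, e2]

theorem _root_.BiSchrodinger.integral_smul_schwartz {h : E3 → ℂ} (hh : Integrable h)
    (Ψ : 𝓢(E3, ℂ)) : ∫ x, Ψ x • h x = ∫ ξ, (𝓕⁻ Ψ) ξ • 𝓕 h ξ := by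
  have e := VectorFourier.integral_fourierIntegral_smul_eq_flip (L := innerₗ E3)
    Real.continuous_fourierChar continuous_inner hh ((𝓕⁻ Ψ : 𝓢(E3, ℂ)).integrable (μ := volume))
  have e2 : ∀ x, VectorFourier.fourierIntegral Real.fourierChar volume (innerₗ E3).flip
      ((𝓕⁻ Ψ : 𝓢(E3, ℂ)) : E3 → ℂ) x = Ψ x := by
    intro x
    rw [flip_innerₗ]
    change 𝓕 ((𝓕⁻ Ψ : 𝓢(E3, ℂ)) : E3 → ℂ) x = Ψ x
    rw [← SchwartzMap.fourier_coe, FourierTransform.fourier_fourierInv_eq]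
  simp only [e2] at e
  calc ∫ x, Ψ x • h x = ∫ x, h x • Ψ x := by simp only [smul_eq_mul, mul_comm]
    _ = _ := e.symm
    _ = _ := by
      refine integral_congr_ae (Eventually.of_forall fun ξ => ?_)
      simp only [smul_eq_mul]
      rw [mul_comm]
      rfl

/-- Two locally integrable functions are compared by testing against smooth functions of compact
support. On the Fourier side both pairings contain `g * 𝓕 φ`, by the convolution theorem. -/
theorem fm_toLp (hk : DecayingKernel k) {g : E3 →ᵇ ℂ} (hg : ∀ ξ, g ξ = 𝓕 k ξ) (φ : 𝓢(E3, ℂ)) :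
    fm g (φ.toLp 2) =ᵐ[volume] fun x => hk.convAt x (φ.toLp 2) := by
  suffices h : ∀ᵐ x, fm g (φ.toLp 2) x = ((φ : E3 → ℂ) ⋆[ContinuousLinearMap.lsmul ℂ ℂ] k) x by
    filter_upwards [h] with x hx
    rw [hx, hk.convAt_toLp]
  have hloc : LocallyIntegrable (fm g (φ.toLp 2)) := locallyIntegrable_L2 _
  have hint : Integrable ((φ : E3 → ℂ) ⋆[ContinuousLinearMap.lsmul ℂ ℂ] k) :=
    φ.integrable.integrable_convolution _ hk.integrable
  refine ae_eq_of_integral_contDiff_smul_eq hloc hint.locallyIntegrable ?_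
  intro ψ hψ hψc
  have hψ' : ContDiff ℝ ∞ fun x => (ψ x : ℂ) := Complex.ofRealCLM.contDiff.comp hψ
  have hψc' : HasCompactSupport fun x => (ψ x : ℂ) := hψc.comp_left Complex.ofReal_zero
  have h1 : ∫ x, ψ x • fm g (φ.toLp 2) x =
      toDist (fm g (φ.toLp 2)) (hψc'.toSchwartzMap hψ') := by
    rw [Lp.toTemperedDistributionCLM_apply, Lp.toTemperedDistribution_apply]
    rfl
  have h2 := integral_smul_schwartz hint (hψc'.toSchwartzMap hψ')
  rw [h1, toDist_fm_toLp_apply]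
  refine Eq.trans ?_ h2.symm
  refine integral_congr_ae (Eventually.of_forall fun ξ => ?_)
  simp only [Real.fourier_smul_convolution_eq φ.integrable hk.integrable, hg,
    SchwartzMap.fourier_coe, smul_eq_mul]
  ring

/-- A Fourier multiplier whose symbol is the Fourier transform of a decaying kernel is a
convolution operator. -/
theorem fm_eq (hk : DecayingKernel k) {g : E3 →ᵇ ℂ} (hg : ∀ ξ, g ξ = 𝓕 k ξ) (f : L2) :
    fm g f =ᵐ[volume] fun x => hk.convAt x f := by
  refine DenseRange.induction_on
    (p := fun f : L2 => fm g f =ᵐ[volume] fun x => hk.convAt x f)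
    (SchwartzMap.denseRange_toLpCLM (E := E3) (F := ℂ) (p := 2) (μ := volume) (by simp)) f ?_
    (fun φ => hk.fm_toLp hg φ)
  -- Convergence in `L²` gives almost everywhere convergence of the left side along a subsequence,
  -- while the right side converges at every point.
  refine IsSeqClosed.isClosed fun u f hu hf => ?_
  have h1 := (tendstoInMeasure_of_tendsto_Lp (((fm g).continuous.tendsto f).comp hf))
  obtain ⟨ns, hns, h2⟩ := h1.exists_seq_tendsto_ae
  filter_upwards [h2, ae_all_iff.mpr hu] with x h3 h4
  have h5 : Tendsto (fun n => hk.convAt x (u (ns n))) atTop (𝓝 (hk.convAt x f)) :=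
    ((hk.convAt x).continuous.tendsto f).comp (hf.comp hns.tendsto_atTop)
  refine tendsto_nhds_unique h3 (h5.congr fun n => ?_)
  exact (h4 (ns n)).symm

end DecayingKernel

end Convolution

/-! ### Hilbert–Schmidt operators are limits of operators of finite rank -/

section HilbertSchmidt

open scoped BoundedContinuousFunction
open FourierTransform

/-- The function `x ↦ κ(x) f`, for a square integrable family `κ` of functionals. -/
noncomputable def hsApply (κ : Lp (L2 →L[ℂ] ℂ) 2 (volume : Measure E3)) (f : L2) : L2 :=
  (ContinuousLinearMap.apply ℂ ℂ f).compLp κ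

theorem coeFn_hsApply (κ : Lp (L2 →L[ℂ] ℂ) 2 (volume : Measure E3)) (f : L2) :
    hsApply κ f =ᵐ[volume] fun x => κ x f :=
  ContinuousLinearMap.coeFn_compLp (ContinuousLinearMap.apply ℂ ℂ f) κ

/-- The bilinear map `hsApply`. -/
noncomputable def hsLinear : Lp (L2 →L[ℂ] ℂ) 2 (volume : Measure E3) →ₗ[ℂ] L2 →ₗ[ℂ] L2 :=
  LinearMap.mk₂ ℂ hsApply
    (fun κ κ' f => by
      apply Lp.ext
      filter_upwards [coeFn_hsApply (κ + κ') f, coeFn_hsApply κ f, coeFn_hsApply κ' f,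
        Lp.coeFn_add κ κ', Lp.coeFn_add (hsApply κ f) (hsApply κ' f)] with x h1 h2 h3 h4 h5
      rw [h1, h4, h5, Pi.add_apply, Pi.add_apply, h2, h3, add_apply])
    (fun c κ f => by
      apply Lp.ext
      filter_upwards [coeFn_hsApply (c • κ) f, coeFn_hsApply κ f,
        Lp.coeFn_smul c κ, Lp.coeFn_smul c (hsApply κ f)] with x h1 h2 h3 h4
      rw [h1, h3, h4, Pi.smul_apply, Pi.smul_apply, h2, smul_apply])
    (fun κ f f' => by
      apply Lp.ext
      filter_upwards [coeFn_hsApply κ (f + f'), coeFn_hsApply κ f, coeFn_hsApply κ f',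
        Lp.coeFn_add (hsApply κ f) (hsApply κ f')] with x h1 h2 h3 h4
      rw [h1, h4, Pi.add_apply, h2, h3, map_add])
    (fun c κ f => by
      apply Lp.ext
      filter_upwards [coeFn_hsApply κ (c • f), coeFn_hsApply κ f,
        Lp.coeFn_smul c (hsApply κ f)] with x h1 h2 h3
      rw [h1, h3, Pi.smul_apply, h2, map_smul])

/-- The operator `f ↦ (x ↦ κ(x) f)` defined by a square integrable family of functionals. -/
noncomputable def hsOp : Lp (L2 →L[ℂ] ℂ) 2 (volume : Measure E3) →L[ℂ] L2 →L[ℂ] L2 :=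
  LinearMap.mkContinuous₂ hsLinear 1 <| by
    intro κ f
    rw [one_mul, mul_comm]
    refine Lp.norm_le_mul_norm_of_ae_le_mul ?_
    filter_upwards [coeFn_hsApply κ f] with x hx
    rw [show hsLinear κ f = hsApply κ f from rfl, hx, mul_comm]
    exact (κ x).le_opNorm f

theorem coeFn_hsOp (κ : Lp (L2 →L[ℂ] ℂ) 2 (volume : Measure E3)) (f : L2) :
    hsOp κ f =ᵐ[volume] fun x => κ x f :=
  coeFn_hsApply κ f

/-- The indicator of a set times a fixed functional gives an operator of rank at most one. Sums of
these are dense in the space of families `κ`, and `hsOp` is continuous. -/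
theorem hsOp_mem_approximable (κ : Lp (L2 →L[ℂ] ℂ) 2 (volume : Measure E3)) :
    hsOp κ ∈ approximable L2 L2 := by
  refine Lp.induction (by simp) (fun κ => hsOp κ ∈ approximable L2 L2) ?_ ?_ ?_ κ
  · intro c s hs hμs
    refine finiteRank_le_approximable ?_
    have h : hsOp (Lp.simpleFunc.indicatorConst 2 hs hμs.ne c : Lp (L2 →L[ℂ] ℂ) 2 (volume : Measure E3)) =
        ContinuousLinearMap.smulRight c (indicatorConstLp 2 hs hμs.ne (1 : ℂ)) := by
      ext1 f
      apply Lp.ext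
      rw [Lp.simpleFunc.coe_indicatorConst]
      filter_upwards [coeFn_hsOp (indicatorConstLp 2 hs hμs.ne c) f,
        indicatorConstLp_coeFn (μ := (volume : Measure E3)) (p := 2) (hs := hs) (hμs := hμs.ne) (c := c),
        indicatorConstLp_coeFn (μ := (volume : Measure E3)) (p := 2) (hs := hs) (hμs := hμs.ne)
          (c := (1 : ℂ)),
        Lp.coeFn_smul (c f) (indicatorConstLp 2 hs hμs.ne (1 : ℂ))] with x h1 h2 h3 h4
      rw [h1, h2, ContinuousLinearMap.smulRight_apply, h4, Pi.smul_apply, h3]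
      by_cases hx : x ∈ s <;> simp [hx]
    rw [h, mem_finiteRank]
    refine Submodule.finiteDimensional_of_le
      (S₂ := Submodule.span ℂ {indicatorConstLp 2 hs hμs.ne (1 : ℂ)}) ?_
    rintro _ ⟨f, rfl⟩
    exact Submodule.smul_mem _ _ (Submodule.mem_span_singleton_self _)
  · intro f g hf hg _ h1 h2
    rw [map_add]
    exact Submodule.add_mem _ h1 h2
  · exact isClosed_approximable.preimage hsOp.continuous

variable {k : E3 → ℂ}

/-- The functionals `convAt x` are bounded uniformly in `x`, so a factor `V` in `L²` makes the
family square integrable. -/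
theorem DecayingKernel.mulOp_fm_mem_approximable (hk : DecayingKernel k) {g : E3 →ᵇ ℂ}
    (hg : ∀ ξ, g ξ = 𝓕 k ξ) {V : LInf} (hV : MemLp V 2 (volume : Measure E3)) :
    mulOp V ∘L fm g ∈ approximable L2 L2 := by
  obtain ⟨C, hC⟩ := hk.exists_norm_convAt_le
  have hκ : MemLp (fun x => V x • hk.convAt x) 2 (volume : Measure E3) := by
    refine hV.of_le_mul (c := C)
      (hV.aestronglyMeasurable.smul hk.continuous_convAt.aestronglyMeasurable)
      (Eventually.of_forall fun x => ?_)
    rw [norm_smul, mul_comm]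
    exact mul_le_mul_of_nonneg_right (hC x) (norm_nonneg _)
  have h : mulOp V ∘L fm g = hsOp (hκ.toLp _) := by
    ext1 f
    apply Lp.ext
    filter_upwards [coeFn_mulOp V (fm g f), hk.fm_eq hg f, coeFn_hsOp (hκ.toLp _) f,
      hκ.coeFn_toLp] with x h1 h2 h3 h4
    rw [ContinuousLinearMap.comp_apply, h1, h2, h3, h4]
    rfl
  rw [h]
  exact hsOp_mem_approximable _

end HilbertSchmidt

/-! ### Cut-off convolution operators -/

section Cutoff

open scoped BoundedContinuousFunction
open FourierTransform

/-- The measurable function `f` vanishes almost everywhere outside the ball of radius `r`. -/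
def BallSupp (r : ℝ) (f : E3 → ℂ) : Prop := ∀ᵐ x ∂(volume : Measure E3), r < ‖x‖ → f x = 0

theorem BallSupp.mono {r r' : ℝ} (h : r ≤ r') {f : E3 → ℂ} (hf : BallSupp r f) : BallSupp r' f :=
  Eventually.mono (show ∀ᵐ x ∂(volume : Measure E3), r < ‖x‖ → f x = 0 from hf)
    fun _ hx hr => hx (h.trans_lt hr)

theorem CompSupp.exists_ballSupp {f : E3 → ℂ} (hf : CompSupp f) : ∃ r, 0 ≤ r ∧ BallSupp r f := by
  obtain ⟨K, hK, h⟩ := hf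
  obtain ⟨r, hr⟩ := hK.isBounded.exists_norm_le
  refine ⟨max r 0, le_max_right _ _, ?_⟩
  filter_upwards [h] with x hx hrx
  refine hx fun hxK => ?_
  exact absurd ((hr x hxK).trans (le_max_left r 0)) (not_le.mpr hrx)

theorem BallSupp.mulOp {r : ℝ} {χ : LInf} (hχ : BallSupp r χ) (f : L2) :
    BallSupp r (mulOp χ f) := by
  filter_upwards [show ∀ᵐ x ∂(volume : Measure E3), r < ‖x‖ → χ x = 0 from hχ, coeFn_mulOp χ f]
    with x h1 h2 hr
  rw [h2, h1 hr, zero_mul]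

theorem BallSupp.memLp_two {r : ℝ} {χ : LInf} (hχ : BallSupp r χ) :
    MemLp χ 2 (volume : Measure E3) := by
  have h1 : MemLp χ 2 ((volume : Measure E3).restrict (Metric.closedBall 0 r)) := by
    have : IsFiniteMeasure ((volume : Measure E3).restrict (Metric.closedBall 0 r)) :=
      ⟨by rw [Measure.restrict_apply_univ]; exact measure_closedBall_lt_top⟩
    exact ((Lp.memLp χ).restrict _).mono_exponent le_top
  have h2 := (memLp_indicator_iff_restrict Metric.isClosed_closedBall.measurableSet).mpr h1
  refine (memLp_congr_ae ?_).mp h2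
  filter_upwards [show ∀ᵐ x ∂(volume : Measure E3), r < ‖x‖ → χ x = 0 from hχ] with x hx
  by_cases h : x ∈ Metric.closedBall (0 : E3) r
  · rw [indicator_of_mem h]
  · rw [indicator_of_notMem h, hx (by simpa using h)]

/-- The characteristic function of a ball. -/
noncomputable def ballInd (r : ℝ) : LInf :=
  indicatorConstLp ∞ (μ := volume) (Metric.isClosed_closedBall (x := (0 : E3)) (ε := r)).measurableSet
    measure_closedBall_lt_top.ne 1

theorem coeFn_ballInd (r : ℝ) :
    ballInd r =ᵐ[volume] (Metric.closedBall (0 : E3) r).indicator fun _ => (1 : ℂ) :=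
  indicatorConstLp_coeFn

theorem ballSupp_ballInd (r : ℝ) : BallSupp r (ballInd r) := by
  filter_upwards [coeFn_ballInd r] with x h hr
  rw [h, indicator_of_notMem (by simpa using hr)]

theorem mulOp_ballInd {r : ℝ} {f : L2} (hf : BallSupp r f) : mulOp (ballInd r) f = f := by
  apply Lp.ext
  filter_upwards [coeFn_mulOp (ballInd r) f, coeFn_ballInd r,
    show ∀ᵐ x ∂(volume : Measure E3), r < ‖x‖ → f x = 0 from hf] with x h1 h2 h3
  rw [h1, h2]
  by_cases h : x ∈ Metric.closedBall (0 : E3) r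
  · rw [indicator_of_mem h, one_mul]
  · rw [h3 (by simpa using h), mul_zero]

/-- For kernels that agree on a ball the convolutions with a function of compact support agree on a
smaller ball. -/
theorem integral_kernel_congr {k k' : E3 → ℂ} {a b : ℝ} (h : ∀ x, ‖x‖ ≤ a + b → k x = k' x)
    {f : E3 → ℂ} (hf : BallSupp b f) {x : E3} (hx : ‖x‖ ≤ a) :
    ∫ y, k (x - y) * f y = ∫ y, k' (x - y) * f y := by
  refine integral_congr_ae ?_
  filter_upwards [show ∀ᵐ x ∂(volume : Measure E3), b < ‖x‖ → f x = 0 from hf] with y hy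
  by_cases h1 : b < ‖y‖
  · simp only [hy h1, mul_zero]
  · rw [h]
    exact (norm_sub_le _ _).trans (add_le_add hx (not_lt.mp h1))

/-- Cauchy–Schwarz puts `χ f` in `L¹`, and a bounded kernel maps `L¹` to `L^∞`. The bound uses only
the supremum of the kernel, which is `1/|k|` at most in the application. -/
theorem DecayingKernel.norm_mulOp_fm_mulOp_le {k : E3 → ℂ} (hk : DecayingKernel k) {g : E3 →ᵇ ℂ}
    (hg : ∀ ξ, g ξ = 𝓕 k ξ) {V χ : LInf} (hV : MemLp V 2 (volume : Measure E3))
    (hχ : MemLp χ 2 (volume : Measure E3)) {M : ℝ} (hM0 : 0 ≤ M) (hM : ∀ x, ‖k x‖ ≤ M) :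
    ‖mulOp V ∘L fm g ∘L mulOp χ‖ ≤ M * (‖hV.toLp V‖ * ‖hχ.toLp χ‖) := by
  refine ContinuousLinearMap.opNorm_le_bound _ (by positivity) fun f => ?_
  have h0 : ∫ y, ‖χ y * f y‖ ≤ ‖hχ.toLp χ‖ * ‖f‖ := by
    have e1 : ∫ y, ‖χ y * f y‖ = ‖(ContinuousLinearMap.mul ℂ ℂ).holderL volume 2 2 1 (hχ.toLp χ) f‖ := by
      rw [L1.norm_eq_integral_norm]
      refine integral_congr_ae ?_
      filter_upwards [ContinuousLinearMap.coeFn_holder (r := 1) (ContinuousLinearMap.mul ℂ ℂ)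
        (hχ.toLp χ) f, hχ.coeFn_toLp] with y h1 h2
      change _ = ‖(ContinuousLinearMap.holder 1 (ContinuousLinearMap.mul ℂ ℂ) (hχ.toLp χ) f : E3 → ℂ) y‖
      rw [h1, h2]
      rfl
    rw [e1]
    refine ((ContinuousLinearMap.mul ℂ ℂ).norm_holder_apply_apply_le _ _).trans ?_
    have : ‖ContinuousLinearMap.mul ℂ ℂ‖ ≤ 1 := ContinuousLinearMap.opNorm_mul_le ℂ ℂ
    nlinarith [mul_nonneg (norm_nonneg (hχ.toLp χ)) (norm_nonneg f)]
  have h1 : ∀ x, ‖hk.convAt x (mulOp χ f)‖ ≤ M * (‖hχ.toLp χ‖ * ‖f‖) := by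
    intro x
    rw [hk.convAt_apply]
    have hi : Integrable fun y => χ y * f y := hχ.integrable_mul (Lp.memLp f)
    have e2 : ∫ y, k (x - y) * (mulOp χ f) y = ∫ y, k (x - y) * (χ y * f y) := by
      refine integral_congr_ae ?_
      filter_upwards [coeFn_mulOp χ f] with y hy
      rw [hy]
    rw [e2]
    calc ‖∫ y, k (x - y) * (χ y * f y)‖ ≤ ∫ y, M * ‖χ y * f y‖ := by
          refine norm_integral_le_of_norm_le (hi.norm.const_mul M) (Eventually.of_forall fun y => ?_)
          rw [norm_mul]
          exact mul_le_mul_of_nonneg_right (hM _) (norm_nonneg _)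
      _ = M * ∫ y, ‖χ y * f y‖ := integral_const_mul _ _
      _ ≤ _ := mul_le_mul_of_nonneg_left h0 hM0
  have h2 : ‖mulOp V (fm g (mulOp χ f))‖ ≤ (M * (‖hχ.toLp χ‖ * ‖f‖)) * ‖hV.toLp V‖ := by
    refine Lp.norm_le_mul_norm_of_ae_le_mul ?_
    filter_upwards [coeFn_mulOp V (fm g (mulOp χ f)), hk.fm_eq hg (mulOp χ f), hV.coeFn_toLp]
      with x e1 e2 e3
    rw [e1, e2, e3, norm_mul, mul_comm]
    exact mul_le_mul_of_nonneg_right (h1 x) (norm_nonneg _)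
  calc _ ≤ _ := h2
    _ = _ := by ring

end Cutoff

end BiSchrodinger

namespace BiSchrodinger

/-! ### The Fourier transform of a radial function on `ℝ³` -/

section Radial

open FourierTransform

/-- Cylindrical coordinates on `ℝ³`. -/
noncomputable def cylEquiv : ℝ × (ℝ × ℝ) ≃ᵐ E3 :=
  ((MeasurableEquiv.prodCongr (MeasurableEquiv.refl ℝ) MeasurableEquiv.finTwoArrow.symm).trans
    (MeasurableEquiv.piFinSuccAbove (fun _ : Fin 3 => ℝ) 0).symm).trans
      (MeasurableEquiv.toLp 2 (Fin 3 → ℝ))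

theorem cylEquiv_apply (z : ℝ) (p : ℝ × ℝ) : cylEquiv (z, p) = !₂[z, p.1, p.2] := by
  ext i
  fin_cases i <;> rfl

theorem measurePreserving_cylEquiv : MeasurePreserving cylEquiv := by
  refine ((MeasurePreserving.id (volume : Measure ℝ)).prod
    ((volume_preserving_finTwoArrow ℝ).symm)).trans ?_ |>.trans (PiLp.volume_preserving_toLp (Fin 3))
  exact (volume_preserving_piFinSuccAbove (fun _ : Fin 3 => ℝ) 0).symm

theorem norm_cyl (z : ℝ) (p : ℝ × ℝ) :
    ‖(!₂[z, p.1, p.2] : E3)‖ = √(z ^ 2 + √(p.1 ^ 2 + p.2 ^ 2) ^ 2) := by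
  rw [EuclideanSpace.norm_eq, Fin.sum_univ_three, Real.sq_sqrt (by positivity)]
  simp [add_assoc]

/-- The reflection that exchanges `ξ` with the vector of the same length on the first axis leaves
`k` invariant and commutes with the Fourier transform. -/
theorem fourier_radial_eq {k : E3 → ℂ} (hk : ∀ x y, ‖x‖ = ‖y‖ → k x = k y) (ξ : E3) :
    𝓕 k ξ = 𝓕 k (EuclideanSpace.single 0 ‖ξ‖) := by
  have h : ‖ξ‖ = ‖(EuclideanSpace.single 0 ‖ξ‖ : E3)‖ := by simp
  have h1 := Submodule.reflection_sub h
  have h2 := Real.fourier_comp_linearIsometry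
    (Submodule.reflection (ℝ ∙ (ξ - EuclideanSpace.single 0 ‖ξ‖))ᗮ) k ξ
  have h3 : k ∘ Submodule.reflection (ℝ ∙ (ξ - EuclideanSpace.single 0 ‖ξ‖))ᗮ = k :=
    funext fun x => hk _ _ (by simp)
  rw [h1, h3] at h2
  exact h2

theorem fourier_single {k : E3 → ℂ} (hk : Integrable k) (s : ℝ) :
    𝓕 k (EuclideanSpace.single 0 s) =
      ∫ z : ℝ, (Real.fourierChar (-(z * s)) : ℂ) * ∫ p : ℝ × ℝ, k (!₂[z, p.1, p.2]) := by
  rw [Real.fourier_eq, ← measurePreserving_cylEquiv.integral_comp cylEquiv.measurableEmbedding,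
    Measure.volume_eq_prod, integral_prod]
  · refine integral_congr_ae (Eventually.of_forall fun z => ?_)
    simp only [cylEquiv_apply]
    rw [← integral_const_mul]
    refine integral_congr_ae (Eventually.of_forall fun p => ?_)
    have h1 : inner ℝ (!₂[z, p.1, p.2] : E3) (EuclideanSpace.single 0 s) = z * s := by
      rw [EuclideanSpace.inner_single_right]
      simp [mul_comm]
    simp only [Circle.smul_def, h1, smul_eq_mul]
  · have h1 : Integrable fun x : E3 => Real.fourierChar (-inner ℝ x (EuclideanSpace.single 0 s)) • k x :=
      (Real.fourierIntegral_convergent_iff _).2 hk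
    exact (measurePreserving_cylEquiv.integrable_comp_emb cylEquiv.measurableEmbedding).2 h1

theorem integral_radial_plane (F : ℝ → ℂ) :
    ∫ p : ℝ × ℝ, F (√(p.1 ^ 2 + p.2 ^ 2)) = (2 * Real.pi : ℂ) * ∫ r in Ioi (0 : ℝ), r * F r := by
  rw [← integral_comp_polarCoord_symm]
  have h1 : ∫ p in polarCoord.target, p.1 • F (√((polarCoord.symm p).1 ^ 2 + (polarCoord.symm p).2 ^ 2))
      = ∫ p in Ioi (0 : ℝ) ×ˢ Ioo (-Real.pi) Real.pi, ((p.1 : ℂ) * F p.1) * (1 : ℂ) := by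
    rw [polarCoord_target]
    refine setIntegral_congr_fun (measurableSet_Ioi.prod measurableSet_Ioo) fun p hp => ?_
    have h2 : 0 < p.1 := hp.1
    have h3 : (p.1 * Real.cos p.2) ^ 2 + (p.1 * Real.sin p.2) ^ 2 = p.1 ^ 2 := by
      rw [mul_pow, mul_pow, ← mul_add, Real.cos_sq_add_sin_sq, mul_one]
    simp only [polarCoord_symm_apply, h3, Real.sqrt_sq h2.le, Complex.real_smul, mul_one]
  rw [h1, Measure.volume_eq_prod,
    setIntegral_prod_mul (fun r : ℝ => (r : ℂ) * F r) (fun _ : ℝ => (1 : ℂ))]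
  rw [mul_comm]
  congr 1
  simp [Real.pi_pos.le]
  ring

/-- Substitute `t = √(z² + r²)`, for which `dt = (r / t) dr`. The weight `1/|x|` of the kernel is
exactly what this needs. -/
theorem integral_comp_sqrt (h : ℝ → ℂ) {z : ℝ} (hz : z ≠ 0) :
    ∫ r in Ioi (0 : ℝ), r * (h (√(z ^ 2 + r ^ 2)) / (√(z ^ 2 + r ^ 2) : ℝ)) =
      ∫ r in Ioi |z|, h r := by
  have hz2 : 0 < z ^ 2 := by positivity
  have himg : (fun r : ℝ => √(z ^ 2 + r ^ 2)) '' Ioi 0 = Ioi |z| := by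
    ext t
    constructor
    · rintro ⟨r, hr, rfl⟩
      have hr : 0 < r := hr
      rw [mem_Ioi, ← Real.sqrt_sq_eq_abs]
      exact Real.sqrt_lt_sqrt hz2.le (by linarith [pow_pos hr 2])
    · intro ht
      have ht : |z| < t := ht
      have ht0 : 0 < t := (abs_nonneg z).trans_lt ht
      have h1 : z ^ 2 < t ^ 2 := sq_lt_sq.mpr (by rwa [abs_of_pos ht0])
      refine ⟨√(t ^ 2 - z ^ 2), Real.sqrt_pos.mpr (by linarith), ?_⟩
      simp only
      rw [Real.sq_sqrt (by linarith), add_sub_cancel, Real.sqrt_sq ht0.le]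
  have hder : ∀ r ∈ Ioi (0 : ℝ), HasDerivWithinAt (fun r : ℝ => √(z ^ 2 + r ^ 2))
      (r / √(z ^ 2 + r ^ 2)) (Ioi 0) r := by
    intro r _
    have h1 : HasDerivAt (fun r : ℝ => z ^ 2 + r ^ 2) (2 * r) r := by
      simpa using (hasDerivAt_pow 2 r).const_add (z ^ 2)
    have h2 := h1.sqrt (by positivity)
    rw [mul_div_mul_left _ _ two_ne_zero] at h2
    exact h2.hasDerivWithinAt
  have hinj : InjOn (fun r : ℝ => √(z ^ 2 + r ^ 2)) (Ioi 0) := by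
    intro r hr r' hr' h1
    have h2 := (Real.sqrt_inj (by positivity) (by positivity)).mp h1
    exact (pow_left_inj₀ (le_of_lt hr) (le_of_lt hr') two_ne_zero).mp (by linarith)
  rw [← himg, integral_image_eq_integral_abs_deriv_smul measurableSet_Ioi hder hinj]
  refine setIntegral_congr_fun measurableSet_Ioi fun r hr => ?_
  have hr : 0 < r := hr
  rw [abs_of_pos (div_pos hr (Real.sqrt_pos.mpr (by positivity))), Complex.real_smul]
  push_cast
  ring

theorem integral_fourierChar_symm (s : ℝ) {r : ℝ} (hr : 0 < r) :
    ∫ z : ℝ, (Ioo (-r) r).indicator (fun z => (Real.fourierChar (-(z * s)) : ℂ)) z =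
      ((2 * (r * Real.sinc (2 * Real.pi * s * r)) : ℝ) : ℂ) := by
  rw [integral_indicator measurableSet_Ioo, ← integral_Ioc_eq_integral_Ioo,
    ← intervalIntegral.integral_of_le (by linarith)]
  simp only [Real.fourierChar_apply]
  rcases eq_or_ne s 0 with rfl | hs
  · simp
    ring
  · have hc : (-(2 * Real.pi * s) * Complex.I : ℂ) ≠ 0 := by
      simp [hs, Real.pi_ne_zero]
    have h1 : ∀ z : ℝ, Complex.exp (((2 * Real.pi * -(z * s) : ℝ) : ℂ) * Complex.I) =
        Complex.exp ((-(2 * Real.pi * s) * Complex.I) * z) := by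
      intro z
      congr 1
      push_cast
      ring
    simp only [h1]
    rw [integral_exp_mul_complex hc]
    have hne : 2 * Real.pi * s * r ≠ 0 := by
      have := Real.pi_ne_zero
      positivity
    rw [Real.sinc_of_ne_zero hne]
    have h2 : ((Real.sin (2 * Real.pi * s * r) : ℝ) : ℂ) =
        (Complex.exp (-(2 * Real.pi * s * r : ℂ) * Complex.I) -
          Complex.exp ((2 * Real.pi * s * r : ℂ) * Complex.I)) * Complex.I / 2 := by
      rw [Complex.ofReal_sin, Complex.sin]
      push_cast
      ring_nf
    have h3 : (-(2 * Real.pi * s) * Complex.I : ℂ) * (r : ℝ) =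
        -(2 * Real.pi * s * r : ℂ) * Complex.I := by ring
    have h4 : (-(2 * Real.pi * s) * Complex.I : ℂ) * ((-r : ℝ) : ℂ) =
        (2 * Real.pi * s * r : ℂ) * Complex.I := by
      push_cast
      ring
    rw [h3, h4]
    push_cast [h2]
    have hs' : (s : ℂ) ≠ 0 := by exact_mod_cast hs
    have hp' : (Real.pi : ℂ) ≠ 0 := by exact_mod_cast Real.pi_ne_zero
    have hr' : (r : ℂ) ≠ 0 := by exact_mod_cast hr.ne'
    field_simp
    rw [Complex.I_sq]
    ring

/-- The Fourier transform of the radial function `h(|x|) / (4π|x|)`. -/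
theorem fourier_radial {k : E3 → ℂ} (hk : Integrable k) {h : ℝ → ℂ} (hc : Continuous h)
    (hi : IntegrableOn (fun r : ℝ => (r : ℂ) * h r) (Ioi 0))
    (hkh : ∀ x ≠ 0, k x = h ‖x‖ / (4 * Real.pi * ‖x‖)) (ξ : E3) :
    𝓕 k ξ = ∫ r in Ioi (0 : ℝ), ((r * Real.sinc (2 * Real.pi * ‖ξ‖ * r) : ℝ) : ℂ) * h r := by
  have hrad : ∀ x y, ‖x‖ = ‖y‖ → k x = k y := by
    intro x y hxy
    rcases eq_or_ne x 0 with rfl | hx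
    · rw [norm_zero, eq_comm, norm_eq_zero] at hxy
      rw [hxy]
    · have hy : y ≠ 0 := by
        rw [← norm_ne_zero_iff, ← hxy]
        exact norm_ne_zero_iff.mpr hx
      rw [hkh x hx, hkh y hy, hxy]
  rw [fourier_radial_eq hrad, fourier_single hk]
  set s := ‖ξ‖
  -- The plane at height `z` contributes half the integral of `h` over `r > |z|`. The condition is
  -- written as an indicator in `z`, so that Fubini leaves the character integrated over `(-r, r)`.
  have h1 : ∀ᵐ z : ℝ, (Real.fourierChar (-(z * s)) : ℂ) * ∫ p : ℝ × ℝ, k (!₂[z, p.1, p.2]) =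
      ∫ r in Ioi (0 : ℝ), (1 / 2 * h r) *
        (Ioo (-r) r).indicator (fun z => (Real.fourierChar (-(z * s)) : ℂ)) z := by
    filter_upwards [compl_mem_ae_iff.mpr (measure_singleton (μ := (volume : Measure ℝ)) 0)] with z hz
    have hz : z ≠ 0 := hz
    have e1 : ∀ p : ℝ × ℝ, k (!₂[z, p.1, p.2]) =
        (fun r : ℝ => h (√(z ^ 2 + r ^ 2)) / (4 * Real.pi * (√(z ^ 2 + r ^ 2) : ℝ)))
          (√(p.1 ^ 2 + p.2 ^ 2)) := by
      intro p
      rw [hkh _ fun h0 => hz (by simpa using congrArg (fun x : E3 => x 0) h0), norm_cyl]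
    simp only [e1]
    rw [integral_radial_plane fun r : ℝ =>
      h (√(z ^ 2 + r ^ 2)) / (4 * Real.pi * (√(z ^ 2 + r ^ 2) : ℝ))]
    have hp' : (Real.pi : ℂ) ≠ 0 := by exact_mod_cast Real.pi_ne_zero
    have e2 : (2 * Real.pi : ℂ) * ∫ r in Ioi (0 : ℝ), r *
        (h (√(z ^ 2 + r ^ 2)) / (4 * Real.pi * (√(z ^ 2 + r ^ 2) : ℝ))) =
        1 / 2 * ∫ r in Ioi |z|, h r := by
      rw [← integral_comp_sqrt h hz, ← integral_const_mul, ← integral_const_mul]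
      refine integral_congr_ae (Eventually.of_forall fun r => ?_)
      simp only
      field_simp
      ring
    rw [e2]
    have e3 : ∫ r in Ioi (0 : ℝ), (1 / 2 * h r) *
        (Ioo (-r) r).indicator (fun z => (Real.fourierChar (-(z * s)) : ℂ)) z =
        ∫ r in Ioi |z|, (1 / 2 * h r) * (Real.fourierChar (-(z * s)) : ℂ) := by
      rw [← integral_indicator measurableSet_Ioi, ← integral_indicator measurableSet_Ioi]
      refine integral_congr_ae (Eventually.of_forall fun r => ?_)
      simp only [indicator, mem_Ioi, mem_Ioo]
      by_cases hr : |z| < r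
      · rw [if_pos ((abs_nonneg z).trans_lt hr), if_pos (abs_lt.mp hr), if_pos hr]
      · rw [if_neg hr]
        split_ifs with h2 h3
        · exact absurd (abs_lt.mpr h3) hr
        · rw [mul_zero]
        · rfl
    rw [e3, integral_mul_const, integral_const_mul]
    ring
  rw [integral_congr_ae h1, integral_integral_swap]
  · refine setIntegral_congr_fun measurableSet_Ioi fun r hr => ?_
    rw [integral_const_mul, integral_fourierChar_symm s hr]
    push_cast
    ring
  · have hm : AEStronglyMeasurable (fun p : ℝ × ℝ => (1 / 2 * h p.2) *
        (Ioo (-p.2) p.2).indicator (fun z => (Real.fourierChar (-(z * s)) : ℂ)) p.1)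
        ((volume : Measure ℝ).prod (volume.restrict (Ioi 0))) := by
      have e : (fun p : ℝ × ℝ =>
          (Ioo (-p.2) p.2).indicator (fun z => (Real.fourierChar (-(z * s)) : ℂ)) p.1) =
          {p : ℝ × ℝ | -p.2 < p.1 ∧ p.1 < p.2}.indicator
            fun p => (Real.fourierChar (-(p.1 * s)) : ℂ) := by
        funext p
        rfl
      refine AEStronglyMeasurable.mul (by fun_prop) ?_
      rw [e]
      refine AEStronglyMeasurable.indicator (Continuous.aestronglyMeasurable ?_) ?_
      · exact continuous_subtype_val.comp (Real.continuous_fourierChar.comp (by fun_prop))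
      · exact (measurableSet_lt measurable_snd.neg measurable_fst).inter
          (measurableSet_lt measurable_fst measurable_snd)
    refine (integrable_prod_iff' hm).mpr ⟨Eventually.of_forall fun r => ?_, ?_⟩
    · simp only
      refine Integrable.const_mul ?_ _
      rw [integrable_indicator_iff measurableSet_Ioo]
      refine (Continuous.integrableOn_Icc (a := -r) (b := r) ?_).mono_set Ioo_subset_Icc_self
      exact continuous_subtype_val.comp (Real.continuous_fourierChar.comp (by fun_prop))
    -- The `z`-integral of the norm over `(-r, r)` is `r |h r|`, integrable by hypothesis.
    · refine (hi.norm).congr ?_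
      filter_upwards [ae_restrict_mem measurableSet_Ioi] with r hr
      have hr : 0 < r := hr
      have e : ∀ z : ℝ, ‖(1 / 2 * h r) *
          (Ioo (-r) r).indicator (fun z => (Real.fourierChar (-(z * s)) : ℂ)) z‖ =
          (1 / 2 * ‖h r‖) * (Ioo (-r) r).indicator (fun _ => (1 : ℝ)) z := by
        intro z
        rw [norm_mul, norm_mul]
        by_cases hz : z ∈ Ioo (-r) r
        · rw [indicator_of_mem hz, indicator_of_mem hz, Circle.norm_coe]
          simp
        · rw [indicator_of_notMem hz, indicator_of_notMem hz]
          simp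
      simp only [e]
      rw [integral_const_mul, integral_indicator measurableSet_Ioo]
      simp [abs_of_pos hr, hr.le]
      ring

end Radial

end BiSchrodinger

namespace BiSchrodinger

/-! ### Radial kernels with a compactly supported profile -/

section Profile

open FourierTransform BoundedContinuousFunction

/-- For `s ≠ 0` the function is `sin (s r) / s`; with `sinc` the frequency `s = 0` needs no separate
treatment later. -/
theorem hasDerivAt_mul_sinc (s r : ℝ) :
    HasDerivAt (fun r : ℝ => ((r * Real.sinc (s * r) : ℝ) : ℂ)) ((Real.cos (s * r) : ℝ) : ℂ) r := by
  refine HasDerivAt.ofReal_comp ?_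
  rcases eq_or_ne s 0 with rfl | hs
  · simpa using hasDerivAt_id' r
  · have h1 : (fun r : ℝ => r * Real.sinc (s * r)) = fun r => Real.sin (s * r) / s := by
      funext t
      rcases eq_or_ne t 0 with rfl | ht
      · simp
      · rw [Real.sinc_of_ne_zero (mul_ne_zero hs ht)]
        field_simp
    rw [h1]
    have h2 := (((hasDerivAt_id' r).const_mul s).sin).div_const s
    rwa [mul_one, mul_div_cancel_right₀ _ hs] at h2

theorem hasDerivAt_cos_mul (s r : ℝ) :
    HasDerivAt (fun r : ℝ => ((Real.cos (s * r) : ℝ) : ℂ))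
      (-(s : ℂ) ^ 2 * ((r * Real.sinc (s * r) : ℝ) : ℂ)) r := by
  have h1 : (-(s : ℂ) ^ 2 * ((r * Real.sinc (s * r) : ℝ) : ℂ)) =
      ((-s ^ 2 * (r * Real.sinc (s * r)) : ℝ) : ℂ) := by
    push_cast
    ring
  rw [h1]
  refine HasDerivAt.ofReal_comp ?_
  have h2 := ((hasDerivAt_id' r).const_mul s).cos
  convert h2 using 1
  rw [mul_one]
  rcases eq_or_ne (s * r) 0 with h0 | h0
  · rw [h0]
    rcases mul_eq_zero.mp h0 with rfl | rfl <;> simp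
  · rw [Real.sinc_of_ne_zero h0]
    have hs := left_ne_zero_of_mul h0
    have hr := right_ne_zero_of_mul h0
    field_simp

theorem continuous_mul_sinc (s : ℝ) :
    Continuous fun r : ℝ => ((r * Real.sinc (s * r) : ℝ) : ℂ) :=
  continuous_iff_continuousAt.mpr fun r => (hasDerivAt_mul_sinc s r).continuousAt

theorem continuous_cos_mul (s : ℝ) : Continuous fun r : ℝ => ((Real.cos (s * r) : ℝ) : ℂ) :=
  continuous_iff_continuousAt.mpr fun r => (hasDerivAt_cos_mul s r).continuousAt

/-- Integration by parts, `-s² r sinc (s r)` being the derivative of `cos (s r)`. Alternating with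
`integral_cos_mul`, three derivatives of `h` pay for four powers of `s`. -/
theorem sq_mul_integral_sinc {h h' : ℝ → ℂ} {L : ℝ} (hd : ∀ r, HasDerivAt h (h' r) r)
    (hc : Continuous h') (hL : h L = 0) (s : ℝ) :
    (s : ℂ) ^ 2 * ∫ r in (0 : ℝ)..L, ((r * Real.sinc (s * r) : ℝ) : ℂ) * h r =
      h 0 + ∫ r in (0 : ℝ)..L, ((Real.cos (s * r) : ℝ) : ℂ) * h' r := by
  have h1 := intervalIntegral.integral_mul_deriv_eq_deriv_mul (a := 0) (b := L)
    (fun r _ => hasDerivAt_cos_mul s r) (fun r _ => hd r)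
    ((continuous_const.mul (continuous_mul_sinc s)).intervalIntegrable _ _)
    (hc.intervalIntegrable _ _)
  rw [h1, hL]
  simp only [mul_assoc]
  rw [intervalIntegral.integral_const_mul]
  simp

theorem integral_cos_mul {h h' : ℝ → ℂ} {L : ℝ} (hd : ∀ r, HasDerivAt h (h' r) r)
    (hc : Continuous h') (hL : h L = 0) (s : ℝ) :
    ∫ r in (0 : ℝ)..L, ((Real.cos (s * r) : ℝ) : ℂ) * h r =
      -∫ r in (0 : ℝ)..L, ((r * Real.sinc (s * r) : ℝ) : ℂ) * h' r := by
  have h1 := intervalIntegral.integral_mul_deriv_eq_deriv_mul (a := 0) (b := L)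
    (fun r _ => hasDerivAt_mul_sinc s r) (fun r _ => hd r)
    ((continuous_cos_mul s).intervalIntegrable _ _)
    (hc.intervalIntegrable _ _)
  rw [h1, hL]
  simp

/-- The derivative is computed from the right, so the endpoint `r = L` is included. This removes the
boundary terms at `L` in the integrations by parts. -/
theorem eq_zero_of_hasDerivAt_of_le {h : ℝ → ℂ} {L r : ℝ} {d : ℂ} (hd : HasDerivAt h d r)
    (h0 : ∀ t, L ≤ t → h t = 0) (hr : L ≤ r) : d = 0 := by
  have h1 : HasDerivWithinAt h 0 (Ici r) r :=
    (hasDerivWithinAt_const r (Ici r) (0 : ℂ)).congr (fun t ht => h0 t (hr.trans ht)) (h0 r hr)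
  exact (uniqueDiffOn_Ici r r self_mem_Ici).eq_deriv _ hd.hasDerivWithinAt h1

/-- The continuous functions on `[0, L]`. -/
abbrev CIcc (L : ℝ) : Type := C(Icc (0 : ℝ) L, ℂ)

/-- The integral operator with a bounded kernel, from continuous functions on `[0, L]` to bounded
continuous functions on `ℝ³`. -/
noncomputable def integralBCF {L : ℝ} (hL : 0 ≤ L) {κ : E3 → ℝ → ℂ}
    (hκ : Continuous (Function.uncurry κ)) {M : ℝ} (hM0 : 0 ≤ M)
    (hM : ∀ ξ, ∀ r ∈ Icc 0 L, ‖κ ξ r‖ ≤ M) : CIcc L →L[ℂ] (E3 →ᵇ ℂ) :=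
  -- Composition with `projIcc` extends `φ` by constants, which makes the integrand continuous on
  -- the whole line.
  have hcont : ∀ φ : CIcc L, Continuous fun p : E3 × ℝ => κ p.1 p.2 * φ (projIcc 0 L hL p.2) :=
    fun φ => hκ.mul (φ.continuous.comp (continuous_projIcc.comp continuous_snd))
  have hint : ∀ (φ : CIcc L) ξ, IntegrableOn (fun r => κ ξ r * φ (projIcc 0 L hL r)) (Icc 0 L) :=
    fun φ ξ => ((hcont φ).comp (Continuous.prodMk_right ξ)).integrableOn_Icc
  have hbound : ∀ (φ : CIcc L) ξ,
      ‖∫ r in Icc 0 L, κ ξ r * φ (projIcc 0 L hL r)‖ ≤ M * L * ‖φ‖ := by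
    intro φ ξ
    have h1 := norm_setIntegral_le_of_norm_le_const (μ := (volume : Measure ℝ)) (s := Icc 0 L)
      (f := fun r => κ ξ r * φ (projIcc 0 L hL r)) (C := M * ‖φ‖) (by simp) fun r hr => by
        rw [norm_mul]
        exact mul_le_mul (hM ξ r hr) (φ.norm_coe_le_norm _) (norm_nonneg _) hM0
    refine h1.trans (le_of_eq ?_)
    rw [Measure.real, Real.volume_Icc, sub_zero, ENNReal.toReal_ofReal hL]
    ring
  LinearMap.mkContinuous
    { toFun := fun φ => BoundedContinuousFunction.ofNormedAddCommGroup
        (fun ξ => ∫ r in Icc 0 L, κ ξ r * φ (projIcc 0 L hL r))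
        (continuous_parametric_integral_of_continuous (hcont φ) isCompact_Icc)
        (M * L * ‖φ‖) (hbound φ)
      map_add' := fun φ ψ => by
        ext ξ
        simp only [BoundedContinuousFunction.coe_ofNormedAddCommGroup, ContinuousMap.add_apply,
          BoundedContinuousFunction.add_apply, mul_add]
        exact integral_add (hint φ ξ) (hint ψ ξ)
      map_smul' := fun c φ => by
        ext ξ
        simp only [BoundedContinuousFunction.coe_ofNormedAddCommGroup, ContinuousMap.smul_apply,
          BoundedContinuousFunction.smul_apply, smul_eq_mul, RingHom.id_apply]
        rw [← integral_const_mul]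
        refine integral_congr_ae (Eventually.of_forall fun r => ?_)
        simp only
        ring }
    (M * L) fun φ => (BoundedContinuousFunction.norm_le (by positivity)).mpr fun ξ => hbound φ ξ

theorem integralBCF_apply {L : ℝ} (hL : 0 ≤ L) {κ : E3 → ℝ → ℂ}
    (hκ : Continuous (Function.uncurry κ)) {M : ℝ} (hM0 : 0 ≤ M)
    (hM : ∀ ξ, ∀ r ∈ Icc 0 L, ‖κ ξ r‖ ≤ M) (φ : CIcc L) {h : ℝ → ℂ}
    (hφ : ∀ r (hr : r ∈ Icc 0 L), φ ⟨r, hr⟩ = h r) (ξ : E3) :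
    integralBCF hL hκ hM0 hM φ ξ = ∫ r in (0 : ℝ)..L, κ ξ r * h r := by
  rw [intervalIntegral.integral_of_le hL, ← integral_Icc_eq_integral_Ioc]
  refine setIntegral_congr_fun measurableSet_Icc fun r hr => ?_
  rw [projIcc_of_mem hL hr, hφ r hr]

/-- The transform `φ ↦ ∫₀^L φ(r) r sinc(2π|ξ|r) dr`. -/
noncomputable def sincTransform {L : ℝ} (hL : 0 ≤ L) : CIcc L →L[ℂ] (E3 →ᵇ ℂ) :=
  integralBCF hL (κ := fun ξ r => ((r * Real.sinc (2 * Real.pi * ‖ξ‖ * r) : ℝ) : ℂ))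
    (by
      have := Real.continuous_sinc
      simp only [Function.uncurry_def]
      fun_prop) hL fun ξ r hr => by
      rw [Complex.norm_real, norm_mul, Real.norm_of_nonneg hr.1]
      exact (mul_le_of_le_one_right hr.1 (Real.abs_sinc_le_one _)).trans hr.2

/-- The transform `φ ↦ ∫₀^L φ(r) cos(2π|ξ|r) dr`. -/
noncomputable def cosTransform {L : ℝ} (hL : 0 ≤ L) : CIcc L →L[ℂ] (E3 →ᵇ ℂ) :=
  integralBCF hL (κ := fun ξ r => ((Real.cos (2 * Real.pi * ‖ξ‖ * r) : ℝ) : ℂ))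
    (by
      simp only [Function.uncurry_def]
      fun_prop) zero_le_one fun ξ r _ => by
      rw [Complex.norm_real]
      exact Real.abs_cos_le_one _

/-- The product of `(1 + |ξ|²)²` with the sine transform of a function, as a function of its
second and third derivatives. -/
noncomputable def weightedTransform {L : ℝ} (hL : 0 ≤ L) :
    CIcc L × CIcc L × CIcc L →L[ℂ] (E3 →ᵇ ℂ) :=
  sincTransform hL ∘L ContinuousLinearMap.fst ℂ _ _ -
    (2 * (2 * Real.pi : ℂ)⁻¹ ^ 2) • (sincTransform hL ∘L
      ContinuousLinearMap.fst ℂ _ _ ∘L ContinuousLinearMap.snd ℂ _ _) -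
    ((2 * Real.pi : ℂ)⁻¹ ^ 4) • (
      (ContinuousLinearMap.toSpanSingleton ℂ (1 : E3 →ᵇ ℂ)) ∘L
        (ContinuousMap.evalCLM ℂ (⟨0, left_mem_Icc.mpr hL⟩ : Icc (0 : ℝ) L)) ∘L
          ContinuousLinearMap.fst ℂ _ _ ∘L ContinuousLinearMap.snd ℂ _ _ +
      cosTransform hL ∘L ContinuousLinearMap.snd ℂ _ _ ∘L ContinuousLinearMap.snd ℂ _ _)

/-- The function `h` is three times continuously differentiable, vanishes at `0` and on `[L, ∞)`,
and `u` is the triple of the restrictions to `[0, L]` of `h`, `h''` and `h'''`. -/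
structure IsProfile (L : ℝ) (h : ℝ → ℂ) (u : CIcc L × CIcc L × CIcc L) : Prop where
  zero : h 0 = 0
  eq_zero : ∀ r, L ≤ r → h r = 0
  exists_deriv : ∃ h1 h2 h3 : ℝ → ℂ, (∀ r, HasDerivAt h (h1 r) r) ∧ (∀ r, HasDerivAt h1 (h2 r) r) ∧
    (∀ r, HasDerivAt h2 (h3 r) r) ∧ Continuous h3 ∧ (∀ r hr, u.1 ⟨r, hr⟩ = h r) ∧
    (∀ r hr, u.2.1 ⟨r, hr⟩ = h2 r) ∧ ∀ r hr, u.2.2 ⟨r, hr⟩ = h3 r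

/-- The kernel `h(|x|) / (4π|x|)`. -/
noncomputable def profileKernel (h : ℝ → ℂ) (x : E3) : ℂ := (4 * Real.pi : ℂ)⁻¹ * dslope h 0 ‖x‖

theorem profileKernel_apply {h : ℝ → ℂ} (h0 : h 0 = 0) {x : E3} (hx : x ≠ 0) :
    profileKernel h x = h ‖x‖ / (4 * Real.pi * ‖x‖) := by
  rw [profileKernel, dslope_of_ne _ (norm_ne_zero_iff.mpr hx), slope_def_module, h0, sub_zero,
    sub_zero, Complex.real_smul]
  push_cast
  rw [div_eq_mul_inv, mul_inv]
  ring

theorem continuous_profileKernel {h : ℝ → ℂ} (hc : Continuous h) (hd : DifferentiableAt ℝ h 0) :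
    Continuous (profileKernel h) := by
  have h1 : Continuous (dslope h 0) := by
    rw [← continuousOn_univ]
    exact (continuousOn_dslope univ_mem).mpr ⟨hc.continuousOn, hd⟩
  exact continuous_const.mul (h1.comp continuous_norm)

theorem continuous_of_hasDerivAt {h h' : ℝ → ℂ} (hd : ∀ r, HasDerivAt h (h' r) r) :
    Continuous h :=
  continuous_iff_continuousAt.mpr fun r => (hd r).continuousAt

theorem IsProfile.continuous {L : ℝ} {h : ℝ → ℂ} {u} (hu : IsProfile L h u) : Continuous h := by
  obtain ⟨h1, h2, h3, d1, -⟩ := hu.exists_deriv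
  exact continuous_of_hasDerivAt d1

theorem IsProfile.decayingKernel {L : ℝ} (hL : 0 ≤ L) {h : ℝ → ℂ} {u} (hu : IsProfile L h u) :
    DecayingKernel (profileKernel h) := by
  obtain ⟨h1, h2, h3, d1, -⟩ := hu.exists_deriv
  have hc := continuous_profileKernel hu.continuous (d1 0).differentiableAt
  refine ⟨hc, ?_⟩
  obtain ⟨C, hC⟩ := (isCompact_closedBall (0 : E3) (L + 1)).exists_bound_of_continuousOn
    hc.continuousOn
  have hC0 : 0 ≤ C := (norm_nonneg _).trans (hC 0 (by simpa using by linarith))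
  refine ⟨C * (1 + (L + 1)) ^ (4 : ℝ), fun x => ?_⟩
  by_cases hx : ‖x‖ ≤ L + 1
  · refine (hC x (by simpa using hx)).trans ?_
    rw [mul_assoc, Real.rpow_neg (by positivity), ← div_eq_mul_inv]
    refine le_mul_of_one_le_right hC0 ((one_le_div (by positivity)).mpr ?_)
    exact Real.rpow_le_rpow (by positivity) (by linarith) (by norm_num)
  · have hx' : L + 1 < ‖x‖ := not_le.mp hx
    have hx0 : x ≠ 0 := by
      rw [← norm_pos_iff]
      linarith
    rw [profileKernel_apply hu.zero hx0, hu.eq_zero _ (by linarith), zero_div, norm_zero]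
    positivity

theorem IsProfile.fourier_profileKernel {L : ℝ} (hL : 0 ≤ L) {h : ℝ → ℂ} {u}
    (hu : IsProfile L h u) (ξ : E3) :
    𝓕 (profileKernel h) ξ =
      ∫ r in (0 : ℝ)..L, ((r * Real.sinc (2 * Real.pi * ‖ξ‖ * r) : ℝ) : ℂ) * h r := by
  have hc := hu.continuous
  have hzero : ∀ F : ℝ → ℂ, ∀ r ∈ Ioi (0 : ℝ) \ Ioc 0 L, F r * h r = 0 := by
    intro F r hr
    rw [hu.eq_zero r, mul_zero]
    by_contra hlt
    exact hr.2 ⟨hr.1, (not_le.mp hlt).le⟩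
  rw [fourier_radial (hu.decayingKernel hL).integrable hc _ fun x hx =>
    profileKernel_apply hu.zero hx]
  · rw [intervalIntegral.integral_of_le hL]
    exact setIntegral_eq_of_subset_of_forall_sdiff_eq_zero measurableSet_Ioi
      Ioc_subset_Ioi_self (hzero _)
  · have h1 : IntegrableOn (fun r : ℝ => (r : ℂ) * h r) (Ioc 0 L) :=
      (Continuous.integrableOn_Icc (by fun_prop)).mono_set Ioc_subset_Icc_self
    exact h1.of_forall_sdiff_eq_zero measurableSet_Ioi (hzero _)

/-- Let `A` be the sine transform of `h` and `s = 2π|ξ|`. Integrating by parts, `s² A = -∫ r sinc (s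
r) h''` and `s⁴ A = -(h''(0) + ∫ cos (s r) h''')`. Expanding `(1 + |ξ|²)²` gives the three terms.
The first derivative of `h` has dropped out, so it is absent from the data. -/
theorem IsProfile.weightedTransform_apply {L : ℝ} (hL : 0 ≤ L) {h : ℝ → ℂ} {u}
    (hu : IsProfile L h u) (ξ : E3) :
    weightedTransform hL u ξ = (1 + (‖ξ‖ : ℂ) ^ 2) ^ 2 * 𝓕 (profileKernel h) ξ := by
  rw [hu.fourier_profileKernel hL]
  obtain ⟨h1, h2, h3, d1, d2, d3, c3, e0, e2, e3⟩ := hu.exists_deriv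
  have z1 : ∀ r, L ≤ r → h1 r = 0 := fun r hr => eq_zero_of_hasDerivAt_of_le (d1 r) hu.eq_zero hr
  have z2 : ∀ r, L ≤ r → h2 r = 0 := fun r hr => eq_zero_of_hasDerivAt_of_le (d2 r) z1 hr
  have c2 := continuous_of_hasDerivAt d3
  have c1 := continuous_of_hasDerivAt d2
  set s : ℝ := 2 * Real.pi * ‖ξ‖
  have i1 := sq_mul_integral_sinc d1 c1 (hu.eq_zero L le_rfl) s
  rw [integral_cos_mul d2 c2 (z1 L le_rfl), hu.zero, zero_add] at i1
  have i2 := sq_mul_integral_sinc d3 c3 (z2 L le_rfl) s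
  have hval : weightedTransform hL u ξ =
      (∫ r in (0 : ℝ)..L, ((r * Real.sinc (s * r) : ℝ) : ℂ) * h r) -
      (2 * (2 * Real.pi : ℂ)⁻¹ ^ 2) *
        (∫ r in (0 : ℝ)..L, ((r * Real.sinc (s * r) : ℝ) : ℂ) * h2 r) -
      ((2 * Real.pi : ℂ)⁻¹ ^ 4) * (h2 0 +
        ∫ r in (0 : ℝ)..L, ((Real.cos (s * r) : ℝ) : ℂ) * h3 r) := by
    have j0 : sincTransform hL u.1 ξ = _ := integralBCF_apply hL _ _ _ u.1 e0 ξ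
    have j2 : sincTransform hL u.2.1 ξ = _ := integralBCF_apply hL _ _ _ u.2.1 e2 ξ
    have j3 : cosTransform hL u.2.2 ξ = _ := integralBCF_apply hL _ _ _ u.2.2 e3 ξ
    have j4 := e2 0 (left_mem_Icc.mpr hL)
    rw [← j0, ← j2, ← j3, ← j4]
    simp [weightedTransform, mul_add]
  rw [hval, ← i2]
  set A := ∫ r in (0 : ℝ)..L, ((r * Real.sinc (s * r) : ℝ) : ℂ) * h r
  have hs : (s : ℂ) = 2 * Real.pi * ‖ξ‖ := by simp [s]
  have hp : (2 * Real.pi : ℂ) ≠ 0 := by simp [Real.pi_ne_zero]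
  have i3 : ∫ r in (0 : ℝ)..L, ((r * Real.sinc (s * r) : ℝ) : ℂ) * h2 r = -((s : ℂ) ^ 2 * A) := by
    rw [i1, neg_neg]
  rw [i3, hs]
  field_simp
  ring

/-- The bounded operator from `L²(ℝ³)` to `H⁴(ℝ³)` given by a weighted transform. -/
noncomputable def profileOp {L : ℝ} (hL : 0 ≤ L) :
    CIcc L × CIcc L × CIcc L →L[ℂ] L2 →L[ℂ] H4 :=
  (ContinuousLinearMap.compL ℂ L2 L2 H4 besselInv) ∘L fm ∘L weightedTransform hL

/-- The Fourier multiplier of a profile. -/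
noncomputable def profileSymbol {L : ℝ} (hL : 0 ≤ L) (u : CIcc L × CIcc L × CIcc L) : E3 →ᵇ ℂ :=
  winv * weightedTransform hL u

theorem toL2L_comp_profileOp {L : ℝ} (hL : 0 ≤ L) (u) :
    toL2L ∘L profileOp hL u = fm (profileSymbol hL u) := by
  ext1 f
  rw [profileSymbol, fm_mul]
  rw [ContinuousLinearMap.comp_apply, toL2L_apply]
  exact toL2_besselInv _

theorem IsProfile.profileSymbol_apply {L : ℝ} (hL : 0 ≤ L) {h : ℝ → ℂ} {u}
    (hu : IsProfile L h u) (ξ : E3) : profileSymbol hL u ξ = 𝓕 (profileKernel h) ξ := by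
  rw [profileSymbol, BoundedContinuousFunction.mul_apply, hu.weightedTransform_apply hL,
    winv_eq, inv_mul_cancel_left₀]
  have : (1 + (‖ξ‖ : ℂ) ^ 2) = ((1 + ‖ξ‖ ^ 2 : ℝ) : ℂ) := by push_cast; rfl
  rw [this]
  exact pow_ne_zero 2 (Complex.ofReal_ne_zero.mpr (by positivity))

theorem IsProfile.toL2_profileOp {L : ℝ} (hL : 0 ≤ L) {h : ℝ → ℂ} {u}
    (hu : IsProfile L h u) (f : L2) :
    (profileOp hL u f).toL2 =ᵐ[volume] fun x => (hu.decayingKernel hL).convAt x f := by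
  have h1 := congrArg (fun T : L2 →L[ℂ] L2 => T f) (toL2L_comp_profileOp hL u)
  have h2 := (hu.decayingKernel hL).fm_eq (hu.profileSymbol_apply hL) f
  rw [← h1, ContinuousLinearMap.comp_apply, toL2L_apply] at h2
  exact h2

end Profile

end BiSchrodinger

namespace BiSchrodinger

/-! ### Cut-off exponential profiles and their holomorphic dependence on the spectral parameter -/

section Wave

open FourierTransform BoundedContinuousFunction

/-- A smooth cutoff on the line, equal to `1` on `[-(n+1), n+1]` and to `0` off `(-(n+2), n+2)`. -/
noncomputable def cutBump (n : ℕ) : ContDiffBump (0 : ℝ) :=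
  ⟨n + 1, n + 2, by positivity, by linarith⟩

/-- The complex-valued cutoff. -/
noncomputable def cut (n : ℕ) (r : ℝ) : ℂ := (cutBump n r : ℂ)

theorem contDiff_cut (n : ℕ) : ContDiff ℝ ∞ (cut n) :=
  Complex.ofRealCLM.contDiff.comp (cutBump n).contDiff

theorem cut_of_le {n : ℕ} {r : ℝ} (hr : |r| ≤ n + 1) : cut n r = 1 := by
  rw [cut, (cutBump n).one_of_mem_closedBall (by simpa [cutBump] using hr), Complex.ofReal_one]

theorem cut_of_ge {n : ℕ} {r : ℝ} (hr : (n : ℝ) + 2 ≤ r) : cut n r = 0 := by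
  rw [cut, (cutBump n).zero_of_le_dist, Complex.ofReal_zero]
  rw [Real.dist_0_eq_abs]
  exact hr.trans (le_abs_self r)

theorem hasDerivAt_iteratedDeriv_cut (n j : ℕ) (r : ℝ) :
    HasDerivAt (iteratedDeriv j (cut n)) (iteratedDeriv (j + 1) (cut n) r) r := by
  rw [iteratedDeriv_succ]
  exact ((contDiff_cut n).differentiable_iteratedDeriv j (by exact_mod_cast ENat.natCast_lt_top j) r).hasDerivAt

theorem continuous_iteratedDeriv_cut (n j : ℕ) : Continuous (iteratedDeriv j (cut n)) :=
  continuous_of_hasDerivAt (hasDerivAt_iteratedDeriv_cut n j)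

/-- The `j`-th derivative of the cutoff on `[0, n + 2]`. -/
noncomputable def cutC (n j : ℕ) : CIcc (n + 2) :=
  ⟨fun r => iteratedDeriv j (cut n) r, (continuous_iteratedDeriv_cut n j).comp continuous_subtype_val⟩

/-- The coordinate function on `[0, n + 2]`. -/
noncomputable def coordC (n : ℕ) : CIcc (n + 2) := ⟨fun r => ((r : ℝ) : ℂ), by fun_prop⟩

/-- The exponential is taken in the Banach algebra of continuous functions, so that it is entire in
`μ` for the sup norm. -/
theorem exp_smul_coordC_apply (n : ℕ) (μ : ℂ) (r : Icc (0 : ℝ) (n + 2)) :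
    NormedSpace.exp (μ • coordC n) r = Complex.exp (μ * (r : ℝ)) := by
  have h := NormedSpace.map_exp (ContinuousMap.evalAlgHom ℂ ℂ r : CIcc (n + 2) →ₐ[ℂ] ℂ)
    (continuous_eval_const r) (μ • coordC n)
  rw [← Complex.exp_eq_exp_ℂ] at h
  exact h

/-- The data of the function `cut n r * exp (μ r)`. -/
noncomputable def expData (n : ℕ) (μ : ℂ) : CIcc (n + 2) × CIcc (n + 2) × CIcc (n + 2) :=
  (cutC n 0 * NormedSpace.exp (μ • coordC n),
    (cutC n 2 + (2 * μ) • cutC n 1 + μ ^ 2 • cutC n 0) * NormedSpace.exp (μ • coordC n),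
    (cutC n 3 + (3 * μ) • cutC n 2 + (3 * μ ^ 2) • cutC n 1 + μ ^ 3 • cutC n 0) *
      NormedSpace.exp (μ • coordC n))

/-- The data of the function `cut n r * r`. -/
noncomputable def linData (n : ℕ) : CIcc (n + 2) × CIcc (n + 2) × CIcc (n + 2) :=
  (cutC n 0 * coordC n, (2 : ℂ) • cutC n 1 + cutC n 2 * coordC n,
    (3 : ℂ) • cutC n 2 + cutC n 3 * coordC n)

theorem differentiable_expData (n : ℕ) : Differentiable ℂ (expData n) := by
  have hE : Differentiable ℂ fun μ : ℂ => NormedSpace.exp (μ • coordC n) := fun μ =>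
    (hasDerivAt_exp_smul_const (coordC n) μ).differentiableAt
  refine Differentiable.prodMk (by fun_prop) (Differentiable.prodMk ?_ ?_) <;> fun_prop

/-- The `μ`-derivative of `exp (μ r)` at `0` is `r`. The profile `r` gives a constant kernel, the
source of the rank one residue at `k = 0`. -/
theorem hasDerivAt_expData_zero (n : ℕ) : HasDerivAt (expData n) (linData n) 0 := by
  have hE : HasDerivAt (fun μ : ℂ => NormedSpace.exp (μ • coordC n)) (coordC n) 0 := by
    have h := hasDerivAt_exp_smul_const (coordC n) (0 : ℂ)
    rwa [zero_smul ℂ (coordC n), NormedSpace.exp_zero, one_mul] at h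
  have hid := hasDerivAt_id' (0 : ℂ)
  have h1 := hE.const_mul (cutC n 0)
  have h2 := ((((hid.const_mul 2).smul_const (cutC n 1)).const_add (cutC n 2)).add
    ((hid.pow 2).smul_const (cutC n 0))).mul hE
  have h3 := (((((hid.const_mul 3).smul_const (cutC n 2)).const_add (cutC n 3)).add
    (((hid.pow 2).const_mul 3).smul_const (cutC n 1))).add
      ((hid.pow 3).smul_const (cutC n 0))).mul hE
  refine (h1.prodMk (h2.prodMk h3)).congr_deriv ?_
  simp only [zero_smul ℂ (coordC n), NormedSpace.exp_zero, Pi.add_apply, Pi.pow_apply]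
  have hz : ∀ f : CIcc (n + 2), (0 : ℂ) • f = 0 := fun f => zero_smul ℂ f
  simp [linData, hz]

/-- The data of the function `cut n r * (exp (i k r) - exp (- k r)) / 2`. -/
noncomputable def waveData (n : ℕ) (k : ℂ) : CIcc (n + 2) × CIcc (n + 2) × CIcc (n + 2) :=
  (2 : ℂ)⁻¹ • (expData n (Complex.I * k) - expData n (-k))

theorem waveData_zero (n : ℕ) : waveData n 0 = 0 := by
  simp [waveData]

theorem differentiable_waveData (n : ℕ) : Differentiable ℂ (waveData n) := by
  have h1 := (differentiable_expData n).comp (differentiable_id.const_mul Complex.I)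
  have h2 := (differentiable_expData n).comp differentiable_id.neg
  exact (h1.sub h2).const_smul (2 : ℂ)⁻¹

theorem hasDerivAt_waveData_zero (n : ℕ) :
    HasDerivAt (waveData n) ((2 : ℂ)⁻¹ • (Complex.I • linData n - (-1 : ℂ) • linData n)) 0 := by
  have hid := hasDerivAt_id' (0 : ℂ)
  have h1 := HasDerivAt.scomp (𝕜 := ℂ) (g₁ := expData n) (g₁' := linData n) (0 : ℂ)
    (by simpa using hasDerivAt_expData_zero n) (hid.const_mul Complex.I)
  have h2 := HasDerivAt.scomp (𝕜 := ℂ) (g₁ := expData n) (g₁' := linData n) (0 : ℂ)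
    (by simpa using hasDerivAt_expData_zero n) hid.neg
  have h3 := (h1.sub h2).const_smul (2 : ℂ)⁻¹
  rw [mul_one] at h3
  exact h3

/-- The function `(exp (i k r) - exp (- k r)) / 2`. -/
noncomputable def wave (k : ℂ) (r : ℝ) : ℂ :=
  (Complex.exp (Complex.I * k * r) - Complex.exp (-k * r)) / 2

theorem hasDerivAt_cexp_mul (μ : ℂ) (r : ℝ) :
    HasDerivAt (fun r : ℝ => Complex.exp (μ * r)) (μ * Complex.exp (μ * r)) r := by
  have h1 : HasDerivAt (fun r : ℝ => μ * (r : ℂ)) μ r := by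
    simpa using (Complex.ofRealCLM.hasDerivAt (x := r)).const_mul μ
  simpa [mul_comm] using h1.cexp

theorem isProfile_wave (n : ℕ) (k : ℂ) :
    IsProfile (n + 2) (fun r => cut n r * wave k r) (waveData n k) := by
  set a : ℕ → ℝ → ℂ := fun j => iteratedDeriv j (cut n) with ha
  have ha0 : cut n = a 0 := by simp [ha]
  have da : ∀ j r, HasDerivAt (a j) (a (j + 1) r) r := hasDerivAt_iteratedDeriv_cut n
  have de := hasDerivAt_cexp_mul
  -- By the Leibniz rule, `p1`, `p2` and `p3` are the first three derivatives of `cut n r * exp (μ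
  -- r)`.
  set p1 : ℂ → ℝ → ℂ := fun μ r => (a 1 r + μ * a 0 r) * Complex.exp (μ * r) with hp1
  set p2 : ℂ → ℝ → ℂ := fun μ r =>
    (a 2 r + 2 * μ * a 1 r + μ ^ 2 * a 0 r) * Complex.exp (μ * r) with hp2
  set p3 : ℂ → ℝ → ℂ := fun μ r =>
    (a 3 r + 3 * μ * a 2 r + 3 * μ ^ 2 * a 1 r + μ ^ 3 * a 0 r) * Complex.exp (μ * r) with hp3
  have d0 : ∀ μ r, HasDerivAt (fun r : ℝ => a 0 r * Complex.exp (μ * r)) (p1 μ r) r := by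
    intro μ r
    refine ((da 0 r).mul (de μ r)).congr_deriv ?_
    simp only [hp1]
    ring
  have d1 : ∀ μ r, HasDerivAt (p1 μ) (p2 μ r) r := by
    intro μ r
    refine (((da 1 r).add ((da 0 r).const_mul μ)).mul (de μ r)).congr_deriv ?_
    simp only [hp2, Pi.add_apply]
    ring
  have d2 : ∀ μ r, HasDerivAt (p2 μ) (p3 μ r) r := by
    intro μ r
    refine ((((da 2 r).add ((da 1 r).const_mul (2 * μ))).add
      ((da 0 r).const_mul (μ ^ 2))).mul (de μ r)).congr_deriv ?_
    simp only [hp3, Pi.add_apply]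
    ring
  refine ⟨by simp [wave], fun r hr => by simp [cut_of_ge hr],
    fun r => (p1 (Complex.I * k) r - p1 (-k) r) / 2, fun r => (p2 (Complex.I * k) r - p2 (-k) r) / 2,
    fun r => (p3 (Complex.I * k) r - p3 (-k) r) / 2, fun r => ?_,
    fun r => ((d1 _ r).sub (d1 _ r)).div_const 2, fun r => ((d2 _ r).sub (d2 _ r)).div_const 2,
    ?_, fun r hr => ?_, fun r hr => ?_, fun r hr => ?_⟩
  · refine (((d0 (Complex.I * k) r).sub (d0 (-k) r)).div_const 2).congr_of_eventuallyEq
      (Eventually.of_forall fun t => ?_)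
    simp only [wave, ha0, Pi.sub_apply]
    ring
  · have hc : ∀ j, Continuous (a j) := continuous_iteratedDeriv_cut n
    fun_prop
  · simp [waveData, expData, exp_smul_coordC_apply, cutC, wave]
    ring
  · simp [waveData, expData, exp_smul_coordC_apply, cutC, hp2, ha]
    ring
  · simp [waveData, expData, exp_smul_coordC_apply, cutC, hp3, ha]
    ring

theorem isProfile_lin (n : ℕ) : IsProfile (n + 2) (fun r => cut n r * r) (linData n) := by
  set a : ℕ → ℝ → ℂ := fun j => iteratedDeriv j (cut n) with ha
  have ha0 : cut n = a 0 := by simp [ha]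
  have da : ∀ j r, HasDerivAt (a j) (a (j + 1) r) r := hasDerivAt_iteratedDeriv_cut n
  have di : ∀ r : ℝ, HasDerivAt (fun r : ℝ => (r : ℂ)) 1 r := fun r =>
    Complex.ofRealCLM.hasDerivAt (x := r)
  refine ⟨by simp, fun r hr => by simp [cut_of_ge hr],
    fun r => a 1 r * r + a 0 r, fun r => a 2 r * r + 2 * a 1 r, fun r => a 3 r * r + 3 * a 2 r,
    fun r => ?_, fun r => ?_, fun r => ?_, ?_, fun r hr => ?_, fun r hr => ?_, fun r hr => ?_⟩
  · rw [ha0]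
    exact ((da 0 r).mul (di r)).congr_deriv (by ring)
  · exact (((da 1 r).mul (di r)).add (da 0 r)).congr_deriv (by ring)
  · exact (((da 2 r).mul (di r)).add ((da 1 r).const_mul 2)).congr_deriv (by ring)
  · have hc : ∀ j, Continuous (a j) := continuous_iteratedDeriv_cut n
    fun_prop
  · simp [linData, cutC, coordC]
  · simp [linData, cutC, coordC, ha]
    ring
  · simp [linData, cutC, coordC, ha]
    ring

/-- At `x = 0` the kernel is a derivative, so the cutoff must equal `1` near `0`. The plateau radius
`n + 1` ensures this even for `n = 0`. -/
theorem profileKernel_congr {n : ℕ} {h : ℝ → ℂ} {x : E3} (hx : ‖x‖ ≤ n) :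
    profileKernel (fun r => cut n r * h r) x = profileKernel h x := by
  rw [profileKernel, profileKernel]
  congr 1
  have h1 : ∀ r : ℝ, |r| ≤ n + 1 → cut n r * h r = h r := fun r hr => by rw [cut_of_le hr, one_mul]
  have h0 : |(0 : ℝ)| ≤ n + 1 := by
    rw [abs_zero]
    positivity
  rcases eq_or_ne ‖x‖ 0 with h2 | h2
  · rw [h2, dslope_same, dslope_same]
    refine EventuallyEq.deriv_eq ?_
    filter_upwards [Metric.closedBall_mem_nhds (0 : ℝ) (by positivity : (0 : ℝ) < n + 1)] with r hr
    exact h1 r (by simpa using hr)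
  · rw [dslope_of_ne _ h2, dslope_of_ne _ h2, slope_def_module, slope_def_module, h1 0 h0,
      h1 ‖x‖ (by rw [abs_of_nonneg (norm_nonneg x)]; linarith)]

theorem profileKernel_id (x : E3) : profileKernel (fun r => (r : ℂ)) x = (4 * Real.pi : ℂ)⁻¹ := by
  rw [profileKernel]
  convert mul_one _
  rcases eq_or_ne ‖x‖ 0 with h2 | h2
  · rw [h2, dslope_same]
    exact (Complex.ofRealCLM.hasDerivAt (x := 0)).deriv
  · rw [dslope_of_ne _ h2, slope_def_module]
    simp [h2, Complex.real_smul]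

end Wave

end BiSchrodinger

namespace BiSchrodinger

/-! ### The kernel of the free resolvent in the first quadrant -/

section FreeKernel

open FourierTransform BoundedContinuousFunction

theorem integrableOn_mul_exp {b : ℝ} (hb : 0 < b) :
    IntegrableOn (fun r : ℝ => r * Real.exp (-b * r)) (Ioi 0) := by
  simpa using integrableOn_rpow_mul_exp_neg_mul_rpow (p := 1) (s := 1) (by norm_num) one_pos hb

theorem norm_cexp_mul_ofReal (μ : ℂ) (r : ℝ) : ‖Complex.exp (μ * r)‖ = Real.exp (-(-μ.re) * r) := by
  rw [Complex.norm_exp]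
  simp

theorem integrableOn_mul_cexp {μ : ℂ} (hμ : μ.re < 0) :
    IntegrableOn (fun r : ℝ => (r : ℂ) * Complex.exp (μ * r)) (Ioi 0) := by
  refine (integrableOn_mul_exp (neg_pos.mpr hμ)).mono' (by fun_prop) ?_
  filter_upwards [ae_restrict_mem measurableSet_Ioi] with r hr
  have hr : 0 < r := hr
  rw [norm_mul, norm_cexp_mul_ofReal, Complex.norm_real, Real.norm_of_nonneg hr.le]

theorem norm_mul_sinc_le (s : ℝ) {r : ℝ} (hr : 0 ≤ r) :
    ‖((r * Real.sinc (s * r) : ℝ) : ℂ)‖ ≤ r := by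
  rw [Complex.norm_real, norm_mul, Real.norm_of_nonneg hr]
  exact mul_le_of_le_one_right hr (Real.abs_sinc_le_one _)

theorem integrableOn_sinc_mul {h : ℝ → ℂ} (s : ℝ)
    (hh : IntegrableOn (fun r : ℝ => (r : ℂ) * h r) (Ioi 0)) (hc : Continuous h) :
    IntegrableOn (fun r : ℝ => ((r * Real.sinc (s * r) : ℝ) : ℂ) * h r) (Ioi 0) := by
  refine hh.norm.mono' ((continuous_mul_sinc s).mul hc).aestronglyMeasurable ?_
  filter_upwards [ae_restrict_mem measurableSet_Ioi] with r hr
  have hr : 0 < r := hr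
  rw [norm_mul, norm_mul, Complex.norm_real r, Real.norm_of_nonneg hr.le]
  exact mul_le_mul_of_nonneg_right (norm_mul_sinc_le s hr.le) (norm_nonneg _)

theorem sq_add_sq_ne_zero {μ : ℂ} (hμ : μ.re < 0) (s : ℝ) : μ ^ 2 + (s : ℂ) ^ 2 ≠ 0 := by
  intro h
  have h1 : (μ + Complex.I * s) * (μ - Complex.I * s) = 0 := by
    rw [← h]
    ring_nf
    rw [Complex.I_sq]
    ring
  rcases mul_eq_zero.mp h1 with h2 | h2 <;>
  · have h3 := congrArg Complex.re h2
    simp at h3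
    linarith

theorem integral_sinc_mul_cexp {μ : ℂ} (hμ : μ.re < 0) (s : ℝ) :
    ∫ r in Ioi (0 : ℝ), ((r * Real.sinc (s * r) : ℝ) : ℂ) * Complex.exp (μ * r) =
      (μ ^ 2 + (s : ℂ) ^ 2)⁻¹ := by
  have hne := sq_add_sq_ne_zero hμ s
  -- An explicit primitive. It tends to `0` at infinity because `Re μ < 0`, and at `r = 0` its value
  -- is `-(μ² + s²)⁻¹`.
  have hd : ∀ r ∈ Ici (0 : ℝ), HasDerivAt (fun r : ℝ => Complex.exp (μ * r) *
      (μ * ((r * Real.sinc (s * r) : ℝ) : ℂ) - ((Real.cos (s * r) : ℝ) : ℂ)) * (μ ^ 2 + (s : ℂ) ^ 2)⁻¹)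
      (((r * Real.sinc (s * r) : ℝ) : ℂ) * Complex.exp (μ * r)) r := by
    intro r _
    refine (((hasDerivAt_cexp_mul μ r).mul (((hasDerivAt_mul_sinc s r).const_mul μ).sub
      (hasDerivAt_cos_mul s r))).mul_const _).congr_deriv ?_
    rw [mul_inv_eq_iff_eq_mul₀ hne]
    simp only [Pi.sub_apply]
    ring
  have ht : Tendsto (fun r : ℝ => Complex.exp (μ * r) *
      (μ * ((r * Real.sinc (s * r) : ℝ) : ℂ) - ((Real.cos (s * r) : ℝ) : ℂ)) * (μ ^ 2 + (s : ℂ) ^ 2)⁻¹)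
      atTop (𝓝 0) := by
    have hb := neg_pos.mpr hμ
    have t1 := tendsto_rpow_mul_exp_neg_mul_atTop_nhds_zero 1 _ hb
    have t0 := tendsto_rpow_mul_exp_neg_mul_atTop_nhds_zero 0 _ hb
    simp only [Real.rpow_one, Real.rpow_zero, one_mul] at t1 t0
    have t2 := ((t1.const_mul ‖μ‖).add t0).mul_const ‖(μ ^ 2 + (s : ℂ) ^ 2)⁻¹‖
    simp only [mul_zero, add_zero, zero_mul] at t2
    refine squeeze_zero_norm' ?_ t2
    filter_upwards [eventually_ge_atTop 0] with r hr
    rw [norm_mul, norm_mul, norm_cexp_mul_ofReal]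
    refine mul_le_mul_of_nonneg_right ?_ (norm_nonneg _)
    have h1 : ‖μ * ((r * Real.sinc (s * r) : ℝ) : ℂ) - ((Real.cos (s * r) : ℝ) : ℂ)‖ ≤
        ‖μ‖ * r + 1 := by
      refine (norm_sub_le _ _).trans (add_le_add ?_ ?_)
      · rw [norm_mul]
        exact mul_le_mul_of_nonneg_left (norm_mul_sinc_le s hr) (norm_nonneg _)
      · rw [Complex.norm_real]
        exact Real.abs_cos_le_one _
    refine (mul_le_mul_of_nonneg_left h1 (Real.exp_nonneg _)).trans (le_of_eq ?_)
    ring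
  rw [integral_Ioi_of_hasDerivAt_of_tendsto' hd
    (integrableOn_sinc_mul s (integrableOn_mul_cexp hμ) (by fun_prop)) ht]
  simp

theorem norm_cexp_sub_cexp_le {c : ℝ} {z w : ℂ} (hz : z.re ≤ c) (hw : w.re ≤ c) :
    ‖Complex.exp z - Complex.exp w‖ ≤ Real.exp c * ‖z - w‖ :=
  (convex_halfSpace_re_le c).norm_image_sub_le_of_norm_deriv_le
    (fun x _ => Complex.differentiable_exp x) (fun x hx => by
      rw [Complex.deriv_exp, Complex.norm_exp]
      exact Real.exp_le_exp.mpr hx) hw hz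

/-- Both exponents lie in the half-plane `Re ≤ -m r`, where the mean value inequality applies. The
factor `r` cancels the singularity `1/|x|`, and the factor `|k|` cancels one of the two powers in
`k⁻²`. -/
theorem norm_wave_le {k : ℂ} {m r : ℝ} (hre : m ≤ k.re) (him : m ≤ k.im) (hr : 0 ≤ r) :
    ‖wave k r‖ ≤ ‖k‖ * Real.exp (-(m * r)) * r := by
  have h1 : ‖Complex.exp (Complex.I * k * r) - Complex.exp (-k * r)‖ ≤
      Real.exp (-(m * r)) * ‖Complex.I * k * r - -k * r‖ := by
    refine norm_cexp_sub_cexp_le ?_ ?_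
    · simpa using mul_le_mul_of_nonneg_right him hr
    · simpa using mul_le_mul_of_nonneg_right hre hr
  have h2 : ‖Complex.I * k * r - -k * r‖ ≤ 2 * (‖k‖ * r) := by
    have h3 : ‖(r : ℂ)‖ = r := by rw [Complex.norm_real, Real.norm_of_nonneg hr]
    refine (norm_sub_le _ _).trans (le_of_eq ?_)
    rw [norm_mul, norm_mul, norm_mul, norm_neg, Complex.norm_I, h3]
    ring
  rw [wave, norm_div, RCLike.norm_ofNat, div_le_iff₀ two_pos]
  refine h1.trans ((mul_le_mul_of_nonneg_left h2 (Real.exp_nonneg _)).trans (le_of_eq ?_))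
  ring

theorem hasDerivAt_wave (k : ℂ) (r : ℝ) : HasDerivAt (wave k)
    ((Complex.I * k * Complex.exp (Complex.I * k * r) - -k * Complex.exp (-k * r)) / 2) r :=
  ((hasDerivAt_cexp_mul (Complex.I * k) r).sub (hasDerivAt_cexp_mul (-k) r)).div_const 2

theorem wave_zero (k : ℂ) : wave k 0 = 0 := by simp [wave]

theorem norm_profileKernel_wave_le {k : ℂ} {m : ℝ} (hre : m ≤ k.re) (him : m ≤ k.im) (x : E3) :
    ‖profileKernel (wave k) x‖ ≤ ‖k‖ * Real.exp (-(m * ‖x‖)) := by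
  have h4 : ‖(4 * Real.pi : ℂ)⁻¹‖ ≤ 1 := by
    rw [norm_inv, norm_mul, RCLike.norm_ofNat, Complex.norm_real,
      Real.norm_of_nonneg Real.pi_pos.le]
    refine inv_le_one_of_one_le₀ ?_
    linarith [Real.pi_gt_three]
  have h5 : ‖dslope (wave k) 0 ‖x‖‖ ≤ ‖k‖ * Real.exp (-(m * ‖x‖)) := by
    rcases eq_or_ne ‖x‖ 0 with h2 | h2
    · rw [h2, dslope_same, (hasDerivAt_wave k 0).deriv]
      have h3 : (Complex.I * k * Complex.exp (Complex.I * k * (0 : ℝ)) -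
          -k * Complex.exp (-k * (0 : ℝ))) / 2 = (Complex.I + 1) / 2 * k := by
        simp
        ring
      rw [h3, norm_mul, mul_comm]
      simp only [mul_zero, neg_zero, Real.exp_zero]
      refine mul_le_mul_of_nonneg_left ?_ (norm_nonneg _)
      rw [norm_div, RCLike.norm_ofNat, div_le_one two_pos]
      refine (norm_add_le _ _).trans (le_of_eq ?_)
      rw [Complex.norm_I, norm_one]
      norm_num
    · rw [dslope_of_ne _ h2, slope_def_module, wave_zero, sub_zero, sub_zero, norm_smul, norm_inv,
        norm_norm, inv_mul_le_iff₀ (by positivity), mul_comm ‖x‖]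
      exact norm_wave_le hre him (norm_nonneg x)
  rw [profileKernel, norm_mul]
  exact (mul_le_of_le_one_left (norm_nonneg _) h4).trans h5

/-- The kernel `(exp (i k |x|) - exp (- k |x|)) / (8 π k² |x|)` of the free resolvent. -/
noncomputable def freeKernel (k : ℂ) (x : E3) : ℂ := (k ^ 2)⁻¹ * profileKernel (wave k) x

/-- This is the case `m = 0`, uniform up to the boundary of the quadrant. It makes `1 + K(k)`
invertible for large `|k|`. -/
theorem norm_freeKernel_le {k : ℂ} (hk : k ∈ firstQuadrant) (x : E3) :
    ‖freeKernel k x‖ ≤ ‖k‖⁻¹ := by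
  have h0 : 0 < ‖k‖ := norm_pos_iff.mpr fun h => by simpa [h] using hk.1
  have h1 := norm_profileKernel_wave_le hk.1.le hk.2.le x
  simp only [zero_mul, neg_zero, Real.exp_zero, mul_one] at h1
  rw [freeKernel, norm_mul, norm_inv, norm_pow]
  refine (mul_le_mul_of_nonneg_left h1 (by positivity)).trans (le_of_eq ?_)
  field_simp

/-- The constant comes from `(m (1 + t))⁴ / 4! ≤ exp (m (1 + t))`. -/
theorem exp_neg_mul_le {m t : ℝ} (hm : 0 < m) (ht : 0 ≤ t) :
    Real.exp (-(m * t)) ≤ 24 * Real.exp m / m ^ 4 * (1 + t) ^ (-4 : ℝ) := by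
  have h1 := Real.pow_div_factorial_le_exp (m * (1 + t)) (by positivity) 4
  have h2 : (1 + t) ^ (-4 : ℝ) = ((1 + t) ^ 4)⁻¹ := by
    rw [Real.rpow_neg (by positivity)]
    norm_cast
  have h3 : Real.exp (m * (1 + t)) = Real.exp m * Real.exp (m * t) := by
    rw [← Real.exp_add]
    ring_nf
  rw [h3, mul_pow] at h1
  have h4 : ((Nat.factorial 4 : ℕ) : ℝ) = 24 := by norm_num [Nat.factorial]
  rw [h4, div_le_iff₀ (by norm_num)] at h1
  rw [h2, Real.exp_neg, ← div_eq_mul_inv, div_div, inv_le_iff_one_le_mul₀ (Real.exp_pos _),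
    div_mul_eq_mul_div, one_le_div (by positivity)]
  linarith

theorem decayingKernel_freeKernel {k : ℂ} (hk : k ∈ firstQuadrant) :
    DecayingKernel (freeKernel k) := by
  have hc : Continuous (wave k) := continuous_of_hasDerivAt (hasDerivAt_wave k)
  refine ⟨continuous_const.mul
    (continuous_profileKernel hc (hasDerivAt_wave k 0).differentiableAt), ?_⟩
  have hm : 0 < min k.re k.im := lt_min hk.1 hk.2
  refine ⟨‖(k ^ 2)⁻¹‖ * (‖k‖ * (24 * Real.exp (min k.re k.im) / (min k.re k.im) ^ 4)),
    fun x => ?_⟩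
  rw [freeKernel, norm_mul, mul_assoc, mul_assoc]
  refine mul_le_mul_of_nonneg_left ?_ (norm_nonneg _)
  exact (norm_profileKernel_wave_le (min_le_left _ _) (min_le_right _ _) x).trans
    (mul_le_mul_of_nonneg_left (exp_neg_mul_le hm (norm_nonneg x)) (norm_nonneg _))

/-- Since `k²` has positive imaginary part, it cannot be one of the real numbers `±√t`. -/
theorem pow_four_ne_of_mem_firstQuadrant {k : ℂ} (hk : k ∈ firstQuadrant) (t : ℝ) (ht : 0 ≤ t) :
    (t : ℂ) ≠ k ^ 4 := by
  intro h
  have h1 : (k ^ 2 - (√t : ℝ)) * (k ^ 2 + (√t : ℝ)) = 0 := by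
    have h2 : ((√t : ℝ) : ℂ) ^ 2 = t := by
      rw [← Complex.ofReal_pow, Real.sq_sqrt ht]
    linear_combination -h - h2
  have h3 : 0 < (k ^ 2).im := by
    have := mul_pos hk.1 hk.2
    rw [sq, Complex.mul_im]
    linarith
  rcases mul_eq_zero.mp h1 with h2 | h2 <;>
  · have h4 := congrArg Complex.im h2
    simp only [Complex.sub_im, Complex.add_im, Complex.ofReal_im, Complex.zero_im] at h4
    linarith

theorem fourier_freeKernel {k : ℂ} (hk : k ∈ firstQuadrant) (ξ : E3) :
    𝓕 (freeKernel k) ξ = ((((2 * Real.pi * ‖ξ‖) ^ 4 : ℝ) : ℂ) - k ^ 4)⁻¹ := by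
  have hc : Continuous (wave k) := continuous_of_hasDerivAt (hasDerivAt_wave k)
  have r1 : (Complex.I * k).re < 0 := by simpa using hk.2
  have r2 : (-k).re < 0 := by simpa using hk.1
  have i1 := integrableOn_mul_cexp r1
  have i2 := integrableOn_mul_cexp r2
  have hi : IntegrableOn (fun r : ℝ => (r : ℂ) * ((k ^ 2)⁻¹ * wave k r)) (Ioi 0) := by
    refine ((i1.sub i2).const_mul ((k ^ 2)⁻¹ / 2)).congr (Eventually.of_forall fun r => ?_)
    simp only [wave, Pi.sub_apply]
    ring
  have hk0 : k ≠ 0 := fun h => by simpa [h] using hk.1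
  rw [fourier_radial (h := fun r => (k ^ 2)⁻¹ * wave k r)
    (decayingKernel_freeKernel hk).integrable (continuous_const.mul hc) hi
    fun x hx => by rw [freeKernel, profileKernel_apply (wave_zero k) hx, mul_div_assoc]]
  set s : ℝ := 2 * Real.pi * ‖ξ‖
  have e : ∀ r : ℝ, ((r * Real.sinc (s * r) : ℝ) : ℂ) * ((k ^ 2)⁻¹ * wave k r) =
      ((k ^ 2)⁻¹ / 2) * (((r * Real.sinc (s * r) : ℝ) : ℂ) * Complex.exp (Complex.I * k * r) -
        ((r * Real.sinc (s * r) : ℝ) : ℂ) * Complex.exp (-k * r)) := by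
    intro r
    rw [wave]
    ring
  simp only [e]
  rw [integral_const_mul, integral_sub (integrableOn_sinc_mul s i1 (by fun_prop))
    (integrableOn_sinc_mul s i2 (by fun_prop)), integral_sinc_mul_cexp r1, integral_sinc_mul_cexp r2]
  have n1 := sq_add_sq_ne_zero r1 s
  have n2 := sq_add_sq_ne_zero r2 s
  -- Partial fractions: `1/(s² - k²) - 1/(s² + k²) = 2k²/(s⁴ - k⁴)`.
  have n3 : ((s ^ 4 : ℝ) : ℂ) - k ^ 4 = ((Complex.I * k) ^ 2 + (s : ℂ) ^ 2) * ((-k) ^ 2 + (s : ℂ) ^ 2) := by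
    rw [mul_pow Complex.I, Complex.I_sq]
    push_cast
    ring
  have n4 : ((-k) ^ 2 + (s : ℂ) ^ 2) - ((Complex.I * k) ^ 2 + (s : ℂ) ^ 2) = 2 * k ^ 2 := by
    rw [mul_pow Complex.I, Complex.I_sq]
    ring
  rw [n3, inv_sub_inv n1 n2, n4]
  set A := (Complex.I * k) ^ 2 + (s : ℂ) ^ 2
  set B := (-k) ^ 2 + (s : ℂ) ^ 2
  field_simp

theorem freeResL2_ae_eq {k : ℂ} (hk : k ∈ firstQuadrant) (f : L2) :
    freeResL2 (k ^ 4) f =ᵐ[volume] fun x => (decayingKernel_freeKernel hk).convAt x f := by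
  rw [freeResL2_eq_fm]
  refine (decayingKernel_freeKernel hk).fm_eq (fun ξ => ?_) f
  rw [fourier_freeKernel hk, resolventSymbol_apply (pow_four_ne_of_mem_firstQuadrant hk)]

end FreeKernel

end BiSchrodinger

namespace BiSchrodinger

/-! ### The continuation of the free resolvent -/

section WaveOp

theorem natCast_add_two_nonneg (n : ℕ) : (0 : ℝ) ≤ n + 2 := by positivity

/-- The convolution with the kernel of the free resolvent, cut off outside a large ball. -/
noncomputable def waveOp (n : ℕ) (k : ℂ) : L2 →L[ℂ] H4 :=
  (k ^ 2)⁻¹ • profileOp (natCast_add_two_nonneg n) (waveData n k)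

theorem analyticAt_profileOp_waveData (n : ℕ) (k : ℂ) :
    AnalyticAt ℂ (fun k => profileOp (natCast_add_two_nonneg n) (waveData n k)) k :=
  AnalyticAt.clmApply _ ((differentiable_waveData n).analyticAt k)

theorem analyticAt_waveOp (n : ℕ) {k : ℂ} (hk : k ≠ 0) : AnalyticAt ℂ (waveOp n) k :=
  AnalyticAt.fun_smul ((analyticAt_id.pow 2).inv (pow_ne_zero 2 hk))
    (analyticAt_profileOp_waveData n k)

/-- For `|x| ≤ a` and `|y| ≤ b` one has `|x - y| ≤ n`, where the radial cutoff equals `1`. -/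
theorem waveOp_ae_eq {a b n : ℕ} (h : a + b ≤ n) (k : ℂ) {f : L2} (hf : BallSupp b f) :
    ∀ᵐ x ∂(volume : Measure E3), ‖x‖ ≤ a →
      (waveOp n k f).toL2 x = ∫ y, freeKernel k (x - y) * f y := by
  have h1 := (isProfile_wave n k).toL2_profileOp (natCast_add_two_nonneg n) f
  have h2 : (waveOp n k f).toL2 =
      (k ^ 2)⁻¹ • (profileOp (natCast_add_two_nonneg n) (waveData n k) f).toL2 := by
    rw [waveOp, smul_apply, map_smul]
  rw [h2]
  filter_upwards [h1, Lp.coeFn_smul (k ^ 2)⁻¹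
    (profileOp (natCast_add_two_nonneg n) (waveData n k) f).toL2] with x e1 e2 hx
  rw [e2, Pi.smul_apply, e1, DecayingKernel.convAt_apply,
    integral_kernel_congr (k' := profileKernel (wave k)) _ hf hx, smul_eq_mul, ← integral_const_mul]
  · simp only [freeKernel, mul_assoc]
  · intro x hx
    exact profileKernel_congr (hx.trans (by exact_mod_cast h))

theorem profileOp_linData_ae_eq {a b n : ℕ} (h : a + b ≤ n) {f : L2} (hf : BallSupp b f) :
    ∀ᵐ x ∂(volume : Measure E3), ‖x‖ ≤ a →
      (profileOp (natCast_add_two_nonneg n) (linData n) f).toL2 x =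
        ∫ y, (4 * Real.pi : ℂ)⁻¹ * f y := by
  filter_upwards [(isProfile_lin n).toL2_profileOp (natCast_add_two_nonneg n) f] with x e1 hx
  rw [e1, DecayingKernel.convAt_apply,
    integral_kernel_congr (k' := fun _ => (4 * Real.pi : ℂ)⁻¹) _ hf hx]
  intro x hx
  exact (profileKernel_congr (hx.trans (by exact_mod_cast h))).trans (profileKernel_id x)

theorem mulOp_eq_of_ae {a : ℝ} {W : LInf} (hW : BallSupp a W) {f g : L2}
    (h : ∀ᵐ x ∂(volume : Measure E3), ‖x‖ ≤ a → f x = g x) : mulOp W f = mulOp W g := by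
  apply Lp.ext
  filter_upwards [coeFn_mulOp W f, coeFn_mulOp W g, h,
    show ∀ᵐ x ∂(volume : Measure E3), a < ‖x‖ → W x = 0 from hW] with x h1 h2 h3 h4
  rw [h1, h2]
  rcases le_or_gt ‖x‖ a with h5 | h5
  · rw [h3 h5]
  · rw [h4 h5, zero_mul, zero_mul]

theorem mulOp_profileOp_linData {a b n : ℕ} (h : a + b ≤ n) {W χ : LInf} (hW : BallSupp a W)
    (hχ : BallSupp b χ) (f : L2) :
    mulOp W (profileOp (natCast_add_two_nonneg n) (linData n) (mulOp χ f)).toL2 =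
      (∫ y, (4 * Real.pi : ℂ)⁻¹ * mulOp χ f y) • hW.memLp_two.toLp W := by
  apply Lp.ext
  filter_upwards [coeFn_mulOp W (profileOp (natCast_add_two_nonneg n) (linData n) (mulOp χ f)).toL2,
    profileOp_linData_ae_eq h (hχ.mulOp f), hW.memLp_two.coeFn_toLp,
    Lp.coeFn_smul (∫ y, (4 * Real.pi : ℂ)⁻¹ * mulOp χ f y) (hW.memLp_two.toLp W),
    show ∀ᵐ x ∂(volume : Measure E3), (a : ℝ) < ‖x‖ → W x = 0 from hW] with x h1 h2 h3 h4 h5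
  rw [h1, h4, Pi.smul_apply, h3, smul_eq_mul]
  rcases le_or_gt ‖x‖ a with h6 | h6
  · rw [h2 h6, mul_comm]
  · rw [h5 h6, zero_mul, mul_zero]

/-- The rank can be read off after an injective map. A residue with values in `H⁴` is thus
recognised in `L²`, as a multiple of the cutoff function. -/
theorem mem_finiteRank_of_injective_comp {X Y Z : Type*} [NormedAddCommGroup X] [NormedSpace ℂ X]
    [NormedAddCommGroup Y] [NormedSpace ℂ Y] [NormedAddCommGroup Z] [NormedSpace ℂ Z]
    {T : X →L[ℂ] Y} {J : Y →L[ℂ] Z} (hJ : Function.Injective J) {w : Z} {c : X → ℂ}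
    (h : ∀ x, J (T x) = c x • w) : T ∈ finiteRank X Y := by
  rw [mem_finiteRank]
  let e : LinearMap.range (T : X →ₗ[ℂ] Y) →ₗ[ℂ] Submodule.span ℂ {w} :=
    LinearMap.codRestrict _ ((J : Y →ₗ[ℂ] Z) ∘ₗ Submodule.subtype _) (by
      rintro ⟨_, x, rfl⟩
      exact Submodule.mem_span_singleton.mpr ⟨c x, (h x).symm⟩)
  refine FiniteDimensional.of_injective e fun y y' hy => Subtype.ext (hJ ?_)
  exact congrArg Subtype.val hy

theorem mulOp_comp_linData_mem_finiteRank {a b n : ℕ} (h : a + b ≤ n) {W χ : LInf}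
    (hW : BallSupp a W) (hχ : BallSupp b χ) :
    (mulOp W ∘L toL2L) ∘L profileOp (natCast_add_two_nonneg n) (linData n) ∘L mulOp χ ∈
      finiteRank L2 L2 := by
  refine mem_finiteRank_of_injective_comp (J := ContinuousLinearMap.id ℂ L2)
    (fun _ _ h => h) (w := hW.memLp_two.toLp W)
    (c := fun f => ∫ y, (4 * Real.pi : ℂ)⁻¹ * mulOp χ f y) fun f => ?_
  rw [← mulOp_profileOp_linData h hW hχ, ← toL2L_apply]
  rfl

theorem BallSupp.testLInf {a : ℝ} {ρ : Test} (hρ : BallSupp a ρ) : BallSupp a (testLInf ρ) := by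
  filter_upwards [coeFn_testLInf ρ, show ∀ᵐ x ∂(volume : Measure E3), a < ‖x‖ → ρ x = 0 from hρ]
    with x h1 h2 h3
  rw [h1, h2 h3]

theorem testMul_comp_linData_mem_finiteRank {a b n : ℕ} (h : a + b ≤ n) {ρ : Test} {χ : LInf}
    (hρ : BallSupp a ρ) (hχ : BallSupp b χ) :
    testMul ρ ∘L profileOp (natCast_add_two_nonneg n) (linData n) ∘L mulOp χ ∈
      finiteRank L2 H4 := by
  refine mem_finiteRank_of_injective_comp (J := toL2L)
    (fun u v h => toL2_injective (by rwa [toL2L_apply, toL2L_apply] at h))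
    (w := hρ.testLInf.memLp_two.toLp _)
    (c := fun f => ∫ y, (4 * Real.pi : ℂ)⁻¹ * mulOp χ f y) fun f => ?_
  rw [← mulOp_profileOp_linData h hρ.testLInf hχ, toL2L_apply]
  rfl

/-- The only possible pole is `k = 0`. The numerator vanishes there, so the pole is simple, and its
residue is `(1 + i)/2` times the operator of the linear profile. -/
theorem isMeromorphicFamilyAt_waveOp {Z : Type*} [NormedAddCommGroup Z] [NormedSpace ℂ Z] {n : ℕ}
    {C : H4 →L[ℂ] Z} {χ : LInf}
    (h : C ∘L profileOp (natCast_add_two_nonneg n) (linData n) ∘L mulOp χ ∈ finiteRank L2 Z)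
    (k : ℂ) : IsMeromorphicFamilyAt (fun k => C ∘L waveOp n k ∘L mulOp χ) k := by
  rcases eq_or_ne k 0 with rfl | hk
  · set N : ℂ → L2 →L[ℂ] H4 := fun k => profileOp (natCast_add_two_nonneg n) (waveData n k) with hN
    have hNa : AnalyticAt ℂ N 0 := analyticAt_profileOp_waveData n 0
    have hN0 : N 0 = 0 := by simp [hN, waveData_zero]
    have hNd : HasDerivAt N (((2 : ℂ)⁻¹ * (Complex.I + 1)) •
        profileOp (natCast_add_two_nonneg n) (linData n)) 0 := by
      have h1 := (profileOp (natCast_add_two_nonneg n)).hasFDerivAt.comp_hasDerivAt (0 : ℂ)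
        (hasDerivAt_waveData_zero n)
      refine h1.congr_deriv ?_
      simp only [map_smul, map_sub, mul_smul, add_smul, neg_smul, one_smul, sub_neg_eq_add]
    have hD := hNa.dslope_self
    have hfr : ((2 : ℂ)⁻¹ * (Complex.I + 1)) •
        (C ∘L profileOp (natCast_add_two_nonneg n) (linData n) ∘L mulOp χ) ∈ finiteRank L2 Z :=
      (finiteRank L2 Z).smul_mem _ h
    have m1 := IsMeromorphicFamilyAt.inv_pow_smul_finiteRank (a := 0) hfr 0
    have m2 := IsMeromorphicFamilyAt.of_analyticAt ((analyticAt_const (v := C)).clmComp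
      (hD.dslope_self.clmComp (analyticAt_const (v := mulOp χ))))
    refine (m1.add m2).congr ?_
    filter_upwards [self_mem_nhdsWithin] with k hk
    have hk : k ≠ 0 := hk
    -- Second order Taylor expansion at `0`: after division by `k²` only the first order term is
    -- singular.
    have e1 : N k = k • (dslope N 0 0 + k • dslope (dslope N 0) 0 k) := by
      have s1 := sub_smul_dslope N 0 k
      have s2 := sub_smul_dslope (dslope N 0) 0 k
      rw [sub_zero] at s1 s2
      rw [s2, add_sub_cancel, s1, hN0, sub_zero]
    have e2 : waveOp n k = k⁻¹ • dslope N 0 0 + dslope (dslope N 0) 0 k := by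
      change (k ^ 2)⁻¹ • N k = _
      rw [e1, smul_smul, smul_add, smul_smul]
      congr 2
      · field_simp
      · have : (k ^ 2)⁻¹ * k * k = 1 := by field_simp
        rw [this, one_smul]
    rw [e2, dslope_same, hNd.deriv]
    simp only [ContinuousLinearMap.add_comp, ContinuousLinearMap.comp_add,
      ContinuousLinearMap.smul_comp, ContinuousLinearMap.comp_smul, sub_zero, zero_add, pow_one]
  · exact IsMeromorphicFamilyAt.of_analyticAt (analyticAt_const.clmComp
      ((analyticAt_waveOp n hk).clmComp analyticAt_const))

end WaveOp

/-! ### The local resolvent -/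

section LocalRes

theorem ae_of_forall_ball {p : E3 → Prop}
    (h : ∀ a : ℕ, ∀ᵐ x ∂(volume : Measure E3), ‖x‖ ≤ a → p x) : ∀ᵐ x ∂(volume : Measure E3), p x := by
  filter_upwards [ae_all_iff.mpr h] with x hx
  obtain ⟨a, ha⟩ := exists_nat_ge ‖x‖
  exact hx a ha

theorem CompSupp.exists_nat {f : E3 → ℂ} (hf : CompSupp f) : ∃ b : ℕ, BallSupp b f := by
  obtain ⟨r, -, hr⟩ := hf.exists_ballSupp
  obtain ⟨b, hb⟩ := exists_nat_ge r
  exact ⟨b, hr.mono hb⟩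

theorem BallSupp.compSupp {r : ℝ} {f : E3 → ℂ} (hf : BallSupp r f) : CompSupp f := by
  refine ⟨Metric.closedBall 0 r, isCompact_closedBall _ _, ?_⟩
  filter_upwards [show ∀ᵐ x ∂(volume : Measure E3), r < ‖x‖ → f x = 0 from hf] with x hx h
  exact hx (by simpa using h)

theorem exists_ballSupp_test (ρ : Test) : ∃ a : ℕ, BallSupp a ρ :=
  CompSupp.exists_nat ⟨tsupport ρ, ρ.hasCompactSupport,
    Eventually.of_forall fun _ hx => image_eq_zero_of_notMem_tsupport hx⟩

/-- The convolution of a function in `L²_comp(ℝ³)` with the kernel of the free resolvent. -/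
noncomputable def potential (k : ℂ) (f : L2) : Meas :=
  AEEqFun.mk (fun x => ∫ y, freeKernel k (x - y) * f y) <| by
    have hc : Continuous (freeKernel k) := continuous_const.mul (continuous_profileKernel
      (continuous_of_hasDerivAt (hasDerivAt_wave k)) (hasDerivAt_wave k 0).differentiableAt)
    refine StronglyMeasurable.aestronglyMeasurable
      (StronglyMeasurable.integral_prod_right' (f := fun p : E3 × E3 => freeKernel k (p.1 - p.2) * f p.2)
        (StronglyMeasurable.mul ?_ ?_))
    · exact (hc.comp (continuous_fst.sub continuous_snd)).stronglyMeasurable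
    · exact (Lp.stronglyMeasurable f).comp_measurable measurable_snd

theorem coeFn_potential (k : ℂ) (f : L2) :
    potential k f =ᵐ[volume] fun x => ∫ y, freeKernel k (x - y) * f y := AEEqFun.coeFn_mk _ _

theorem potential_ae_eq {a b n : ℕ} (h : a + b ≤ n) (k : ℂ) {f : L2} (hf : BallSupp b f) :
    ∀ᵐ x ∂(volume : Measure E3), ‖x‖ ≤ a → potential k f x = (waveOp n k f).toL2 x := by
  filter_upwards [coeFn_potential k f, waveOp_ae_eq h k hf] with x h1 h2 hx
  rw [h1, h2 hx]

theorem potential_eq_freeResL2 {k : ℂ} (hk : k ∈ firstQuadrant) (f : L2) :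
    potential k f = (freeResL2 (k ^ 4) f : Meas) := by
  apply AEEqFun.ext
  filter_upwards [coeFn_potential k f, freeResL2_ae_eq hk f] with x h1 h2
  rw [h1, h2, DecayingKernel.convAt_apply]

theorem BallSupp.add {r : ℝ} {f g : L2} (hf : BallSupp r f) (hg : BallSupp r g) :
    BallSupp r (f + g : L2) := by
  filter_upwards [show ∀ᵐ x ∂(volume : Measure E3), r < ‖x‖ → f x = 0 from hf,
    show ∀ᵐ x ∂(volume : Measure E3), r < ‖x‖ → g x = 0 from hg, Lp.coeFn_add f g] with x h1 h2 h3 h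
  rw [h3, Pi.add_apply, h1 h, h2 h, add_zero]

theorem BallSupp.smul {r : ℝ} (c : ℂ) {f : L2} (hf : BallSupp r f) : BallSupp r (c • f : L2) := by
  filter_upwards [show ∀ᵐ x ∂(volume : Measure E3), r < ‖x‖ → f x = 0 from hf,
    Lp.coeFn_smul c f] with x h1 h2 h
  rw [h2, Pi.smul_apply, h1 h, smul_zero]

theorem BallSupp.sub {r : ℝ} {f g : L2} (hf : BallSupp r f) (hg : BallSupp r g) :
    BallSupp r (f - g : L2) := by
  have h := hf.add (hg.smul (-1))
  rwa [neg_one_smul, ← sub_eq_add_neg] at h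

theorem exists_ballSupp_pair {f g : L2} (hf : CompSupp f) (hg : CompSupp g) :
    ∃ b : ℕ, BallSupp b f ∧ BallSupp b g := by
  obtain ⟨b, hb⟩ := hf.exists_nat
  obtain ⟨c, hc⟩ := hg.exists_nat
  exact ⟨max b c, hb.mono (by exact_mod_cast le_max_left b c),
    hc.mono (by exact_mod_cast le_max_right b c)⟩

/-- The continuation of the free resolvent to operators from `L²_comp(ℝ³)` to `H⁴_loc(ℝ³)`. -/
noncomputable def localRes (k : ℂ) : L2comp →ₗ[ℂ] H4loc where
  toFun f := ⟨potential k f, fun ρ => by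
    obtain ⟨a, ha⟩ := exists_ballSupp_test ρ
    obtain ⟨b, hb⟩ := CompSupp.exists_nat f.2
    refine ⟨testMul ρ (waveOp (a + b) k f), ?_⟩
    filter_upwards [coeFn_testMul ρ (waveOp (a + b) k f), potential_ae_eq le_rfl k hb,
      show ∀ᵐ x ∂(volume : Measure E3), (a : ℝ) < ‖x‖ → ρ x = 0 from ha] with x h1 h2 h3
    rw [h1]
    rcases le_or_gt ‖x‖ a with h4 | h4
    · rw [h2 h4]
    · rw [h3 h4, zero_mul, zero_mul]⟩
  -- On each ball the potential agrees with the linear operator `waveOp`, so linearity requires no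
  -- integrability of the uncut kernel.
  map_add' f g := Subtype.ext <| AEEqFun.ext <| ae_of_forall_ball fun a => by
    obtain ⟨b, hf, hg⟩ := exists_ballSupp_pair f.2 g.2
    filter_upwards [potential_ae_eq (le_refl (a + b)) k hf, potential_ae_eq (le_refl (a + b)) k hg,
      potential_ae_eq (le_refl (a + b)) k (hf.add hg),
      AEEqFun.coeFn_add (potential k f) (potential k g),
      Lp.coeFn_add (waveOp (a + b) k f).toL2 (waveOp (a + b) k g).toL2] with x h1 h2 h3 h4 h5 hx
    refine (h3 hx).trans (Eq.trans ?_ h4.symm)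
    rw [map_add, map_add, h5, Pi.add_apply, Pi.add_apply, h1 hx, h2 hx]
  map_smul' c f := Subtype.ext <| AEEqFun.ext <| ae_of_forall_ball fun a => by
    obtain ⟨b, hf⟩ := CompSupp.exists_nat f.2
    filter_upwards [potential_ae_eq (le_refl (a + b)) k hf,
      potential_ae_eq (le_refl (a + b)) k (hf.smul c),
      AEEqFun.coeFn_smul c (potential k f),
      Lp.coeFn_smul c (waveOp (a + b) k f).toL2] with x h1 h2 h3 h4 hx
    refine (h2 hx).trans (Eq.trans ?_ h3.symm)
    rw [map_smul, map_smul, h4, Pi.smul_apply, Pi.smul_apply, h1 hx]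

end LocalRes

end BiSchrodinger

namespace BiSchrodinger

/-! ### The Birman–Schwinger operator -/

section Birman

theorem approximable_comp_right {X Y Z : Type*} [NormedAddCommGroup X] [NormedSpace ℂ X]
    [NormedAddCommGroup Y] [NormedSpace ℂ Y] [NormedAddCommGroup Z] [NormedSpace ℂ Z]
    {B : Y →L[ℂ] Z} (hB : B ∈ approximable Y Z) (C : X →L[ℂ] Y) : B ∘L C ∈ approximable X Z :=
  map_mem_closure (f := fun B : Y →L[ℂ] Z => B ∘L C)
    (((ContinuousLinearMap.compL ℂ X Y Z).flip C).continuous) hB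
    fun _ h => finiteRank_comp_right h C

/-- The continuation of the operator `V (Δ² - k⁴)⁻¹ χ`, where `V` is supported in the ball of
radius `b` and `χ` is the characteristic function of that ball. -/
noncomputable def birman (V : LInf) (b : ℕ) (k : ℂ) : L2 →L[ℂ] L2 :=
  (mulOp V ∘L toL2L) ∘L waveOp (b + b) k ∘L mulOp (ballInd b)

variable {V : LInf} {b : ℕ}

theorem mulOp_toL2_waveOp {n c : ℕ} (hV : BallSupp b V) (hn : b + c ≤ n) (k : ℂ) {f : L2}
    (hf : BallSupp c f) {u : L2} (hu : potential k f = (u : Meas)) :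
    mulOp V (waveOp n k f).toL2 = mulOp V u := by
  refine mulOp_eq_of_ae hV ?_
  filter_upwards [potential_ae_eq hn k hf] with x hx h
  rw [← hx h, hu]

theorem mulOp_toL2_waveOp_congr {n n' c c' : ℕ} (hV : BallSupp b V) (hn : b + c ≤ n)
    (hn' : b + c' ≤ n') (k : ℂ) {f : L2} (hf : BallSupp c f) (hf' : BallSupp c' f) :
    mulOp V (waveOp n k f).toL2 = mulOp V (waveOp n' k f).toL2 := by
  refine mulOp_eq_of_ae hV ?_
  filter_upwards [potential_ae_eq hn k hf, potential_ae_eq hn' k hf'] with x hx hx' h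
  rw [← hx h, hx' h]

theorem isMeromorphicFamilyAt_birman (hV : BallSupp b V) (k : ℂ) :
    IsMeromorphicFamilyAt (birman V b) k :=
  isMeromorphicFamilyAt_waveOp
    (mulOp_comp_linData_mem_finiteRank le_rfl hV (ballSupp_ballInd b)) k

theorem analyticAt_birman {k : ℂ} (hk : k ≠ 0) : AnalyticAt ℂ (birman V b) k :=
  analyticAt_const.clmComp ((analyticAt_waveOp (b + b) hk).clmComp analyticAt_const)

/-- The cut-off kernel has compact support, so the Hilbert–Schmidt argument works for every `k`,
including those where the free kernel grows. -/
theorem birman_mem_approximable (hV : BallSupp b V) (k : ℂ) :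
    birman V b k ∈ approximable L2 L2 := by
  have hp := isProfile_wave (b + b) k
  have hL := natCast_add_two_nonneg (b + b)
  have h1 := (hp.decayingKernel hL).mulOp_fm_mem_approximable (hp.profileSymbol_apply hL)
    hV.memLp_two
  rw [← toL2L_comp_profileOp] at h1
  have h2 := approximable_comp_right ((approximable L2 L2).smul_mem (k ^ 2)⁻¹ h1)
    (mulOp (ballInd b))
  convert h2 using 1
  ext1 f
  simp [birman, waveOp]

theorem birman_eq {k : ℂ} (hV : BallSupp b V) (hk : k ∈ firstQuadrant) (f : L2) :
    birman V b k f = mulOp V (freeResL2 (k ^ 4) (mulOp (ballInd b) f)) := by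
  rw [← mulOp_toL2_waveOp hV le_rfl k ((ballSupp_ballInd b).mulOp f)
    (potential_eq_freeResL2 hk _), ← toL2L_apply]
  rfl

theorem norm_birman_le {k : ℂ} (hV : BallSupp b V) (hk : k ∈ firstQuadrant) :
    ‖birman V b k‖ ≤ ‖k‖⁻¹ * (‖hV.memLp_two.toLp V‖ *
      ‖(ballSupp_ballInd b).memLp_two.toLp (ballInd b)‖) := by
  have h1 : birman V b k = mulOp V ∘L freeResL2 (k ^ 4) ∘L mulOp (ballInd b) := by
    ext1 f
    exact birman_eq hV hk f
  rw [h1, freeResL2_eq_fm]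
  refine (decayingKernel_freeKernel hk).norm_mulOp_fm_mulOp_le (fun ξ => ?_) _ _ (by positivity)
    (norm_freeKernel_le hk)
  rw [fourier_freeKernel hk, resolventSymbol_apply (pow_four_ne_of_mem_firstQuadrant hk)]

theorem exists_isUnit_one_add_birman (hV : BallSupp b V) :
    ∃ M : ℝ, ∀ k ∈ firstQuadrant, M < ‖k‖ → IsUnit (1 + birman V b k) := by
  refine ⟨‖hV.memLp_two.toLp V‖ * ‖(ballSupp_ballInd b).memLp_two.toLp (ballInd b)‖,
    fun k hk hM => ?_⟩
  have h0 : 0 < ‖k‖ := norm_pos_iff.mpr fun h => by simpa [h] using hk.1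
  have h1 : ‖-birman V b k‖ < 1 := by
    rw [norm_neg]
    refine (norm_birman_le hV hk).trans_lt ?_
    rwa [inv_mul_lt_iff₀ h0, mul_one]
  have h2 := isUnit_one_sub_of_norm_lt_one h1
  rwa [sub_neg_eq_add] at h2

theorem isOpen_firstQuadrant : IsOpen firstQuadrant :=
  (isOpen_lt continuous_const Complex.continuous_re).inter
    (isOpen_lt continuous_const Complex.continuous_im)

theorem ne_zero_of_mem_firstQuadrant {k : ℂ} (hk : k ∈ firstQuadrant) : k ≠ 0 :=
  fun h => by simpa [h] using hk.1

theorem birman_fredholm (hV : BallSupp b V) (a : ℂ) :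
    (∀ᶠ k in 𝓝[≠] a, IsUnit (1 + birman V b k)) ∧
      IsMeromorphicFamilyAt (fun k => Ring.inverse (1 + birman V b k)) a := by
  refine meromorphic_fredholm (isMeromorphicFamilyAt_birman hV)
    (fun _ => Eventually.of_forall fun k => birman_mem_approximable hV k) ?_ a
  obtain ⟨M, hM⟩ := exists_isUnit_one_add_birman hV
  -- The norm of this point is at least its real part `|M| + 1`, hence exceeds `M`.
  have ht : ((|M| + 1 : ℝ) : ℂ) * (1 + Complex.I) ∈ firstQuadrant := by
    constructor <;> simp <;> positivity
  refine ⟨_, nhdsWithin_le_nhds (eventually_isUnit ?_ (hM _ ht ?_))⟩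
  · exact continuousAt_const.add (analyticAt_birman (ne_zero_of_mem_firstQuadrant ht)).continuousAt
  · refine lt_of_lt_of_le ?_ (Complex.re_le_norm _)
    simp only [Complex.re_ofReal_mul, Complex.add_re, Complex.one_re, Complex.I_re, add_zero,
      mul_one]
    linarith [le_abs_self M]

/-- The exceptional set of the continued resolvent. -/
def exceptional (V : LInf) (b : ℕ) : Set ℂ := {k | k = 0 ∨ ¬IsUnit (1 + birman V b k)}

/-- Near each point `a` the Fredholm theorem leaves no exceptional point except possibly `a`;
compactness does the rest. -/
theorem finite_exceptional_inter (hV : BallSupp b V) {K : Set ℂ} (hK : IsCompact K) :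
    (exceptional V b ∩ K).Finite := by
  refine hK.induction_on (p := fun s => (exceptional V b ∩ s).Finite) (by simp)
    (fun s t hst ht => ht.subset (inter_subset_inter_right _ hst)) (fun s t hs ht => ?_) fun a _ => ?_
  · rw [inter_union_distrib_left]
    exact hs.union ht
  · have h1 : ∀ᶠ k in 𝓝[≠] a, k ∉ exceptional V b := by
      have h0 : ∀ᶠ k in 𝓝[≠] a, k ≠ 0 := by
        rcases eq_or_ne a 0 with rfl | ha
        · exact self_mem_nhdsWithin
        · exact nhdsWithin_le_nhds (isOpen_ne.mem_nhds ha)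
      filter_upwards [h0, (birman_fredholm hV a).1] with k hk hu
      rintro (h | h)
      exacts [hk h, h hu]
    have h2 : ∀ᶠ k in 𝓝 a, k ≠ a → k ∉ exceptional V b := eventually_nhdsWithin_iff.mp h1
    refine ⟨{k | k ≠ a → k ∉ exceptional V b}, nhdsWithin_le_nhds h2,
      (finite_singleton a).subset ?_⟩
    rintro k ⟨hk, hk'⟩
    by_contra hne
    exact hk' hne hk

end Birman

/-! ### The resolvent in the first quadrant -/

section Quadrant

variable {V : LInf} {b : ℕ}

theorem res_eq {X : Type*} [NormedAddCommGroup X] [NormedSpace ℂ X] {A : X →ₗ.[ℂ] X} {z : ℂ}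
    {R : X →L[ℂ] X} (h : IsResolventAt A z R) : res A z = R := by
  have h1 : z ∈ resSet A := ⟨R, h⟩
  rw [res, dif_pos h1]
  exact h1.choose_spec.unique h

theorem isResolventAt_biSchrodinger_iff {V : LInf} {z : ℂ} {R : L2 →L[ℂ] L2} :
    IsResolventAt (biSchrodinger V) z R ↔
      (∀ f : L2, ∃ u : sobolevFour, (u : L2) = R f ∧
        bilaplacian u + mulOp V u - z • (u : L2) = f) ∧
      ∀ u : sobolevFour, R (bilaplacian u + mulOp V u - z • (u : L2)) = u := Iff.rfl

theorem exists_bilaplacian_sub_eq {z : ℂ} (hz : ∀ t : ℝ, 0 ≤ t → (t : ℂ) ≠ z) (f : L2) :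
    ∃ u : sobolevFour, (u : L2) = freeResL2 z f ∧ bilaplacian u - z • (u : L2) = f := by
  have h : (freeRes z f).toL2 = freeResL2 z f := (freeResL2_apply z f).symm
  exact ⟨(freeRes z f : sobolevFour), h, by
    rw [show Subtype.val _ = freeResL2 z f from h]
    exact bilaplacian_sub_freeRes hz f⟩

/-- The solution of `g + K g = h` is `h - K g`, and `K g` carries the factor `V`. Where the inverse
does not exist, `Ring.inverse` is `0`. -/
theorem ballSupp_inverse_one_add_birman (hV : BallSupp b V) (k : ℂ) {h : L2} (hh : BallSupp b h) :
    BallSupp b (Ring.inverse (1 + birman V b k) h) := by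
  by_cases hu : IsUnit (1 + birman V b k)
  · have h1 : (1 + birman V b k) (Ring.inverse (1 + birman V b k) h) = h := by
      have h2 := congrArg (fun T : L2 →L[ℂ] L2 => T h) (Ring.mul_inverse_cancel _ hu)
      exact h2
    rw [add_apply, one_apply_eq_self] at h1
    rw [← eq_sub_iff_add_eq] at h1
    rw [h1]
    exact hh.sub (hV.mulOp _)
  · rw [Ring.inverse_non_unit _ hu, zero_apply]
    have h1 := hh.smul 0
    rwa [zero_smul] at h1

/-- The resolvent identity, as a formula for the resolvent of `Δ² + V`. -/
noncomputable def resolventFormula (V : LInf) (b : ℕ) (k : ℂ) : L2 →L[ℂ] L2 :=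
  freeResL2 (k ^ 4) - freeResL2 (k ^ 4) ∘L Ring.inverse (1 + birman V b k) ∘L mulOp V ∘L
    freeResL2 (k ^ 4)

theorem resolventFormula_apply (k : ℂ) (f : L2) : resolventFormula V b k f =
    freeResL2 (k ^ 4) (f - Ring.inverse (1 + birman V b k) (mulOp V (freeResL2 (k ^ 4) f))) := by
  rw [map_sub]
  rfl

theorem birman_eq_of_ballSupp {k : ℂ} (hV : BallSupp b V) (hk : k ∈ firstQuadrant) {f : L2}
    (hf : BallSupp b f) : birman V b k f = mulOp V (freeResL2 (k ^ 4) f) := by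
  rw [birman_eq hV hk, mulOp_ballInd hf]

theorem isResolventAt_resolventFormula {k : ℂ} (hV : BallSupp b V) (hk : k ∈ firstQuadrant)
    (hu : IsUnit (1 + birman V b k)) :
    IsResolventAt (biSchrodinger V) (k ^ 4) (resolventFormula V b k) := by
  have hz := pow_four_ne_of_mem_firstQuadrant hk
  refine isResolventAt_biSchrodinger_iff.mpr ⟨?_, ?_⟩
  · intro f
    set h := mulOp V (freeResL2 (k ^ 4) f) with hh
    set g := Ring.inverse (1 + birman V b k) h with hg
    have hgs : BallSupp b g := ballSupp_inverse_one_add_birman hV k (hV.mulOp _)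
    -- As `g` is supported in the ball, `K g = V R₀ g` without the cutoff. Hence `u = R₀ (f - g)`
    -- gives `(Δ² - k⁴) u + V u = f - g + h - V R₀ g = f`.
    have hgK : g + mulOp V (freeResL2 (k ^ 4) g) = h := by
      rw [← birman_eq_of_ballSupp hV hk hgs]
      exact congrArg (fun T : L2 →L[ℂ] L2 => T h) (Ring.mul_inverse_cancel _ hu)
    obtain ⟨u, h1, h2⟩ := exists_bilaplacian_sub_eq hz (f - g)
    refine ⟨u, by rw [h1, resolventFormula_apply], ?_⟩
    rw [add_sub_right_comm, h2, h1, map_sub, map_sub, ← hh, ← hgK]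
    abel
  · intro u
    rw [resolventFormula_apply]
    have h1 := freeResL2_bilaplacian_sub hz u
    have h2 : freeResL2 (k ^ 4) (bilaplacian u + mulOp V u - k ^ 4 • (u : L2)) =
        u + freeResL2 (k ^ 4) (mulOp V u) := by
      rw [add_sub_right_comm, map_add, h1]
    -- The argument of the inverse is `(1 + K) (V u)`.
    have h3 : Ring.inverse (1 + birman V b k) (mulOp V (u + freeResL2 (k ^ 4) (mulOp V u))) =
        mulOp V u := by
      rw [map_add, ← birman_eq_of_ballSupp hV hk (hV.mulOp _)]
      exact congrArg (fun T : L2 →L[ℂ] L2 => T (mulOp V u)) (Ring.inverse_mul_cancel _ hu)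
    rw [map_sub, h2, h3, add_sub_cancel_right]

/-- The inverse of `1 + V R₀ χ` is `1 - V R χ`. The two products reduce to the two resolvent
identities `R = R₀ - R₀ V R` and `R + R V R₀ = R₀`. -/
theorem isUnit_of_mem_resSet {k : ℂ} (hV : BallSupp b V) (hk : k ∈ firstQuadrant)
    (hr : k ^ 4 ∈ resSet (biSchrodinger V)) : IsUnit (1 + birman V b k) := by
  obtain ⟨R, hR⟩ := hr
  obtain ⟨hR1, hR2⟩ := isResolventAt_biSchrodinger_iff.mp hR
  have hz := pow_four_ne_of_mem_firstQuadrant hk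
  have e1 : ∀ f, R f = freeResL2 (k ^ 4) f - freeResL2 (k ^ 4) (mulOp V (R f)) := by
    intro f
    obtain ⟨u, hu, hf⟩ := hR1 f
    have h1 := freeResL2_bilaplacian_sub hz u
    have h2 : bilaplacian u - k ^ 4 • (u : L2) = f - mulOp V u := by
      rw [← hf]
      abel
    rw [h2, map_sub, hu] at h1
    exact h1.symm
  have e2 : ∀ f, R f + R (mulOp V (freeResL2 (k ^ 4) f)) = freeResL2 (k ^ 4) f := by
    intro f
    obtain ⟨u, h1, h2⟩ := exists_bilaplacian_sub_eq hz f
    have h3 := hR2 u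
    rw [add_sub_right_comm, h2, h1, map_add] at h3
    exact h3
  have hχ : ∀ f, mulOp (ballInd b) (mulOp V f) = mulOp V f := fun f => mulOp_ballInd (hV.mulOp f)
  refine ⟨⟨1 + birman V b k, 1 - mulOp V ∘L R ∘L mulOp (ballInd b), ?_, ?_⟩, rfl⟩
  · ext1 f
    change (f - mulOp V (R (mulOp (ballInd b) f))) +
      birman V b k (f - mulOp V (R (mulOp (ballInd b) f))) = f
    rw [birman_eq hV hk, map_sub, hχ, map_sub, ← e1]
    abel
  · ext1 f
    change (f + birman V b k f) - mulOp V (R (mulOp (ballInd b) (f + birman V b k f))) = f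
    rw [birman_eq hV hk, map_add, hχ, map_add, e2]
    abel

theorem mem_resSet_iff {k : ℂ} (hV : BallSupp b V) (hk : k ∈ firstQuadrant) :
    k ^ 4 ∈ resSet (biSchrodinger V) ↔ IsUnit (1 + birman V b k) :=
  ⟨isUnit_of_mem_resSet hV hk, fun hu => ⟨_, isResolventAt_resolventFormula hV hk hu⟩⟩

theorem exceptional_inter_firstQuadrant (hV : BallSupp b V) :
    exceptional V b ∩ firstQuadrant = quadrantPoles V := by
  ext k
  constructor
  · rintro ⟨h, hk⟩
    refine ⟨hk, ?_⟩
    rw [mem_resSet_iff hV hk]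
    exact h.resolve_left (ne_zero_of_mem_firstQuadrant hk)
  · rintro ⟨hk, h⟩
    rw [mem_resSet_iff hV hk] at h
    exact ⟨Or.inr h, hk⟩

/-- Large `k` are excluded by the norm bound. The rest lie in a closed ball of the plane, where the
exceptional set of the continued family is finite, so nothing accumulates on the axes or at `0`. -/
theorem finite_quadrantPoles (hV : BallSupp b V) : (quadrantPoles V).Finite := by
  obtain ⟨M, hM⟩ := exists_isUnit_one_add_birman hV
  refine (finite_exceptional_inter hV (isCompact_closedBall (0 : ℂ) M)).subset ?_
  rw [← exceptional_inter_firstQuadrant hV]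
  rintro k ⟨h, hk⟩
  refine ⟨h, ?_⟩
  rw [mem_closedBall_zero_iff]
  by_contra hlt
  exact (h.resolve_left (ne_zero_of_mem_firstQuadrant hk)) (hM k hk (not_le.mp hlt))

theorem RV_eq {k : ℂ} (hV : BallSupp b V) (hk : k ∈ firstQuadrant)
    (hu : IsUnit (1 + birman V b k)) : RV V k = resolventFormula V b k :=
  res_eq (isResolventAt_resolventFormula hV hk hu)

theorem analyticAt_freeResL2_pow {k : ℂ} (hk : k ∈ firstQuadrant) :
    AnalyticAt ℂ (fun k : ℂ => freeResL2 (k ^ 4)) k :=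
  AnalyticAt.fun_comp (f := fun k : ℂ => k ^ 4)
    (analyticAt_freeResL2 (pow_four_ne_of_mem_firstQuadrant hk)) (analyticAt_id.pow 4)

theorem analyticAt_inverse_birman {k : ℂ} (hk : k ≠ 0) (hu : IsUnit (1 + birman V b k)) :
    AnalyticAt ℂ (fun k => Ring.inverse (1 + birman V b k)) k :=
  analyticAt_ringInverse (analyticAt_const.add (analyticAt_birman hk)) hu

theorem analyticAt_RV {k : ℂ} (hV : BallSupp b V) (hk : k ∈ firstQuadrant)
    (hu : IsUnit (1 + birman V b k)) : AnalyticAt ℂ (RV V) k := by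
  have hk0 := ne_zero_of_mem_firstQuadrant hk
  have h1 := analyticAt_freeResL2_pow hk
  have h2 : AnalyticAt ℂ (resolventFormula V b) k :=
    h1.sub (h1.clmComp ((analyticAt_inverse_birman hk0 hu).clmComp (analyticAt_const.clmComp h1)))
  refine h2.congr ?_
  filter_upwards [isOpen_firstQuadrant.mem_nhds hk,
    eventually_isUnit (continuousAt_const.add (analyticAt_birman hk0).continuousAt) hu] with l hl hlu
  exact (RV_eq hV hl hlu).symm

theorem isMeromorphicFamilyAt_RV {k : ℂ} (hV : BallSupp b V) (hk : k ∈ firstQuadrant) :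
    IsMeromorphicFamilyAt (RV V) k := by
  have h1 := IsMeromorphicFamilyAt.of_analyticAt (analyticAt_freeResL2_pow hk)
  have h2 := h1.sub (h1.comp ((birman_fredholm hV k).2.comp (h1.comp_left (mulOp V))))
  refine h2.congr ?_
  filter_upwards [nhdsWithin_le_nhds (isOpen_firstQuadrant.mem_nhds hk), (birman_fredholm hV k).1]
    with l hl hlu
  exact (RV_eq hV hl hlu).symm

end Quadrant

/-! ### The continued resolvent -/

section Continuation

variable {V : LInf} {b : ℕ}

/-- The product of `V` and the local free resolvent. -/
noncomputable def localMul (hV : BallSupp b V) (k : ℂ) : L2comp →ₗ[ℂ] L2 where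
  -- The radius is a choice that depends on `f`. Linearity holds because any larger radius gives the
  -- same product with `V`.
  toFun f := mulOp V (waveOp (b + (CompSupp.exists_nat f.2).choose) k f).toL2
  map_add' f g := by
    obtain ⟨c, hf, hg⟩ := exists_ballSupp_pair f.2 g.2
    rw [mulOp_toL2_waveOp_congr hV le_rfl le_rfl k (CompSupp.exists_nat f.2).choose_spec hf,
      mulOp_toL2_waveOp_congr hV le_rfl le_rfl k (CompSupp.exists_nat g.2).choose_spec hg,
      mulOp_toL2_waveOp_congr hV le_rfl le_rfl k (CompSupp.exists_nat (f + g).2).choose_spec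
        (hf.add hg), Submodule.coe_add, map_add, map_add, map_add]
  map_smul' c f := by
    have hf := (CompSupp.exists_nat f.2).choose_spec
    rw [mulOp_toL2_waveOp_congr hV le_rfl le_rfl k (CompSupp.exists_nat (c • f).2).choose_spec
      (hf.smul c), Submodule.coe_smul, map_smul, map_smul, map_smul, RingHom.id_apply]

theorem localMul_eq (hV : BallSupp b V) {n c : ℕ} (hn : b + c ≤ n) (k : ℂ) {f : L2comp}
    (hf : BallSupp c (f : L2)) : localMul hV k f = mulOp V (waveOp n k f).toL2 :=
  mulOp_toL2_waveOp_congr hV le_rfl hn k (CompSupp.exists_nat f.2).choose_spec hf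

theorem localMul_eq_freeResL2 (hV : BallSupp b V) {k : ℂ} (hk : k ∈ firstQuadrant) (f : L2comp) :
    localMul hV k f = mulOp V (freeResL2 (k ^ 4) f) :=
  mulOp_toL2_waveOp hV le_rfl k (CompSupp.exists_nat f.2).choose_spec (potential_eq_freeResL2 hk _)

theorem ballSupp_localMul (hV : BallSupp b V) (k : ℂ) (f : L2comp) :
    BallSupp b (localMul hV k f) := hV.mulOp _

/-- The correction of the source term in the resolvent identity. -/
noncomputable def correction (hV : BallSupp b V) (k : ℂ) : L2comp →ₗ[ℂ] L2comp :=
  LinearMap.codRestrict L2comp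
    ((Ring.inverse (1 + birman V b k) : L2 →L[ℂ] L2).toLinearMap ∘ₗ localMul hV k)
    fun f => (ballSupp_inverse_one_add_birman hV k (ballSupp_localMul hV k f)).compSupp

theorem coe_correction (hV : BallSupp b V) (k : ℂ) (f : L2comp) :
    (correction hV k f : L2) = Ring.inverse (1 + birman V b k) (localMul hV k f) := rfl

theorem ballSupp_correction (hV : BallSupp b V) (k : ℂ) (f : L2comp) :
    BallSupp b (correction hV k f : L2) :=
  ballSupp_inverse_one_add_birman hV k (ballSupp_localMul hV k f)

/-- The continued resolvent. -/
noncomputable def continuedRes (hV : BallSupp b V) (k : ℂ) : L2comp →ₗ[ℂ] H4loc :=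
  localRes k ∘ₗ (LinearMap.id - correction hV k)

theorem coe_continuedRes (hV : BallSupp b V) (k : ℂ) (f : L2comp) :
    (continuedRes hV k f : Meas) = potential k ((f : L2) - (correction hV k f : L2)) := rfl

theorem continuedRes_eq_RV (hV : BallSupp b V) {k : ℂ} (hk : k ∈ firstQuadrant)
    (hu : IsUnit (1 + birman V b k)) (f : L2comp) :
    (continuedRes hV k f : Meas) = (RV V k (f : L2) : L2) := by
  rw [coe_continuedRes, potential_eq_freeResL2 hk, RV_eq hV hk hu, resolventFormula_apply,
    coe_correction, localMul_eq_freeResL2 hV hk]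

/-- The continued resolvent between cutoffs. -/
noncomputable def cutRes (V : LInf) (b : ℕ) (ρ : Test) (n : ℕ) (k : ℂ) : L2 →L[ℂ] H4 :=
  testMul ρ ∘L waveOp n k ∘L mulOp (testLInf ρ) -
    (testMul ρ ∘L waveOp n k ∘L mulOp (ballInd b)) ∘L Ring.inverse (1 + birman V b k) ∘L
      ((mulOp V ∘L toL2L) ∘L waveOp n k ∘L mulOp (testLInf ρ))

/-- The functions `ρ`, `V` and the corrected source all live in the ball of radius `max a b`.
Differences of its points have length at most `n`, so a single cutoff parameter serves all
occurrences of the free resolvent. -/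
theorem cutRes_ae_eq (hV : BallSupp b V) {ρ : Test} {a n : ℕ} (hρ : BallSupp a ρ)
    (hn : max a b + max a b ≤ n) (k : ℂ) (f : L2) :
    ∀ᵐ x ∂(volume : Measure E3),
      (cutRes V b ρ n k f).toL2 x = ρ x * (continuedRes hV k (cutoff ρ f) : Meas) x := by
  have hf : BallSupp (max a b : ℕ) (mulOp (testLInf ρ) f) :=
    (hρ.testLInf.mulOp f).mono (by exact_mod_cast le_max_left a b)
  have ha : a ≤ max a b := le_max_left a b
  have hb : b ≤ max a b := le_max_right a b
  have hg0 := ballSupp_correction hV k (cutoff ρ f)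
  have hg : BallSupp (max a b : ℕ) (correction hV k (cutoff ρ f) : L2) :=
    hg0.mono (by exact_mod_cast hb)
  have hcut : ((cutoff ρ f : L2comp) : L2) = mulOp (testLInf ρ) f := rfl
  have h1 : cutRes V b ρ n k f =
      testMul ρ (waveOp n k ((cutoff ρ f : L2) - (correction hV k (cutoff ρ f) : L2))) := by
    have h2 : mulOp (ballInd b) (correction hV k (cutoff ρ f) : L2) =
        correction hV k (cutoff ρ f) := mulOp_ballInd hg0
    rw [map_sub, map_sub, ← h2, coe_correction,
      localMul_eq hV (n := n) (c := max a b) (by omega) k (f := cutoff ρ f) hf, hcut, ← toL2L_apply]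
    rfl
  rw [h1, coe_continuedRes]
  filter_upwards [coeFn_testMul ρ (waveOp n k ((cutoff ρ f : L2) -
      (correction hV k (cutoff ρ f) : L2))),
    potential_ae_eq (a := a) (b := max a b) (n := n) (by omega) k (hf.sub hg),
    show ∀ᵐ x ∂(volume : Measure E3), (a : ℝ) < ‖x‖ → ρ x = 0 from hρ] with x e1 e2 e3
  rw [e1]
  rcases le_or_gt ‖x‖ a with h4 | h4
  · rw [hcut, e2 h4]
  · rw [e3 h4, zero_mul, zero_mul]

theorem analyticAt_cutRes (ρ : Test) (n : ℕ) {k : ℂ} (hk : k ∉ exceptional V b) :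
    AnalyticAt ℂ (cutRes V b ρ n) k := by
  have hk0 : k ≠ 0 := fun h => hk (Or.inl h)
  have hu : IsUnit (1 + birman V b k) := by
    by_contra h
    exact hk (Or.inr h)
  have h1 := analyticAt_waveOp n hk0
  exact (analyticAt_const.clmComp (h1.clmComp analyticAt_const)).sub
    ((analyticAt_const.clmComp (h1.clmComp analyticAt_const)).clmComp
      ((analyticAt_inverse_birman hk0 hu).clmComp
        (analyticAt_const.clmComp (h1.clmComp analyticAt_const))))

/-- Each free resolvent stands between two cutoffs, so its residue at `0` has finite rank; sums and
compositions preserve meromorphic families. -/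
theorem isMeromorphicFamilyAt_cutRes (hV : BallSupp b V) {ρ : Test} {a n : ℕ} (hρ : BallSupp a ρ)
    (hn : max a b + max a b ≤ n) (k : ℂ) : IsMeromorphicFamilyAt (cutRes V b ρ n) k := by
  have ha : a ≤ max a b := le_max_left a b
  have hb : b ≤ max a b := le_max_right a b
  refine (isMeromorphicFamilyAt_waveOp (testMul_comp_linData_mem_finiteRank
    (a := a) (b := a) (by omega) hρ hρ.testLInf) k).sub
    ((isMeromorphicFamilyAt_waveOp (testMul_comp_linData_mem_finiteRank
      (a := a) (b := b) (by omega) hρ (ballSupp_ballInd b)) k).comp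
    ((birman_fredholm hV k).2.comp (isMeromorphicFamilyAt_waveOp
      (mulOp_comp_linData_mem_finiteRank (a := b) (b := a) (by omega) hV hρ.testLInf) k)))

end Continuation

end BiSchrodinger

/-! ### The main theorem -/

open BiSchrodinger in
theorem mainTheorem6 (V : LInf) (hV : CompSupp V) :
    -- the poles of the resolvent in the first quadrant are finite in number
    (quadrantPoles V).Finite ∧
    -- the resolvent is a meromorphic family on the first quadrant
    (∀ k ∈ firstQuadrant, IsMeromorphicFamilyAt (RV V) k) ∧
    (∀ k ∈ firstQuadrant \ quadrantPoles V, AnalyticAt ℂ (RV V) k) ∧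
    -- the resolvent extends to a meromorphic family on the whole complex plane
    ∃ (S : Set ℂ) (R : ℂ → L2comp →ₗ[ℂ] H4loc),
      (∀ K : Set ℂ, IsCompact K → (S ∩ K).Finite) ∧
      S ∩ firstQuadrant = quadrantPoles V ∧
      (∀ k ∈ firstQuadrant \ S, ∀ f : L2comp, (R k f : Meas) = (RV V k (f : L2) : L2)) ∧
      ∀ ρ : Test, ∃ A : ℂ → L2 →L[ℂ] H4,
        (∀ k ∉ S, ∀ f : L2,
          ∀ᵐ x ∂(MeasureTheory.volume : MeasureTheory.Measure E3),
            (A k f).toL2 x = ρ x * (R k (cutoff ρ f) : Meas) x) ∧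
        (∀ k ∉ S, AnalyticAt ℂ A k) ∧
        ∀ k : ℂ, IsMeromorphicFamilyAt A k := by
  obtain ⟨b, hb⟩ := hV.exists_nat
  have hunit : ∀ k, k ∉ exceptional V b → IsUnit (1 + birman V b k) := fun k hk => by
    by_contra h
    exact hk (Or.inr h)
  refine ⟨finite_quadrantPoles hb, fun k hk => isMeromorphicFamilyAt_RV hb hk, fun k hk => ?_,
    exceptional V b, continuedRes hb, fun K hK => finite_exceptional_inter hb hK,
    exceptional_inter_firstQuadrant hb, fun k hk f => continuedRes_eq_RV hb hk.1 (hunit k hk.2) f,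
    fun ρ => ?_⟩
  · refine analyticAt_RV hb hk.1 (hunit k fun h => hk.2 ?_)
    rw [← exceptional_inter_firstQuadrant hb]
    exact ⟨h, hk.1⟩
  · obtain ⟨a, ha⟩ := exists_ballSupp_test ρ
    exact ⟨cutRes V b ρ (max a b + max a b), fun k _ f => cutRes_ae_eq hb ha le_rfl k f,
      fun k hk => analyticAt_cutRes ρ _ hk, fun k => isMeromorphicFamilyAt_cutRes hb ha le_rfl k⟩
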